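/- For a coset $X\in\{A,V,S,C\}$ of the lattice $D_{12}$ in $D_{12}^*$ ($A=D_{12}$; $V$ the other coset of integral vectors; $S,C$ the cosets in $(\mathbb Z+\tfrac12)^{12}$ of even, respectively odd, coordinate sum), let $X$ also denote the corresponding irreducible module $S(\hat{\mathfrak h}^-)\otimes\mathbb C[X]$ of the lattice vertex algebra $V_{D_{12}}$, graded by $L_0$. Let $V^{s\natural}=A\oplus C$ ($A$ even, $C$ odd) and $V^{s\natural}_{tw}=S\oplus V$ ($S$ even, $V$ odd); the central charge is $12$. For $\sigma,\tau$ in the upper half-plane put $p=e^{2\pi i\sigma}$, $q=e^{2\pi i\tau}$ and, for $x,y\in\mathbb Z/2\mathbb Z$, $$f(1,1;\tau)=-\mathrm{Tr}_{V^{s\natural}}q^{L_0-1/2},\quad f(1,0;\tau)=\mathrm{sTr}_{V^{s\natural}}q^{L_0-1/2},\quad f(0,1;\tau)=\mathrm{Tr}_{V^{s\natural}_{tw}}q^{L_0-1/2},\quad f(0,0;\tau)=\mathrm{sTr}_{V^{s\natural}_{tw}}q^{L_0-1/2}.$$ For $m\ge1$ define the equivariant Hecke operator $$(T_mf)(x,y;\tau)=\frac1m\sum_{\substack{ad=m\\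 a,d>0}}\ \sum_{0\le b<d} f\Big(dx,\,ay-bx;\,\frac{a\tau+b}{d}\Big),$$ and let $\Psi_f(x,y;\tau)=\exp\big(-\sum_{m\ge1}p^m\,(T_mf)(x,y;\tau)\big)$ as a formal power series in $p$. Let $\eta$ be the Dedekind eta function. Then for all $\sigma,\tau$ in the upper half-plane and all $x,y$ the power series $\Psi_f(x,y;\tau)$ converges absolutely at $p=e^{2\pi i\sigma}$, and \begin{align*} p^{-1}\Psi_f(0,0;\tau)&=\frac{1}{\eta(\sigma)^{24}}-24-f(0,0;\tau),\\ p^{-1}\Psi_f(0,1;\tau)&=\frac{\eta(\sigma)^{24}}{\eta(2\sigma)^{24}}+24-f(0,1;\tau),\\ p^{-1}\Psi_f(1,0;\tau)&=f(1,0;2\sigma)-f(1,0;\tau),\\ p^{-1}\Psi_f(1,1;\tau)&=f(1,0;2\sigma)-f(1,1;\tau). \end{align*} Moreover $\Psi_f(0,0;\tau)$ and $\Psi_f(0,1;\tau)$ are the superdenominator and the denominator of the Conway superalgebra $\mathfrak g$, whose positive roots are pairs $(m,n)\in\mathbb Z_{>0}\times\mathbb Z$ with root space the subspace of $V^{s\natural}_{tw}$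 on which $L_0-\tfrac12=mn$. That is, with $\mathrm{mult}_0(m,n)$ and $\mathrm{mult}_1(m,n)$ the dimensions of the even part (in $S$) and the odd part (in $V$) of that root space, $$\Psi_f(0,0;\tau)=\prod_{m\ge1}\prod_{n\in\mathbb Z}\frac{(1-p^mq^n)^{\mathrm{mult}_0(m,n)}}{(1-p^mq^n)^{\mathrm{mult}_1(m,n)}},\qquad \Psi_f(0,1;\tau)=\prod_{m\ge1}\prod_{n\in\mathbb Z}\frac{(1-p^mq^n)^{\mathrm{mult}_0(m,n)}}{(1+p^mq^n)^{\mathrm{mult}_1(m,n)}},$$ where the first product converges unconditionally for all $\sigma,\tau$ and the second whenever $\operatorname{Im}\sigma\cdot\operatorname{Im}\tau>\tfrac12$. -/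

import Mathlib

open scoped UpperHalfPlane

noncomputable section

namespace ConwayDenominator

/-! ### The four irreducible modules `A, V, S, C` of the lattice vertex algebra of `D₁₂` -/

/-- The labels of the four cosets of `D₁₂` in its dual lattice: adjoint (vacuum), vector, spinor,
conjugate spinor. -/
inductive Sector
  | A
  | V
  | S
  | C

/-- The coset of `D₁₂` in `D₁₂*` (inside `ℚ¹²`) with the given label. -/
def coset : Sector → Set (Fin 12 → ℚ)
  | .A => {v | (∀ i, ∃ n : ℤ, v i = n) ∧ ∃ k : ℤ, ∑ i, v i = 2 * k}
  | .V => {v | (∀ i, ∃ n : ℤ, v i = n) ∧ ∃ k : ℤ, ∑ i, v i = 2 * k + 1}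
  | .S => {v | (∀ i, ∃ n : ℤ, v i = n + 1 / 2) ∧ ∃ k : ℤ, ∑ i, v i = 2 * k}
  | .C => {v | (∀ i, ∃ n : ℤ, v i = n + 1 / 2) ∧ ∃ k : ℤ, ∑ i, v i = 2 * k + 1}

/-- Labels of the standard basis of the Fock space `S(ĥ⁻) ⊗ ℂ[coset X]`: a lattice vector `v` of the
coset, together with occupation numbers `k (i, n)` of the oscillators `α^i_{-n}`, `n ≥ 1`. The
label stands for `∏ (α^i_{-n}) ^ k (i, n) ⊗ e^v`. -/
abbrev FockLabel (X : Sector) : Type := coset X × ((Fin 12 × ℕ+) →₀ ℕ)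

/-- The `L₀`-eigenvalue `(v, v) / 2 + ∑ n * k (i, n)` of a basis vector. -/
def weight {X : Sector} (s : FockLabel X) : ℚ :=
  (∑ i, (s.1 : Fin 12 → ℚ) i ^ 2) / 2 + s.2.sum (fun j k => (k : ℚ) * ((j.2 : ℕ) : ℚ))

/-- The underlying vector space of the module with label `X`. -/
abbrev FockSpace (X : Sector) : Type := FockLabel X →₀ ℂ

/-- The operator `L₀` on the module with label `X`, diagonal in the standard basis. -/
def L₀ (X : Sector) : Module.End ℂ (FockSpace X) :=
  Finsupp.linearCombination ℂ (fun s : FockLabel X => Finsupp.single s ((weight s : ℚ) : ℂ))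

/-- The dimension of the `L₀`-eigenspace of eigenvalue `h` in the module with label `X`. -/
def dimL₀ (X : Sector) (h : ℚ) : ℕ :=
  Module.finrank ℂ (Module.End.eigenspace (L₀ X) (h : ℂ))

/-! ### The trace functions of `V^{s♮} = A ⊕ C` and of `V^{s♮}_tw = V ⊕ S`

The subspaces `A` of `V^{s♮}` and `S` of `V^{s♮}_tw` are even, `C` and `V` are odd. The central
charge is `12`, so that `q ^ n` in a trace of `q ^ (L₀ - c / 24)` belongs to the `L₀`-eigenvalue
`n + 1 / 2`. -/

/-- The coefficient `c_{x,y}(n)` of `q ^ n` in `f(x, y; τ)`: for `(x, y) = (1, 1)` minus the trace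
on `V^{s♮}`, for `(1, 0)` the supertrace on `V^{s♮}`, for `(0, 1)` the trace on `V^{s♮}_tw`, and
for `(0, 0)` the supertrace on `V^{s♮}_tw`. -/
def traceCoeff (x y : ZMod 2) (n : ℚ) : ℤ :=
  if x = 1 then
    if y = 1 then -((dimL₀ .A (n + 1 / 2) : ℤ) + dimL₀ .C (n + 1 / 2))
    else (dimL₀ .A (n + 1 / 2) : ℤ) - dimL₀ .C (n + 1 / 2)
  else
    if y = 1 then (dimL₀ .S (n + 1 / 2) : ℤ) + dimL₀ .V (n + 1 / 2)
    else (dimL₀ .S (n + 1 / 2) : ℤ) - dimL₀ .V (n + 1 / 2)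

/-- `e(z) = exp(2πiz)`, so that `q = e(τ)` and `p = e(σ)`. -/
def e (z : ℂ) : ℂ := Complex.exp (2 * Real.pi * Complex.I * z)

/-- The trace function `f(x, y; τ) = ∑ c_{x,y}(n) q ^ n`, the sum over `n ∈ ½ℤ`. -/
def f (x y : ZMod 2) (τ : ℂ) : ℂ :=
  ∑' k : ℤ, (traceCoeff x y ((k : ℚ) / 2) : ℂ) * e ((k : ℂ) / 2 * τ)

/-! ### Equivariant Hecke operators and the multiplicative lift -/

/-- The equivariant Hecke operator: `(T_m g)(x, y; τ)` is
`m⁻¹ ∑_{ad = m} ∑_{0 ≤ b < d} g(dx, ay - bx; (aτ + b) / d)`. -/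
def hecke {N : ℕ} (m : ℕ) (g : ZMod N → ZMod N → ℂ → ℂ) (x y : ZMod N) (τ : ℂ) : ℂ :=
  (1 / (m : ℂ)) * ∑ ad ∈ m.divisorsAntidiagonal, ∑ b ∈ Finset.range ad.2,
    g ((ad.2 : ZMod N) * x) ((ad.1 : ZMod N) * y - (b : ZMod N) * x)
      (((ad.1 : ℂ) * τ + (b : ℂ)) / (ad.2 : ℂ))

/-- The formal power series `∑_{m ≥ 1} (T_m g)(x, y; τ) p ^ m` in the variable `p`. -/
def heckeSeries {N : ℕ} (g : ZMod N → ZMod N → ℂ → ℂ) (x y : ZMod N) (τ : ℂ) : PowerSeries ℂ :=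
  PowerSeries.mk (fun m => if m = 0 then 0 else hecke m g x y τ)

theorem hasSubst_neg_heckeSeries {N : ℕ} (g : ZMod N → ZMod N → ℂ → ℂ) (x y : ZMod N) (τ : ℂ) :
    PowerSeries.HasSubst (-heckeSeries g x y τ) := by
  apply PowerSeries.HasSubst.of_constantCoeff_zero'
  rw [← PowerSeries.coeff_zero_eq_constantCoeff_apply]
  simp only [heckeSeries, map_neg, PowerSeries.coeff_mk, if_true, neg_zero]

/-- The formal power series `exp (-∑_{m ≥ 1} (T_m g)(x, y; τ) p ^ m)` in `p`. -/
def liftSeries {N : ℕ} (g : ZMod N → ZMod N → ℂ → ℂ) (x y : ZMod N) (τ : ℂ) : PowerSeries ℂ :=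
  (PowerSeries.exp ℂ).subst (-heckeSeries g x y τ)

/-- The value of the power series `Ψ_g(x, y; τ)` at `p = e(σ)`. -/
def Ψ {N : ℕ} (g : ZMod N → ZMod N → ℂ → ℂ) (x y : ZMod N) (σ τ : ℂ) : ℂ :=
  ∑' k : ℕ, PowerSeries.coeff k (liftSeries g x y τ) * e σ ^ k

/-! ### Denominator and superdenominator

The positive roots of the superalgebra are pairs `(m, n)` of integers with `m > 0`, of norm
`-2mn`; the root space is the subspace of `V^{s♮}_tw` with `L₀ - 1 / 2 = mn`. -/

/-- The dimension of the even part of the root space of `(m, n)`, `m > 0`. -/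
def evenMult (m : ℕ+) (n : ℤ) : ℕ := dimL₀ .S (((m : ℕ) : ℚ) * n + 1 / 2)

/-- The dimension of the odd part of the root space of `(m, n)`, `m > 0`. -/
def oddMult (m : ℕ+) (n : ℤ) : ℕ := dimL₀ .V (((m : ℕ) : ℚ) * n + 1 / 2)

/-- The factor of the positive root `(m, n)` in the denominator, with `p ^ m q ^ n = e(mσ + nτ)`. -/
def denominatorFactor (σ τ : ℂ) (α : ℕ+ × ℤ) : ℂ :=
  (1 - e (((α.1 : ℕ) : ℂ) * σ + (α.2 : ℂ) * τ)) ^ evenMult α.1 α.2 /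
    (1 + e (((α.1 : ℕ) : ℂ) * σ + (α.2 : ℂ) * τ)) ^ oddMult α.1 α.2

/-- The factor of the positive root `(m, n)` in the superdenominator. -/
def superdenominatorFactor (σ τ : ℂ) (α : ℕ+ × ℤ) : ℂ :=
  (1 - e (((α.1 : ℕ) : ℂ) * σ + (α.2 : ℂ) * τ)) ^ evenMult α.1 α.2 /
    (1 - e (((α.1 : ℕ) : ℂ) * σ + (α.2 : ℂ) * τ)) ^ oddMult α.1 α.2

end ConwayDenominator

end

noncomputable section

namespace ConwayDenominator

open Filter Topology


/-! Put x = e(τ/2). The Jacobi triple product turns the four characters into combinations of 24th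
powers of the products ∏(1 - x^(2j-1)), ∏(1 + x^(2j-1)) and ∏(1 + x^(2j)). Jacobi's quartic identity
(`jacobi_quartic`), cubed, together with Euler's identity for these products shows that f(0,0) is
the constant -24 and that each of f(1,0), f(0,1), f(1,1) is 24 plus a monomial factor times one such
power. Hence τ ↦ τ + 1 and τ ↦ -1/τ permute the f(x,y) through an action on (x,y). The Hecke
operators are sums over left orbits of integral matrices of determinant m, so they preserve this
equivariance.

For (x,y) ≠ (0,0) the lift equals p (f(1,0;2σ) - f(x,y;τ)) as a formal power series in p. Both have
constant term 1, so it suffices that the difference satisfies the linear differential equation of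
the exponential. Each coefficient D(x,y;τ) of the defect (`defectSeries`) is holomorphic and
equivariant, so D(1,0) D(1,1) D(0,1) is invariant under the full modular group. At i∞ the factor
D(0,1) tends to 0, because p f(1,0;2σ) - 24p = ∏(1 + p^d)^(-24) has the required logarithmic
derivative. The factors D(1,0) and D(1,1) stay bounded, because the poles of the Hecke sums form a
geometric series that subtracts Taylor polynomials of e(τ/2) f(1,0;τ). A level one form of weight 0
that vanishes at the cusp is zero; so some factor vanishes identically, and equivariance carries
this to the others (`coeff_defectSeries_eq_zero`, `liftSeries_eq_diffSeries`).

For (0,0) the constant -24 exponentiates to ∏(1 - p^d)^(-24). Constancy of f(0,0) also means that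
even and odd multiplicities agree for n ≠ 0, so the superdenominator collapses to the same product.
The logarithm of the denominator is a triple series over roots and their multiples; the average over
b in the Hecke operator selects the coefficients whose index is divisible by d, so the same series,
sorted by (a,d), is the exponent of Ψ(0,1). Its absolute convergence rests on f(0,1;iy) =
f(1,0;i/y), which controls the growth of the multiplicities, and this is where Im σ · Im τ > 1/2
enters. -/

/-! ### Euler's product and the Jacobi triple product -/

/-- Euler's product `∏ (1 - x ^ n)` over `n ≥ 1`. -/
def eulerProd (x : ℂ) : ℂ := ∏' n : ℕ, (1 - x ^ (n + 1))

theorem hasProd_eulerProd {x : ℂ} (hx : ‖x‖ < 1) :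
    HasProd (fun n : ℕ => 1 - x ^ (n + 1)) (eulerProd x) :=
  (ModularForm.multipliable_one_sub_pow hx).hasProd

theorem one_sub_pow_succ_ne_zero {x : ℂ} (hx : ‖x‖ < 1) (n : ℕ) : 1 - x ^ (n + 1) ≠ 0 := by
  intro h
  have h1 : ‖x ^ (n + 1)‖ < 1 := by
    rw [norm_pow]; exact pow_lt_one₀ (norm_nonneg _) hx (Nat.succ_ne_zero n)
  rw [← sub_eq_zero.mp h, norm_one] at h1
  exact lt_irrefl _ h1

theorem eulerProd_ne_zero {x : ℂ} (hx : ‖x‖ < 1) : eulerProd x ≠ 0 := by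
  simp only [eulerProd, sub_eq_add_neg]
  refine tprod_one_add_ne_zero_of_summable (fun i => ?_) ?_
  · simpa [sub_eq_add_neg] using one_sub_pow_succ_ne_zero hx i
  · simpa using (summable_nat_add_iff 1).mpr (summable_geometric_of_lt_one (norm_nonneg _) hx)

theorem norm_sq_lt_one {x : ℂ} (hx : ‖x‖ < 1) : ‖x ^ 2‖ < 1 := by
  rw [norm_pow]; exact pow_lt_one₀ (norm_nonneg _) hx two_ne_zero

/-- The product `∏ (1 - x ^ (2 * j + 1))` over `j ≥ 0`. -/
def oddProd (x : ℂ) : ℂ := ∏' j : ℕ, (1 + x ^ (2 * j + 1) * (-1))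

theorem hasProd_oddProd' {x : ℂ} (hx : ‖x‖ < 1) (z : ℂ) :
    HasProd (fun j : ℕ => 1 + x ^ (2 * j + 1) * z) (∏' j : ℕ, (1 + x ^ (2 * j + 1) * z)) := by
  refine (multipliable_one_add_of_summable ?_).hasProd
  have : Summable fun j : ℕ => ‖x‖ * ‖z‖ * (‖x‖ ^ 2) ^ j :=
    (summable_geometric_of_lt_one (by positivity)
      (pow_lt_one₀ (norm_nonneg _) hx two_ne_zero)).mul_left _
  refine this.congr fun j => ?_
  rw [norm_mul, norm_pow]; ring

theorem hasProd_oddProd {x : ℂ} (hx : ‖x‖ < 1) :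
    HasProd (fun j : ℕ => 1 + x ^ (2 * j + 1) * (-1)) (oddProd x) :=
  hasProd_oddProd' hx (-1)

theorem oddProd_mul_eulerProd {x : ℂ} (hx : ‖x‖ < 1) :
    oddProd x * eulerProd (x ^ 2) = eulerProd x := by
  refine HasProd.unique (HasProd.even_mul_odd (f := fun n : ℕ => 1 - x ^ (n + 1)) ?_ ?_)
    (hasProd_eulerProd hx)
  · exact (hasProd_oddProd hx).congr_fun fun j => by ring
  · exact (hasProd_eulerProd (norm_sq_lt_one hx)).congr_fun fun j => by ring

theorem oddProd_mul_oddProd_neg {x : ℂ} (hx : ‖x‖ < 1) :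
    oddProd x * oddProd (-x) = oddProd (x ^ 2) := by
  refine HasProd.unique ?_ (hasProd_oddProd (norm_sq_lt_one hx))
  refine ((hasProd_oddProd hx).mul (hasProd_oddProd (by simpa using hx))).congr_fun fun j => ?_
  rw [Odd.neg_pow ⟨j, rfl⟩]; ring

/-- The reciprocal of the `q`-Pochhammer symbol `∏ (1 - x ^ (2 * j))` over `1 ≤ j ≤ k`, extended
by zero to negative `k`. -/
def invPoch (x : ℂ) (k : ℤ) : ℂ :=
  if 0 ≤ k then (∏ j ∈ Finset.range k.toNat, (1 - (x ^ 2) ^ (j + 1)))⁻¹ else 0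

/-- The extension by zero is consistent with the recursion: at k = 0 the factor 1 - x^0 vanishes. No
boundary cases are then left in the finite triple product. -/
theorem invPoch_sub_one {x : ℂ} (hx : ‖x‖ < 1) (k : ℤ) :
    invPoch x (k - 1) = (1 - x ^ (2 * k)) * invPoch x k := by
  rcases lt_trichotomy k 0 with h | rfl | h
  · rw [invPoch, invPoch, if_neg (by omega), if_neg (by omega), mul_zero]
  · simp [invPoch]
  · obtain ⟨n, rfl⟩ : ∃ n : ℕ, k = n + 1 := ⟨(k - 1).toNat, by omega⟩
    have h1 : ((n : ℤ) + 1 - 1).toNat = n := by omega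
    have h2 : ((n : ℤ) + 1).toNat = n + 1 := by omega
    rw [invPoch, invPoch, if_pos (by omega), if_pos (by omega), h1, h2, Finset.prod_range_succ,
      mul_inv]
    have h3 : x ^ (2 * ((n : ℤ) + 1)) = (x ^ 2) ^ (n + 1) := by
      rw [← pow_mul, ← zpow_natCast]; push_cast; rfl
    rw [h3, mul_comm, mul_assoc, inv_mul_cancel₀, mul_one]
    exact one_sub_pow_succ_ne_zero (norm_sq_lt_one hx) n

/-- This is the q-binomial form of the triple product; only |n| ≤ N contributes, since `invPoch`
vanishes at negative arguments. Passing from N to N + 1 multiplies by two factors, whose z and z⁻¹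
act as shifts of the summation index. -/
theorem hasSum_finite_triple_product {x : ℂ} (hx : ‖x‖ < 1) (hx0 : x ≠ 0) {z : ℂ} (hz : z ≠ 0)
    (N : ℕ) :
    HasSum (fun n : ℤ => (∏ j ∈ Finset.range (2 * N), (1 - (x ^ 2) ^ (j + 1))) *
        invPoch x (N + n) * invPoch x (N - n) * (x ^ (n ^ 2) * z ^ n))
      (∏ j ∈ Finset.range N, ((1 + x ^ (2 * j + 1) * z) * (1 + x ^ (2 * j + 1) * z⁻¹))) := by
  induction N with
  | zero =>
    rw [Finset.prod_range_zero]
    refine (hasSum_ite_eq (0 : ℤ) (1 : ℂ)).congr_fun fun n => ?_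
    by_cases h : n = 0
    · simp [h, invPoch]
    · have : ¬ (0 ≤ n ∧ n ≤ 0) := by omega
      simp only [h, if_false, invPoch]
      by_cases h1 : 0 ≤ n
      · simp [show ¬ n ≤ 0 by omega]
      · simp [h1]
  | succ N ih =>
    have h1 := (Equiv.subRight (1 : ℤ)).hasSum_iff.mpr ih
    have h2 := (Equiv.addRight (1 : ℤ)).hasSum_iff.mpr ih
    have h3 := (ih.mul_left (1 + x ^ (4 * N + 2))).add
      ((h1.mul_left (x ^ (2 * N + 1) * z)).add (h2.mul_left (x ^ (2 * N + 1) * z⁻¹)))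
    rw [Finset.prod_range_succ]
    have hv : ∀ P : ℂ, P * ((1 + x ^ (2 * N + 1) * z) * (1 + x ^ (2 * N + 1) * z⁻¹)) =
        (1 + x ^ (4 * N + 2)) * P + (x ^ (2 * N + 1) * z * P + x ^ (2 * N + 1) * z⁻¹ * P) := by
      intro P
      field_simp
      ring
    rw [hv]
    refine h3.congr_fun fun n => ?_
    simp only [Function.comp_apply, Equiv.subRight_apply, Equiv.coe_addRight]
    have e1 : invPoch x (N + n) = (1 - x ^ (2 * ((N : ℤ) + 1 + n))) * invPoch x (N + 1 + n) := by
      rw [← invPoch_sub_one hx]; congr 1; ring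
    have e2 : invPoch x (N - n) = (1 - x ^ (2 * ((N : ℤ) + 1 - n))) * invPoch x (N + 1 - n) := by
      rw [← invPoch_sub_one hx]; congr 1; ring
    have e3 : invPoch x (N + (n - 1)) = (1 - x ^ (2 * ((N : ℤ) + n))) * invPoch x (N + n) := by
      rw [← invPoch_sub_one hx]; congr 1; ring
    have e4 : invPoch x (N - (n + 1)) = (1 - x ^ (2 * ((N : ℤ) - n))) * invPoch x (N - n) := by
      rw [← invPoch_sub_one hx]; congr 1; ring
    have e5 : invPoch x (N - (n - 1)) = invPoch x (N + 1 - n) := by congr 1; ring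
    have e6 : invPoch x (N + (n + 1)) = invPoch x (N + 1 + n) := by congr 1; ring
    rw [e3, e4, e5, e6, e1, e2, show 2 * (N + 1) = 2 * N + 1 + 1 by ring,
      Finset.prod_range_succ, Finset.prod_range_succ]
    set R := invPoch x (N + 1 + n)
    set R' := invPoch x (N + 1 - n)
    push_cast
    -- Every power of x that occurs is a monomial in u, w, x^(n²), x² and x^(2N+1), which reduces
    -- the recursion to a rational identity.
    set u := x ^ (2 * ((N : ℤ) + 1 + n)) with hu
    set w := x ^ (2 * ((N : ℤ) + 1 - n)) with hw
    have f1 : x ^ (2 * ((N : ℤ) + n)) = u * (x ^ 2)⁻¹ := by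
      rw [hu, ← zpow_natCast, ← zpow_neg, ← zpow_add₀ hx0]; congr 1; push_cast; ring
    have f2 : x ^ (2 * ((N : ℤ) - n)) = w * (x ^ 2)⁻¹ := by
      rw [hw, ← zpow_natCast, ← zpow_neg, ← zpow_add₀ hx0]; congr 1; push_cast; ring
    have f3 : x ^ ((n - 1) ^ 2) = w * x ^ (n ^ 2) * (x ^ (2 * N + 1))⁻¹ := by
      rw [hw, ← zpow_natCast, ← zpow_neg, ← zpow_add₀ hx0, ← zpow_add₀ hx0]; congr 1
      push_cast; ring
    have f4 : x ^ ((n + 1) ^ 2) = u * x ^ (n ^ 2) * (x ^ (2 * N + 1))⁻¹ := by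
      rw [hu, ← zpow_natCast, ← zpow_neg, ← zpow_add₀ hx0, ← zpow_add₀ hx0]; congr 1
      push_cast; ring
    have f5 : (x ^ 2) ^ (2 * N + 1) = u * w * (x ^ 2)⁻¹ := by
      rw [hu, hw, ← pow_mul, ← zpow_natCast, ← zpow_natCast, ← zpow_neg, ← zpow_add₀ hx0,
        ← zpow_add₀ hx0]; congr 1; push_cast; ring
    have f6 : (x ^ 2) ^ (2 * N + 1 + 1) = u * w := by
      rw [hu, hw, ← pow_mul, ← zpow_natCast, ← zpow_add₀ hx0]; congr 1; push_cast; ring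
    have f7 : x ^ (4 * N + 2) = u * w * (x ^ 2)⁻¹ := by rw [← f5, ← pow_mul]; congr 1; ring
    rw [f1, f2, f3, f4, f5, f6, f7, zpow_sub_one₀ hz, zpow_add_one₀ hz]
    have hp : x ^ (2 * N + 1) ≠ 0 := pow_ne_zero _ hx0
    field_simp
    ring

theorem tendsto_prod_range {f : ℕ → ℂ} {a : ℂ} (h : HasProd f a) :
    Tendsto (fun N => ∏ j ∈ Finset.range N, f j) atTop (𝓝 a) := h.tendsto_prod_nat

theorem exists_bounds_of_tendsto_ne_zero {u : ℕ → ℂ} {a : ℂ} (h : Tendsto u atTop (𝓝 a))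
    (ha : a ≠ 0) : ∃ K, ∀ n, ‖u n‖ ≤ K ∧ ‖(u n)⁻¹‖ ≤ K := by
  obtain ⟨K, hK⟩ := (Metric.isBounded_range_of_tendsto u h).exists_norm_le
  obtain ⟨K', hK'⟩ := (Metric.isBounded_range_of_tendsto _ (h.inv₀ ha)).exists_norm_le
  exact ⟨max K K', fun n => ⟨(hK _ ⟨n, rfl⟩).trans (le_max_left _ _),
    (hK' _ ⟨n, rfl⟩).trans (le_max_right _ _)⟩⟩

/-- The Jacobi triple product. -/
theorem jacobi_triple_product {x : ℂ} (hx : ‖x‖ < 1) (hx0 : x ≠ 0) {z : ℂ} (hz : z ≠ 0)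
    (hs : Summable fun n : ℤ => ‖x ^ (n ^ 2) * z ^ n‖) :
    ∑' n : ℤ, x ^ (n ^ 2) * z ^ n = eulerProd (x ^ 2) *
      ((∏' j : ℕ, (1 + x ^ (2 * j + 1) * z)) * ∏' j : ℕ, (1 + x ^ (2 * j + 1) * z⁻¹)) := by
  set Q : ℕ → ℂ := fun k => ∏ j ∈ Finset.range k, (1 - (x ^ 2) ^ (j + 1)) with hQ
  have hx2 := norm_sq_lt_one hx
  have hQt : Tendsto Q atTop (𝓝 (eulerProd (x ^ 2))) :=
    tendsto_prod_range (hasProd_eulerProd hx2)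
  have hE := eulerProd_ne_zero hx2
  obtain ⟨K, hK⟩ := exists_bounds_of_tendsto_ne_zero hQt hE
  have hK0 : 0 ≤ K := (norm_nonneg _).trans (hK 0).1
  have hr : ∀ k : ℤ, ‖invPoch x k‖ ≤ K := by
    intro k
    rw [invPoch]
    split_ifs
    · exact (hK _).2
    · simpa using hK0
  have hrt : Tendsto (fun k : ℤ => invPoch x k) atTop (𝓝 (eulerProd (x ^ 2))⁻¹) := by
    have h1 : Tendsto (fun k : ℤ => k.toNat) atTop atTop :=
      tendsto_atTop.mpr fun b => (eventually_ge_atTop (b : ℤ)).mono fun k hk => by omega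
    refine ((hQt.comp h1).inv₀ hE).congr' ?_
    filter_upwards [eventually_ge_atTop (0 : ℤ)] with k hk
    rw [invPoch, if_pos hk]; rfl
  -- Dominated convergence in the finite identity: the three Pochhammer factors are each bounded by
  -- K and tend to E, E⁻¹, E⁻¹ with E = `eulerProd (x ^ 2)`.
  have key : Tendsto (fun N : ℕ => ∑' n : ℤ, Q (2 * N) *
        invPoch x (N + n) * invPoch x (N - n) * (x ^ (n ^ 2) * z ^ n)) atTop
      (𝓝 (∑' n : ℤ, eulerProd (x ^ 2) * (eulerProd (x ^ 2))⁻¹ * (eulerProd (x ^ 2))⁻¹ *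
        (x ^ (n ^ 2) * z ^ n))) := by
    refine tendsto_tsum_of_dominated_convergence (hs.mul_left (K * K * K)) (fun n => ?_)
      (Eventually.of_forall fun N n => ?_)
    · have t1 : Tendsto (fun N : ℕ => 2 * N) atTop atTop :=
        tendsto_atTop_mono (fun N => by simp only [id]; omega) tendsto_id
      have t2 : Tendsto (fun N : ℕ => (N : ℤ) + n) atTop atTop :=
        tendsto_atTop_add_const_right _ _ tendsto_natCast_atTop_atTop
      have t3 : Tendsto (fun N : ℕ => (N : ℤ) - n) atTop atTop :=
        tendsto_atTop_add_const_right _ (-n) tendsto_natCast_atTop_atTop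
      exact (((hQt.comp t1).mul (hrt.comp t2)).mul (hrt.comp t3)).mul_const _
    · rw [norm_mul, norm_mul, norm_mul]
      have := (hK (2 * N)).1
      have := hr (N + n)
      have := hr (N - n)
      gcongr
  have h2 := tendsto_prod_range ((hasProd_oddProd' hx z).mul (hasProd_oddProd' hx z⁻¹))
  have h3 := tendsto_nhds_unique (h2.congr fun N =>
    (hasSum_finite_triple_product hx hx0 hz N).tsum_eq.symm) key
  rw [h3, tsum_mul_left]
  field_simp

theorem summable_norm_zpow_sq {x : ℂ} (hx : ‖x‖ < 1) :
    Summable fun n : ℤ => ‖x ^ (n ^ 2)‖ := by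
  have h1 : Summable fun n : ℕ => ‖x‖ ^ n := summable_geometric_of_lt_one (norm_nonneg _) hx
  have h2 : ∀ n : ℕ, ‖x ^ ((n : ℤ) ^ 2)‖ ≤ ‖x‖ ^ n := by
    intro n
    rw [show (n : ℤ) ^ 2 = ((n ^ 2 : ℕ) : ℤ) by push_cast; rfl, zpow_natCast, norm_pow]
    exact pow_le_pow_of_le_one (norm_nonneg _) hx.le (Nat.le_self_pow two_ne_zero n)
  have h3 := Summable.of_nonneg_of_le (fun n => norm_nonneg _) h2 h1
  exact Summable.of_nat_of_neg h3 (by simpa using h3)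

theorem summable_norm_zpow_mul_succ {x : ℂ} (hx : ‖x‖ < 1) :
    Summable fun n : ℤ => ‖x ^ (n ^ 2 + n)‖ := by
  have h1 : Summable fun n : ℕ => ‖x‖ ^ n := summable_geometric_of_lt_one (norm_nonneg _) hx
  refine Summable.of_nat_of_neg_add_one (Summable.of_nonneg_of_le (fun n => norm_nonneg _)
    (fun n => ?_) h1) (Summable.of_nonneg_of_le (fun n => norm_nonneg _) (fun n => ?_) h1)
  · rw [show (n : ℤ) ^ 2 + n = ((n ^ 2 + n : ℕ) : ℤ) by push_cast; rfl, zpow_natCast, norm_pow]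
    exact pow_le_pow_of_le_one (norm_nonneg _) hx.le (by nlinarith)
  · rw [show (-((n : ℤ) + 1)) ^ 2 + -((n : ℤ) + 1) = ((n ^ 2 + n : ℕ) : ℤ) by push_cast; ring,
      zpow_natCast, norm_pow]
    exact pow_le_pow_of_le_one (norm_nonneg _) hx.le (by nlinarith)

/-! ### Theta constants as products -/

/-- The theta series `∑ x ^ (n ^ 2)`. -/
def thetaInt (x : ℂ) : ℂ := ∑' n : ℤ, x ^ (n ^ 2)

/-- The theta series `∑ (-1) ^ n x ^ (n ^ 2)`. -/
def thetaAlt (x : ℂ) : ℂ := ∑' n : ℤ, x ^ (n ^ 2) * (-1) ^ n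

/-- The theta series `∑ x ^ (n ^ 2 + n)`. -/
def thetaHalf (x : ℂ) : ℂ := ∑' n : ℤ, x ^ (n ^ 2 + n)

/-- The product `∏ (1 + x ^ (2 * j))` over `j ≥ 1`. -/
def evenProd (x : ℂ) : ℂ := ∏' j : ℕ, (1 + x ^ (2 * j + 1) * x)

theorem evenProd_mul_eulerProd {x : ℂ} (hx : ‖x‖ < 1) :
    evenProd x * eulerProd (x ^ 2) = eulerProd (x ^ 4) := by
  have hx4 : ‖x ^ 4‖ < 1 := by
    rw [norm_pow]; exact pow_lt_one₀ (norm_nonneg _) hx four_ne_zero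
  refine HasProd.unique ?_ (hasProd_eulerProd hx4)
  refine ((hasProd_oddProd' hx x).mul (hasProd_eulerProd (norm_sq_lt_one hx))).congr_fun
    fun j => ?_
  ring

/-- Euler's identity. After multiplication by `eulerProd (x ^ 2)` the products telescope through
`eulerProd (x ^ 4)`. -/
theorem oddProd_mul_oddProd_neg_mul_evenProd {x : ℂ} (hx : ‖x‖ < 1) :
    oddProd x * oddProd (-x) * evenProd x = 1 := by
  have hx2 := norm_sq_lt_one hx
  have h1 := evenProd_mul_eulerProd hx
  have h2 := oddProd_mul_eulerProd hx2
  rw [← pow_mul] at h2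
  rw [oddProd_mul_oddProd_neg hx]
  have h3 := eulerProd_ne_zero hx2
  refine mul_right_cancel₀ h3 ?_
  rw [mul_assoc, h1, h2, one_mul]

theorem thetaInt_eq {x : ℂ} (hx : ‖x‖ < 1) (hx0 : x ≠ 0) :
    thetaInt x = eulerProd (x ^ 2) * oddProd (-x) ^ 2 := by
  have h := jacobi_triple_product hx hx0 one_ne_zero (by simpa using summable_norm_zpow_sq hx)
  have h1 : oddProd (-x) = ∏' j : ℕ, (1 + x ^ (2 * j + 1)) := by
    refine tprod_congr fun j => ?_
    rw [Odd.neg_pow ⟨j, rfl⟩]; ring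
  simp only [one_zpow, mul_one, inv_one] at h
  rw [thetaInt, h, h1, sq (∏' _, _)]

theorem thetaAlt_eq {x : ℂ} (hx : ‖x‖ < 1) (hx0 : x ≠ 0) :
    thetaAlt x = eulerProd (x ^ 2) * oddProd x ^ 2 := by
  have h := jacobi_triple_product (z := -1) hx hx0 (by simp)
    (by simpa using summable_norm_zpow_sq hx)
  rw [show (-1 : ℂ)⁻¹ = -1 by norm_num] at h
  rw [thetaAlt, h, oddProd, sq (∏' _, _)]

theorem thetaHalf_eq {x : ℂ} (hx : ‖x‖ < 1) (hx0 : x ≠ 0) :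
    thetaHalf x = 2 * eulerProd (x ^ 2) * evenProd x ^ 2 := by
  have h := jacobi_triple_product (z := x) hx hx0 hx0
    (by simpa only [← zpow_add₀ hx0] using summable_norm_zpow_mul_succ hx)
  simp only [← zpow_add₀ hx0] at h
  rw [thetaHalf, h]
  -- For z = x the factor j = 0 is 1 + x x⁻¹ = 2, and the remaining factors are those of `evenProd`
  -- shifted by one.
  have h1 : ∏' j : ℕ, (1 + x ^ (2 * j + 1) * x⁻¹) = 2 * evenProd x := by
    have h2 := tendsto_prod_range (hasProd_oddProd' hx x⁻¹)
    have h3 := (tendsto_prod_range (hasProd_oddProd' hx x)).const_mul 2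
    refine tendsto_nhds_unique ((tendsto_add_atTop_iff_nat 1).mpr h2) (h3.congr fun N => ?_)
    rw [Finset.prod_range_succ', mul_comm]
    have h4 : (1 : ℂ) + x ^ (2 * 0 + 1) * x⁻¹ = 2 := by
      rw [mul_zero, zero_add, pow_one, mul_inv_cancel₀ hx0]; norm_num
    rw [h4]
    congr 1
    refine Finset.prod_congr rfl fun j _ => ?_
    field_simp
    ring
  rw [h1, evenProd]; ring


/-! ### Sums over products of index types -/

theorem hasSum_fin_pi_prod {ι : Type*} (n : ℕ) (g : Fin n → ι → ℂ)
    (hg : ∀ i, Summable fun j => ‖g i j‖) :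
    (Summable fun m : Fin n → ι => ‖∏ i, g i (m i)‖) ∧
      HasSum (fun m : Fin n → ι => ∏ i, g i (m i)) (∏ i, ∑' j, g i j) := by
  induction n with
  | zero => exact ⟨(hasSum_unique _).summable, by simp⟩
  | succ n ih =>
    obtain ⟨h1, h2⟩ := ih (fun i => g i.succ) (fun i => hg i.succ)
    have h3 := (hg 0).mul_norm h1
    have h4 : HasSum (fun p : ι × (Fin n → ι) => g 0 p.1 * ∏ i, g i.succ (p.2 i))
        (∏ i, ∑' j, g i j) := by
      rw [Fin.prod_univ_succ, ← h2.tsum_eq, tsum_mul_tsum_of_summable_norm (hg 0) h1]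
      exact (summable_mul_of_summable_norm (hg 0) h1).hasSum
    constructor
    · rw [← (Fin.consEquiv fun _ => ι).summable_iff]
      refine h3.congr fun p => ?_
      simp [Fin.prod_univ_succ, Fin.consEquiv]
    · rw [← (Fin.consEquiv fun _ => ι).hasSum_iff]
      refine h4.congr_fun fun p => ?_
      simp [Fin.prod_univ_succ, Fin.consEquiv]

theorem hasSum_pi_prod {κ ι : Type*} [Fintype κ] (g : κ → ι → ℂ)
    (hg : ∀ i, Summable fun j => ‖g i j‖) :
    (Summable fun m : κ → ι => ‖∏ i, g i (m i)‖) ∧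
      HasSum (fun m : κ → ι => ∏ i, g i (m i)) (∏ i, ∑' j, g i j) := by
  let e := Fintype.equivFin κ
  obtain ⟨h1, h2⟩ := hasSum_fin_pi_prod _ (fun i => g (e.symm i)) (fun i => hg (e.symm i))
  have h3 : ∀ m : κ → ι, ∏ i, g i (m i) = ∏ i, g (e.symm i) (m (e.symm i)) := fun m =>
    (e.symm.prod_comp fun i => g i (m i)).symm
  rw [e.symm.prod_comp fun i => ∑' j, g i j] at h2
  constructor
  · rw [← (e.arrowCongr (Equiv.refl ι)).summable_iff] at h1
    refine h1.congr fun m => ?_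
    simp [h3 m]
  · rw [← (e.arrowCongr (Equiv.refl ι)).hasSum_iff] at h2
    refine h2.congr_fun fun m => ?_
    simp [h3 m]

theorem hasSum_finsupp_indicator {ι : Type*} (x : ι → ℂ) (hx : ∀ i, ‖x i‖ < 1) (s : Finset ι) :
    HasSum ({k : ι →₀ ℕ | k.support ⊆ s}.indicator fun k => k.prod fun i a => x i ^ a)
      (∏ i ∈ s, (1 - x i)⁻¹) := by
  classical
  have h1 := (hasSum_pi_prod (fun (i : s) (a : ℕ) => x i ^ a)
    (fun i => by simpa using hx i)).2
  simp only [fun i : s => tsum_geometric_of_norm_lt_one (hx i)] at h1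
  rw [Finset.prod_coe_sort s fun i => (1 - x i)⁻¹] at h1
  rw [← Finsupp.equivFunOnFinite.hasSum_iff] at h1
  have hinj : Function.Injective (fun k : s →₀ ℕ => k.extendDomain) := fun a b hab => by
    have := congrArg (Finsupp.subtypeDomain (· ∈ s)) hab
    simpa only [Finsupp.subtypeDomain_extendDomain] using this
  rw [← hinj.hasSum_iff]
  · refine h1.congr_fun fun k => ?_
    have hk : (k.extendDomain).support ⊆ s := fun i hi => by
      by_contra hc
      simp [hc] at hi
    rw [Function.comp_apply, Set.indicator_of_mem (by exact hk),
      Finsupp.prod_of_support_subset _ hk _ (by simp),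
      ← Finset.prod_coe_sort]
    simp
  · intro k hk
    refine Set.indicator_of_notMem (fun hks => hk ⟨k.subtypeDomain (· ∈ s), ?_⟩) _
    exact Finsupp.extendDomain_subtypeDomain k fun a ha => hks ha

/-- The generating function of a Fock space. Occupation numbers supported in a finite set give a
product of geometric series; all partial sums of norms are at most the inverse of ∏(1 - ‖x i‖), so
the limit over finite sets is dominated. -/
theorem hasSum_finsupp_prod {ι : Type*} (x : ι → ℂ) (hx : ∀ i, ‖x i‖ < 1)
    (hs : Summable fun i => ‖x i‖) :
    (Summable fun k : ι →₀ ℕ => ‖k.prod fun i a => x i ^ a‖) ∧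
      ∀ P, HasProd (fun i => 1 - x i) P → P ≠ 0 →
        HasSum (fun k : ι →₀ ℕ => k.prod fun i a => x i ^ a) P⁻¹ := by
  have hsum : Summable fun k : ι →₀ ℕ => ‖k.prod fun i a => x i ^ a‖ := by
    have hm : Multipliable fun i => 1 - ‖x i‖ := by
      simpa only [sub_eq_add_neg] using
        multipliable_one_add_of_summable (f := fun i => -‖x i‖) (by simpa using hs)
    have hne : ∏' i, (1 - ‖x i‖) ≠ 0 := by
      simpa only [sub_eq_add_neg] using
        tprod_one_add_ne_zero_of_summable (f := fun i => -‖x i‖)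
          (fun i => by have := hx i; linarith) (by simpa using hs)
    have hle : ∀ s : Finset ι, ∏' i, (1 - ‖x i‖) ≤ ∏ i ∈ s, (1 - ‖x i‖) := by
      intro s
      refine le_of_tendsto hm.hasProd ?_
      filter_upwards [eventually_ge_atTop s] with t ht
      refine Finset.prod_le_prod_of_subset_of_le_one ht (fun i _ => ?_) (fun i _ _ => ?_)
      · have := hx i; linarith
      · have := norm_nonneg (x i); linarith
    have hpos : 0 < ∏' i, (1 - ‖x i‖) := lt_of_le_of_ne
      (ge_of_tendsto hm.hasProd (Eventually.of_forall fun s => Finset.prod_nonneg fun i _ => by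
        have := hx i; linarith)) (Ne.symm hne)
    refine summable_of_sum_le (c := (∏' i, (1 - ‖x i‖))⁻¹) (fun _ => norm_nonneg _) fun F => ?_
    classical
    let s : Finset ι := F.biUnion Finsupp.support
    have h1 := hasSum_finsupp_indicator (fun i => (‖x i‖ : ℂ)) (fun i => by simpa using hx i) s
    have h2 : HasSum ({k : ι →₀ ℕ | k.support ⊆ s}.indicator fun k => k.prod fun i a => ‖x i‖ ^ a)
        (∏ i ∈ s, (1 - ‖x i‖)⁻¹) := by
      rw [← Complex.hasSum_ofReal]
      convert h1 using 1
      · ext k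
        by_cases hk : k ∈ {k : ι →₀ ℕ | k.support ⊆ s}
        · simp [Set.indicator_of_mem hk, Finsupp.prod]
        · simp [Set.indicator_of_notMem hk]
      · push_cast; rfl
    have h3 : ∑ k ∈ F, ‖k.prod fun i a => x i ^ a‖ = ∑ k ∈ F,
        {k : ι →₀ ℕ | k.support ⊆ s}.indicator (fun k => k.prod fun i a => ‖x i‖ ^ a) k := by
      refine Finset.sum_congr rfl fun k hk => ?_
      rw [Set.indicator_of_mem (show k ∈ {k : ι →₀ ℕ | k.support ⊆ s} from
        Finset.subset_biUnion_of_mem Finsupp.support hk)]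
      simp [Finsupp.prod]
    rw [h3]
    refine (sum_le_hasSum F (fun k _ => Set.indicator_nonneg (fun k _ =>
      Finset.prod_nonneg fun i _ => by positivity) k) h2).trans ?_
    rw [Finset.prod_inv_distrib]
    exact inv_anti₀ hpos (hle s)
  refine ⟨hsum, fun P hP hP0 => ?_⟩
  have h1 : Tendsto (fun s : Finset ι => ∑' k : ι →₀ ℕ,
      {k : ι →₀ ℕ | k.support ⊆ s}.indicator (fun k => k.prod fun i a => x i ^ a) k) atTop
      (𝓝 (∑' k : ι →₀ ℕ, k.prod fun i a => x i ^ a)) := by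
    refine tendsto_tsum_of_dominated_convergence hsum (fun k => ?_)
      (Eventually.of_forall fun s k => norm_indicator_le_norm_self _ _)
    refine tendsto_const_nhds.congr' ?_
    filter_upwards [eventually_ge_atTop k.support] with s hs
    rw [Set.indicator_of_mem (by exact hs)]
  have h2 : Tendsto (fun s : Finset ι => ∏ i ∈ s, (1 - x i)⁻¹) atTop (𝓝 P⁻¹) := by
    have h := Tendsto.inv₀ hP hP0
    rw [SummationFilter.unconditional_filter] at h
    simpa only [Finset.prod_inv_distrib] using h
  have h3 := tendsto_nhds_unique (h1.congr fun s => (hasSum_finsupp_indicator x hx s).tsum_eq) h2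
  rw [← h3]
  exact hsum.of_norm.hasSum

theorem prod_zpow_eq_zpow_sum {ι : Type*} {x : ℂ} (hx : x ≠ 0) (s : Finset ι) (m : ι → ℤ) :
    ∏ i ∈ s, x ^ m i = x ^ (∑ i ∈ s, m i) := by
  classical
  induction s using Finset.induction_on with
  | empty => simp
  | insert a s ha ih => rw [Finset.prod_insert ha, Finset.sum_insert ha, ih, zpow_add₀ hx]

/-- Parity is detected by the character (-1)^(∑ m i), which factors over the coordinates. -/
theorem hasSum_pi_parity {n : ℕ} (g : ℤ → ℂ) (hg : Summable fun j => ‖g j‖) :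
    (HasSum (fun m : {m : Fin n → ℤ // Even (∑ i, m i)} => ∏ i, g (m.1 i))
      (((∑' j, g j) ^ n + (∑' j, g j * (-1) ^ j) ^ n) / 2)) ∧
    HasSum (fun m : {m : Fin n → ℤ // Odd (∑ i, m i)} => ∏ i, g (m.1 i))
      (((∑' j, g j) ^ n - (∑' j, g j * (-1) ^ j) ^ n) / 2) := by
  have h1 := (hasSum_pi_prod (κ := Fin n) (fun _ => g) (fun _ => hg)).2
  have h2 := (hasSum_pi_prod (κ := Fin n) (fun _ j => g j * (-1) ^ j)
    (fun _ => by simpa using hg)).2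
  simp only [Finset.prod_const, Finset.card_univ, Fintype.card_fin,
    Finset.prod_mul_distrib] at h1 h2
  have h3 : ∀ m : Fin n → ℤ, ∏ i, (-1 : ℂ) ^ m i = (-1) ^ (∑ i, m i) := fun m =>
    prod_zpow_eq_zpow_sum (by norm_num) _ _
  simp only [h3] at h2
  constructor
  · refine (hasSum_subtype_iff_indicator (f := fun m : Fin n → ℤ => ∏ i, g (m i))
      (s := {m | Even (∑ i, m i)})).mpr (((h1.add h2).div_const 2).congr_fun fun m => ?_)
    by_cases hm : Even (∑ i, m i)
    · rw [Set.indicator_of_mem (by exact hm), hm.neg_one_zpow]; ring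
    · rw [Set.indicator_of_notMem (by exact hm), (Int.not_even_iff_odd.mp hm).neg_one_zpow]; ring
  · refine (hasSum_subtype_iff_indicator (f := fun m : Fin n → ℤ => ∏ i, g (m i))
      (s := {m | Odd (∑ i, m i)})).mpr (((h1.sub h2).div_const 2).congr_fun fun m => ?_)
    by_cases hm : Odd (∑ i, m i)
    · rw [Set.indicator_of_mem (by exact hm), hm.neg_one_zpow]; ring
    · rw [Set.indicator_of_notMem (by exact hm), (Int.not_odd_iff_even.mp hm).neg_one_zpow]; ring

/-! ### Jacobi's quartic identity -/

/-- The reflection n ↦ -1 - n fixes n² + n and reverses the sign. -/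
theorem tsum_thetaHalf_alternating (x : ℂ) : ∑' n : ℤ, x ^ (n ^ 2 + n) * (-1) ^ n = 0 := by
  have h : ∑' n : ℤ, x ^ (n ^ 2 + n) * (-1) ^ n = -∑' n : ℤ, x ^ (n ^ 2 + n) * (-1) ^ n := by
    rw [← tsum_neg, ← (Equiv.subLeft (-1 : ℤ)).tsum_eq]
    refine tsum_congr fun n => ?_
    simp only [Equiv.subLeft_apply]
    rw [show (-1 - n) ^ 2 + (-1 - n) = n ^ 2 + n by ring, zpow_sub₀ (by norm_num)]
    rcases Int.even_or_odd n with hn | hn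
    · rw [hn.neg_one_zpow]; norm_num
    · rw [hn.neg_one_zpow]; norm_num
  exact CharZero.eq_neg_self_iff.mp h

/-- Half of the Hadamard matrix of order four is an isometry from the integral vectors of odd
coordinate sum onto the half-integral vectors of even coordinate sum. -/
def hadamardEquiv :
    {m : Fin 4 → ℤ // Odd (∑ i, m i)} ≃ {n : Fin 4 → ℤ // Even (∑ i, n i)} where
  -- An integral vector n encodes the half-integral vector with coordinates n i + 1/2; hence the -1
  -- in each numerator here and the +2 in the first coordinate of the inverse. Parity makes all
  -- divisions exact.
  toFun m := ⟨![(m.1 0 + m.1 1 + m.1 2 + m.1 3 - 1) / 2, (m.1 0 + m.1 1 - m.1 2 - m.1 3 - 1) / 2,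
    (m.1 0 - m.1 1 + m.1 2 - m.1 3 - 1) / 2, (m.1 0 - m.1 1 - m.1 2 + m.1 3 - 1) / 2], by
      obtain ⟨k, hk⟩ := m.2
      rw [Fin.sum_univ_four] at hk ⊢
      simp only [Matrix.cons_val]
      rw [Int.even_iff]
      omega⟩
  invFun n := ⟨![(n.1 0 + n.1 1 + n.1 2 + n.1 3 + 2) / 2, (n.1 0 + n.1 1 - n.1 2 - n.1 3) / 2,
    (n.1 0 - n.1 1 + n.1 2 - n.1 3) / 2, (n.1 0 - n.1 1 - n.1 2 + n.1 3) / 2], by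
      obtain ⟨k, hk⟩ := n.2
      rw [Fin.sum_univ_four] at hk ⊢
      simp only [Matrix.cons_val]
      rw [Int.odd_iff]
      omega⟩
  left_inv m := by
    obtain ⟨k, hk⟩ := m.2
    rw [Fin.sum_univ_four] at hk
    ext i
    fin_cases i <;> simp only [Matrix.cons_val, Fin.zero_eta, Fin.mk_one, Fin.reduceFinMk] <;> omega
  right_inv n := by
    obtain ⟨k, hk⟩ := n.2
    rw [Fin.sum_univ_four] at hk
    ext i
    fin_cases i <;> simp only [Matrix.cons_val, Fin.zero_eta, Fin.mk_one, Fin.reduceFinMk] <;> omega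

/-- Preservation of the norm, where (n i + 1/2)² = n i² + n i + 1/4 and the four quarters add up to
the 1. -/
theorem hadamardEquiv_norm (m : {m : Fin 4 → ℤ // Odd (∑ i, m i)}) :
    ∑ i, (((hadamardEquiv m).1 i) ^ 2 + (hadamardEquiv m).1 i) + 1 = ∑ i, (m.1 i) ^ 2 := by
  obtain ⟨k, hk⟩ := m.2
  rw [Fin.sum_univ_four] at hk ⊢
  simp only [hadamardEquiv, Equiv.coe_fn_mk, Matrix.cons_val, Fin.sum_univ_four]
  have e0 : m.1 0 = 2 * k + 1 - m.1 1 - m.1 2 - m.1 3 := by linarith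
  rw [e0, show (2 * k + 1 - m.1 1 - m.1 2 - m.1 3 + m.1 1 + m.1 2 + m.1 3 - 1) / 2 = k by omega,
    show (2 * k + 1 - m.1 1 - m.1 2 - m.1 3 + m.1 1 - m.1 2 - m.1 3 - 1) / 2 =
      k - m.1 2 - m.1 3 by omega,
    show (2 * k + 1 - m.1 1 - m.1 2 - m.1 3 - m.1 1 + m.1 2 - m.1 3 - 1) / 2 =
      k - m.1 1 - m.1 3 by omega,
    show (2 * k + 1 - m.1 1 - m.1 2 - m.1 3 - m.1 1 - m.1 2 + m.1 3 - 1) / 2 =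
      k - m.1 1 - m.1 2 by omega]
  ring

/-- The two sides are twice the theta series of the vector coset and of a spinor coset of D₄, which
`hadamardEquiv` identifies isometrically (triality). -/
theorem jacobi_quartic {x : ℂ} (hx : ‖x‖ < 1) (hx0 : x ≠ 0) :
    thetaInt x ^ 4 - thetaAlt x ^ 4 = x * thetaHalf x ^ 4 := by
  have h1 := (hasSum_pi_parity (n := 4) (fun j => x ^ (j ^ 2)) (summable_norm_zpow_sq hx)).2
  have h2 := (hasSum_pi_parity (n := 4) (fun j => x ^ (j ^ 2 + j))
    (summable_norm_zpow_mul_succ hx)).1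
  rw [tsum_thetaHalf_alternating, ← hadamardEquiv.hasSum_iff] at h2
  have h3 := h1.unique ((h2.mul_left x).congr_fun fun m => ?_)
  · change (thetaInt x ^ 4 - thetaAlt x ^ 4) / 2 = x * ((thetaHalf x ^ 4 + 0 ^ 4) / 2) at h3
    linear_combination 2 * h3
  · rw [prod_zpow_eq_zpow_sum hx0, ← hadamardEquiv_norm, zpow_add_one₀ hx0, mul_comm,
      Function.comp_apply, prod_zpow_eq_zpow_sum hx0]


/-! ### Characters of the four modules -/

theorem L₀_apply {X : Sector} (v : FockSpace X) (s : FockLabel X) :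
    L₀ X v s = ((weight s : ℚ) : ℂ) * v s := by
  classical
  rw [L₀, Finsupp.linearCombination_apply, Finsupp.sum_apply, Finsupp.sum, Finset.sum_eq_single s]
  · simp [mul_comm]
  · intro t _ ht
    simp [ht]
  · intro hs
    simp [Finsupp.notMem_support_iff.mp hs]

theorem dimL₀_eq_card (X : Sector) (h : ℚ) :
    dimL₀ X h = Nat.card {s : FockLabel X // weight s = h} := by
  have h1 : Module.End.eigenspace (L₀ X) (h : ℂ) =
      Finsupp.supported ℂ ℂ {s : FockLabel X | weight s = h} := by
    ext v
    rw [Module.End.mem_eigenspace_iff, Finsupp.mem_supported', Finsupp.ext_iff]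
    refine forall_congr' fun s => ?_
    rw [L₀_apply, Finsupp.smul_apply, smul_eq_mul, mul_eq_mul_right_iff, Rat.cast_inj]
    exact or_iff_not_imp_left
  rw [dimL₀, h1, (Finsupp.supportedEquivFinsupp _).finrank_eq, Module.finrank, rank_finsupp_self]
  simp only [Cardinal.lift_id, Nat.card]
  rfl

/-- The shift of a coset: `0` for the integral and `1` for the half-integral vectors. -/
def shift : Sector → ℤ
  | .A => 0
  | .V => 0
  | .S => 1
  | .C => 1

/-- The parity condition that selects a coset among the integral or half-integral vectors. -/
def HasParity : Sector → (Fin 12 → ℤ) → Prop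
  | .A, m => Even (∑ i, m i)
  | .V, m => Odd (∑ i, m i)
  | .S, m => Even (∑ i, m i)
  | .C, m => Odd (∑ i, m i)

/-- The vector with coordinates `m i + shift X / 2`. -/
def shiftVec (X : Sector) (m : Fin 12 → ℤ) : Fin 12 → ℚ := fun i => m i + shift X / 2

theorem shiftVec_injective (X : Sector) : Function.Injective (shiftVec X) := fun m n h => by
  ext i
  have := congrFun h i
  simpa [shiftVec] using this

theorem sum_shiftVec (X : Sector) (m : Fin 12 → ℤ) :
    ∑ i, shiftVec X m i = ((∑ i, m i + 6 * shift X : ℤ) : ℚ) := by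
  simp only [shiftVec, Finset.sum_add_distrib, Finset.sum_const, Finset.card_univ,
    Fintype.card_fin]
  push_cast
  ring

theorem shiftVec_mem_coset (X : Sector) (m : Fin 12 → ℤ) :
    shiftVec X m ∈ coset X ↔ HasParity X m := by
  cases X <;> simp only [coset, Set.mem_ofPred_eq, sum_shiftVec, HasParity, shift, Int.even_iff,
    Int.odd_iff]
  · refine ⟨fun ⟨_, k, hk⟩ => ?_, fun h => ⟨fun i => ⟨m i, by simp [shiftVec, shift]⟩,
      (∑ i, m i) / 2, ?_⟩⟩
    · norm_cast at hk; omega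
    · norm_cast; omega
  · refine ⟨fun ⟨_, k, hk⟩ => ?_, fun h => ⟨fun i => ⟨m i, by simp [shiftVec, shift]⟩,
      (∑ i, m i) / 2, ?_⟩⟩
    · norm_cast at hk; omega
    · norm_cast; omega
  · refine ⟨fun ⟨_, k, hk⟩ => ?_, fun h => ⟨fun i => ⟨m i, by simp [shiftVec, shift]⟩,
      (∑ i, m i) / 2 + 3, ?_⟩⟩
    · norm_cast at hk; omega
    · norm_cast; omega
  · refine ⟨fun ⟨_, k, hk⟩ => ?_, fun h => ⟨fun i => ⟨m i, by simp [shiftVec, shift]⟩,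
      (∑ i, m i) / 2 + 3, ?_⟩⟩
    · norm_cast at hk; omega
    · norm_cast; omega

theorem exists_shiftVec_eq {X : Sector} {v : Fin 12 → ℚ} (hv : v ∈ coset X) :
    ∃ m, shiftVec X m = v := by
  have h : ∀ i, ∃ n : ℤ, (n : ℚ) + shift X / 2 = v i := by
    cases X <;> obtain ⟨hv, -⟩ := hv <;> intro i <;> obtain ⟨n, hn⟩ := hv i <;>
      exact ⟨n, by rw [hn]; simp [shift]⟩
  choose m hm using h
  exact ⟨m, funext hm⟩

/-- The parametrization of a coset by integral vectors. -/
def cosetEquiv (X : Sector) : {m // HasParity X m} ≃ coset X :=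
  Equiv.ofBijective (fun m => ⟨shiftVec X m.1, (shiftVec_mem_coset X m.1).mpr m.2⟩)
    ⟨fun _ _ h => Subtype.ext (shiftVec_injective X (congrArg Subtype.val h)), fun v => by
      obtain ⟨m, hm⟩ := exists_shiftVec_eq v.2
      exact ⟨⟨m, (shiftVec_mem_coset X m).mp (hm ▸ v.2)⟩, Subtype.ext hm⟩⟩

/-- The integer `2 * weight - 1` in terms of integral data. -/
def level (X : Sector) (m : Fin 12 → ℤ) (k : (Fin 12 × ℕ+) →₀ ℕ) : ℤ :=
  ∑ i, ((m i) ^ 2 + shift X * m i) + (3 * shift X - 1) +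
    k.sum fun j a => (a : ℤ) * (2 * ((j.2 : ℕ) : ℤ))

theorem two_mul_weight_sub_one {X : Sector} (m : {m // HasParity X m})
    (k : (Fin 12 × ℕ+) →₀ ℕ) :
    2 * weight ((cosetEquiv X m, k) : FockLabel X) - 1 = level X m.1 k := by
  have h1 : ((cosetEquiv X m : coset X) : Fin 12 → ℚ) = shiftVec X m.1 := rfl
  have h2 : (shift X : ℚ) ^ 2 = shift X := by cases X <;> simp [shift]
  have h3 : ∑ i, shiftVec X m.1 i ^ 2 =
      ∑ i, ((m.1 i : ℚ) ^ 2 + shift X * m.1 i) + 3 * shift X := by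
    have : ∀ i, shiftVec X m.1 i ^ 2 = (m.1 i : ℚ) ^ 2 + shift X * m.1 i + shift X / 4 := by
      intro i
      rw [shiftVec]
      linear_combination h2 / 4
    simp only [this, Finset.sum_add_distrib, Finset.sum_const, Finset.card_univ, Fintype.card_fin]
    ring
  simp only [weight, level, h1, h3, Finsupp.sum]
  push_cast
  have h4 : ∑ j ∈ k.support, (k j : ℚ) * (2 * ((j.2 : ℕ) : ℚ)) =
      2 * ∑ j ∈ k.support, (k j : ℚ) * ((j.2 : ℕ) : ℚ) := by
    rw [Finset.mul_sum]
    exact Finset.sum_congr rfl fun j _ => by ring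
  rw [h4]
  ring

/-- The theta series of a coset, without its leading power of `x`. -/
def latticeSum (X : Sector) (x : ℂ) : ℂ :=
  match X with
  | .A => (thetaInt x ^ 12 + thetaAlt x ^ 12) / 2
  | .V => (thetaInt x ^ 12 - thetaAlt x ^ 12) / 2
  | .S => thetaHalf x ^ 12 / 2
  | .C => thetaHalf x ^ 12 / 2

theorem summable_norm_lattice (X : Sector) {x : ℂ} (hx : ‖x‖ < 1) :
    Summable fun j : ℤ => ‖x ^ (j ^ 2 + shift X * j)‖ := by
  cases X <;> simp only [shift, zero_mul, add_zero, one_mul]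
  · exact summable_norm_zpow_sq hx
  · exact summable_norm_zpow_sq hx
  · exact summable_norm_zpow_mul_succ hx
  · exact summable_norm_zpow_mul_succ hx

theorem hasSum_lattice (X : Sector) {x : ℂ} (hx : ‖x‖ < 1) :
    HasSum (fun m : {m // HasParity X m} => ∏ i, x ^ ((m.1 i) ^ 2 + shift X * m.1 i))
      (latticeSum X x) := by
  have h := hasSum_pi_parity (n := 12) (fun j => x ^ (j ^ 2 + shift X * j))
    (summable_norm_lattice X hx)
  cases X <;> simp only [shift, zero_mul, add_zero, one_mul] at h ⊢
  · exact h.1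
  · exact h.2
  · rw [tsum_thetaHalf_alternating] at h
    rw [zero_pow (by norm_num), add_zero] at h
    exact h.1
  · rw [tsum_thetaHalf_alternating] at h
    rw [zero_pow (by norm_num), sub_zero] at h
    exact h.2

theorem hasProd_oscillators {q : ℂ} (hq : ‖q‖ < 1) :
    (Summable fun j : Fin 12 × ℕ+ => ‖q ^ (j.2 : ℕ)‖) ∧
      HasProd (fun j : Fin 12 × ℕ+ => 1 - q ^ (j.2 : ℕ)) (eulerProd q ^ 12) := by
  have h0 : Summable fun n : ℕ+ => ‖q ^ (n : ℕ)‖ := by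
    rw [← Equiv.pnatEquivNat.symm.summable_iff]
    simpa [Function.comp_def] using
      (summable_nat_add_iff 1).mpr (summable_geometric_of_lt_one (norm_nonneg _) hq)
  have h1 : Summable fun j : Fin 12 × ℕ+ => ‖q ^ (j.2 : ℕ)‖ := by
    simpa using (Summable.mul_norm (f := fun _ : Fin 12 => (1 : ℂ)) (g := fun n : ℕ+ => q ^ (n : ℕ))
      (hasSum_fintype _).summable h0)
  refine ⟨h1, ?_⟩
  have h2 : Multipliable fun j : Fin 12 × ℕ+ => 1 - q ^ (j.2 : ℕ) := by
    simpa only [sub_eq_add_neg] using multipliable_one_add_of_summable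
      (f := fun j : Fin 12 × ℕ+ => -q ^ (j.2 : ℕ)) (by simpa using h1)
  have h3 : HasProd (fun n : ℕ+ => 1 - q ^ (n : ℕ)) (eulerProd q) := by
    rw [← Equiv.pnatEquivNat.symm.hasProd_iff]
    exact (hasProd_eulerProd hq).congr_fun fun n => by simp
  have h4 := h2.hasProd.prod_fiberwise (g := fun _ => eulerProd q) fun _ => h3
  have h5 := h4.unique (hasProd_fintype _)
  simp only [Finset.prod_const, Finset.card_univ, Fintype.card_fin] at h5
  rw [← h5]
  exact h2.hasProd

/-- The character of a module as a function of `x = e(τ / 2)`. -/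
def char (X : Sector) (x : ℂ) : ℂ :=
  x ^ (3 * shift X - 1) * latticeSum X x * (eulerProd (x ^ 2) ^ 12)⁻¹

theorem hasSum_level (X : Sector) {x : ℂ} (hx : ‖x‖ < 1) (hx0 : x ≠ 0) :
    HasSum (fun p : {m // HasParity X m} × ((Fin 12 × ℕ+) →₀ ℕ) => x ^ level X p.1.1 p.2)
      (char X x) := by
  have hx2 := norm_sq_lt_one hx
  obtain ⟨h1, h2⟩ := hasProd_oscillators hx2
  obtain ⟨h3, h4⟩ := hasSum_finsupp_prod (fun j : Fin 12 × ℕ+ => (x ^ 2) ^ (j.2 : ℕ))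
    (fun j => by
      rw [norm_pow]
      exact pow_lt_one₀ (norm_nonneg _) hx2 j.2.ne_zero) h1
  have h5 := h4 _ h2 (pow_ne_zero _ (eulerProd_ne_zero hx2))
  have h6 := hasSum_lattice X hx
  have h7 : HasSum (fun p : {m // HasParity X m} × ((Fin 12 × ℕ+) →₀ ℕ) =>
      (∏ i, x ^ ((p.1.1 i) ^ 2 + shift X * p.1.1 i)) *
        p.2.prod fun j a => ((x ^ 2) ^ (j.2 : ℕ)) ^ a)
      (latticeSum X x * (eulerProd (x ^ 2) ^ 12)⁻¹) := by
    rw [← h6.tsum_eq, ← h5.tsum_eq, tsum_mul_tsum_of_summable_norm h6.summable.norm h3]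
    exact (summable_mul_of_summable_norm h6.summable.norm h3).hasSum
  have h8 := h7.mul_left (x ^ (3 * shift X - 1))
  rw [← mul_assoc] at h8
  refine h8.congr_fun fun p => ?_
  rw [level, zpow_add₀ hx0, zpow_add₀ hx0, prod_zpow_eq_zpow_sum hx0, Finsupp.prod, Finsupp.sum,
    ← prod_zpow_eq_zpow_sum hx0 p.2.support]
  have : ∀ j ∈ p.2.support, x ^ ((p.2 j : ℤ) * (2 * ((j.2 : ℕ) : ℤ))) =
      ((x ^ 2) ^ (j.2 : ℕ)) ^ p.2 j := by
    intro j _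
    rw [← pow_mul, ← pow_mul, ← zpow_natCast]
    congr 1
    push_cast
    ring
  rw [Finset.prod_congr rfl this]
  ring

/-- The sum over basis vectors is sorted by level; on each fibre the terms are constant, and the
cardinality of the fibre is the dimension of the eigenspace. -/
theorem hasSum_char (X : Sector) {x : ℂ} (hx : ‖x‖ < 1) (hx0 : x ≠ 0) :
    HasSum (fun k : ℤ => (dimL₀ X ((k : ℚ) / 2 + 1 / 2) : ℂ) * x ^ k) (char X x) := by
  have h1 := hasSum_level X hx hx0
  let L : {m // HasParity X m} × ((Fin 12 × ℕ+) →₀ ℕ) → ℤ := fun p => level X p.1.1 p.2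
  rw [← (Equiv.sigmaFiberEquiv L).hasSum_iff] at h1
  have hcard : ∀ k : ℤ, dimL₀ X ((k : ℚ) / 2 + 1 / 2) = Nat.card {p // L p = k} := by
    intro k
    rw [dimL₀_eq_card]
    refine (Nat.card_congr
      (((cosetEquiv X).prodCongr (Equiv.refl _)).subtypeEquiv fun p => ?_)).symm
    have h2 := two_mul_weight_sub_one p.1 p.2
    change level X p.1.1 p.2 = k ↔ weight ((cosetEquiv X p.1, p.2) : FockLabel X) = _
    rw [← @Int.cast_inj ℚ, ← h2]
    constructor <;> intro h <;> linarith
  refine h1.sigma fun k => ?_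
  have h2 : ∀ c : {p // L p = k}, ((fun p => x ^ level X p.1.1 p.2) ∘ Equiv.sigmaFiberEquiv L)
      ⟨k, c⟩ = x ^ k := fun c => by
    change x ^ L c.1 = x ^ k
    rw [c.2]
  have h3 : Summable fun c : {p // L p = k} =>
      ((fun p => x ^ level X p.1.1 p.2) ∘ Equiv.sigmaFiberEquiv L) ⟨k, c⟩ :=
    h1.summable.sigma_factor k
  convert h3.hasSum using 1
  simp only [h2, tsum_const, hcard, nsmul_eq_mul]

theorem dimL₀_eq_zero_of_level_ne {X : Sector} {k : ℤ}
    (h : ∀ m l, HasParity X m → level X m l ≠ k) :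
    dimL₀ X ((k : ℚ) / 2 + 1 / 2) = 0 := by
  rw [dimL₀_eq_card]
  refine @Nat.card_of_isEmpty _ ⟨fun ⟨⟨v, l⟩, hs⟩ => ?_⟩
  obtain ⟨m, rfl⟩ := (cosetEquiv X).surjective v
  have h2 := two_mul_weight_sub_one m l
  refine h m.1 l m.2 ?_
  rw [← @Int.cast_inj ℚ, ← h2, hs]
  ring

/-- Since a² ≡ a mod 2, the norm of an integral vector has the parity of its coordinate sum, while
a² + a is always even. So `A` carries the odd powers of x and the other three modules the even ones.
-/
theorem level_emod_two {X : Sector} {m : Fin 12 → ℤ} (hm : HasParity X m)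
    (l : (Fin 12 × ℕ+) →₀ ℕ) :
    X = .A ∧ level X m l % 2 = 1 ∨ X ≠ .A ∧ level X m l % 2 = 0 := by
  have h1 : ∀ a : ℤ, a ^ 2 % 2 = a % 2 := fun a => by
    rcases Int.emod_two_eq_zero_or_one a with h | h <;> simp [sq, Int.mul_emod, h]
  have h2 : (l.sum fun j a => (a : ℤ) * (2 * ((j.2 : ℕ) : ℤ))) % 2 = 0 := by
    refine Int.emod_eq_zero_of_dvd (Finset.dvd_sum fun j _ => ?_)
    exact Dvd.intro_left ((l j : ℤ) * (j.2 : ℕ)) (by ring)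
  have h3 : (∑ i, ((m i) ^ 2 + shift X * m i)) % 2 = (∑ i, (1 + shift X) * m i) % 2 := by
    rw [Finset.sum_int_mod, Finset.sum_int_mod Finset.univ 2 fun i => (1 + shift X) * m i]
    congr 1
    refine Finset.sum_congr rfl fun i _ => ?_
    have := h1 (m i)
    rw [add_mul, one_mul]
    omega
  rw [← Finset.mul_sum] at h3
  rw [level]
  cases X <;> simp only [HasParity, shift, Int.even_iff, Int.odd_iff, ne_eq, reduceCtorEq,
    not_true, not_false_iff, true_and, false_and, or_false, false_or] at * <;> omega

theorem level_ge (X : Sector) (m : Fin 12 → ℤ) (l : (Fin 12 × ℕ+) →₀ ℕ) :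
    3 * shift X - 1 ≤ level X m l := by
  have h1 : 0 ≤ l.sum fun j a => (a : ℤ) * (2 * ((j.2 : ℕ) : ℤ)) :=
    Finset.sum_nonneg fun j _ => by positivity
  have h2 : 0 ≤ ∑ i, ((m i) ^ 2 + shift X * m i) := by
    refine Finset.sum_nonneg fun i _ => ?_
    cases X <;> simp only [shift]
    · nlinarith [sq_nonneg (m i)]
    · nlinarith [sq_nonneg (m i)]
    · rcases le_or_gt 0 (m i) with h | h <;> nlinarith
    · rcases le_or_gt 0 (m i) with h | h <;> nlinarith
  rw [level]
  linarith


/-! ### The trace functions -/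

theorem e_add (z w : ℂ) : e (z + w) = e z * e w := by
  rw [e, e, e, ← Complex.exp_add]; ring_nf

theorem e_ne_zero (z : ℂ) : e z ≠ 0 := Complex.exp_ne_zero _

theorem e_intCast_mul (k : ℤ) (z : ℂ) : e (k * z) = e z ^ k := by
  rw [e, e, ← Complex.exp_int_mul]; ring_nf

theorem e_natCast_mul (k : ℕ) (z : ℂ) : e (k * z) = e z ^ k := by
  rw [e, e, ← Complex.exp_nat_mul]; ring_nf

theorem e_half_mul (k : ℤ) (τ : ℂ) : e ((k : ℂ) / 2 * τ) = e (τ / 2) ^ k := by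
  rw [← e_intCast_mul]; ring_nf

theorem e_half_sq (τ : ℂ) : e (τ / 2) ^ 2 = e τ := by
  rw [← e_natCast_mul]; push_cast; ring_nf

theorem e_one : e 1 = 1 := by
  rw [e, mul_one]; exact Complex.exp_two_pi_mul_I

theorem e_intCast (k : ℤ) : e k = 1 := by
  rw [← mul_one (k : ℂ), e_intCast_mul, e_one, one_zpow]

theorem e_one_half : e (1 / 2) = -1 := by
  rw [e, show 2 * (Real.pi : ℂ) * Complex.I * (1 / 2) = Real.pi * Complex.I by ring]
  exact Complex.exp_pi_mul_I

theorem norm_e (z : ℂ) : ‖e z‖ = Real.exp (-(2 * Real.pi * z.im)) := by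
  rw [e, Complex.norm_exp]
  congr 1
  simp

theorem norm_e_lt_one {z : ℂ} (hz : 0 < z.im) : ‖e z‖ < 1 := by
  rw [norm_e, Real.exp_lt_one_iff]
  have := Real.pi_pos
  have : 0 < 2 * Real.pi * z.im := by positivity
  linarith

theorem norm_e_half_lt_one {z : ℂ} (hz : 0 < z.im) : ‖e (z / 2)‖ < 1 := by
  refine norm_e_lt_one ?_
  rw [Complex.div_ofNat_im]
  linarith

theorem traceCoeff_zero_zero (n : ℚ) :
    traceCoeff 0 0 n = (dimL₀ .S (n + 1 / 2) : ℤ) - dimL₀ .V (n + 1 / 2) := by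
  simp [traceCoeff]

theorem traceCoeff_zero_one (n : ℚ) :
    traceCoeff 0 1 n = (dimL₀ .S (n + 1 / 2) : ℤ) + dimL₀ .V (n + 1 / 2) := by
  simp [traceCoeff]

theorem traceCoeff_one_zero (n : ℚ) :
    traceCoeff 1 0 n = (dimL₀ .A (n + 1 / 2) : ℤ) - dimL₀ .C (n + 1 / 2) := by
  simp [traceCoeff]

theorem traceCoeff_one_one (n : ℚ) :
    traceCoeff 1 1 n = -((dimL₀ .A (n + 1 / 2) : ℤ) + dimL₀ .C (n + 1 / 2)) := by
  simp [traceCoeff]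

/-- The trace function `f(x, y; τ)` as a function of `t = e(τ / 2)`. -/
def traceChar (x y : ZMod 2) (t : ℂ) : ℂ :=
  if x = 1 then
    if y = 1 then -(char .A t + char .C t) else char .A t - char .C t
  else
    if y = 1 then char .S t + char .V t else char .S t - char .V t

theorem zmod_two_eq (x : ZMod 2) : x = 0 ∨ x = 1 := by
  revert x; decide

theorem hasSum_traceChar (x y : ZMod 2) {t : ℂ} (ht : ‖t‖ < 1) (ht0 : t ≠ 0) :
    HasSum (fun k : ℤ => (traceCoeff x y ((k : ℚ) / 2) : ℂ) * t ^ k) (traceChar x y t) := by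
  have h := fun X => hasSum_char X ht ht0
  rw [traceChar]
  split_ifs with hx hy hy
  · refine ((h .A).add (h .C)).neg.congr_fun fun k => ?_
    simp [traceCoeff, hx, hy]; ring
  · refine ((h .A).sub (h .C)).congr_fun fun k => ?_
    simp [traceCoeff, hx, hy]; ring
  · refine ((h .S).add (h .V)).congr_fun fun k => ?_
    simp [traceCoeff, hx, hy]; ring
  · refine ((h .S).sub (h .V)).congr_fun fun k => ?_
    simp [traceCoeff, hx, hy]; ring

theorem hasSum_f (x y : ZMod 2) {τ : ℂ} (hτ : 0 < τ.im) :
    HasSum (fun k : ℤ => (traceCoeff x y ((k : ℚ) / 2) : ℂ) * e (τ / 2) ^ k) (f x y τ) := by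
  have h := (hasSum_traceChar x y (norm_e_half_lt_one hτ) (e_ne_zero _)).summable.hasSum
  simpa only [f, e_half_mul] using h

theorem f_eq_traceChar (x y : ZMod 2) {τ : ℂ} (hτ : 0 < τ.im) :
    f x y τ = traceChar x y (e (τ / 2)) :=
  (hasSum_f x y hτ).unique (hasSum_traceChar x y (norm_e_half_lt_one hτ) (e_ne_zero _))

/-- Jacobi's quartic identity in product form, with the common factor `eulerProd (x ^ 2) ^ 4`
cancelled. -/
theorem oddProd_neg_pow_eight {x : ℂ} (hx : ‖x‖ < 1) (hx0 : x ≠ 0) :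
    oddProd (-x) ^ 8 = oddProd x ^ 8 + 16 * x * evenProd x ^ 8 := by
  have h := jacobi_quartic hx hx0
  rw [thetaInt_eq hx hx0, thetaAlt_eq hx hx0, thetaHalf_eq hx hx0] at h
  have hP := pow_ne_zero 4 (eulerProd_ne_zero (norm_sq_lt_one hx))
  refine mul_left_cancel₀ hP ?_
  linear_combination h

theorem char_A {x : ℂ} (hx : ‖x‖ < 1) (hx0 : x ≠ 0) :
    char .A x = x⁻¹ * ((oddProd (-x) ^ 24 + oddProd x ^ 24) / 2) := by
  have hP := eulerProd_ne_zero (norm_sq_lt_one hx)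
  rw [char, latticeSum, thetaInt_eq hx hx0, thetaAlt_eq hx hx0]
  simp only [shift, mul_zero, zero_sub, zpow_neg, zpow_one]
  field_simp

theorem char_V {x : ℂ} (hx : ‖x‖ < 1) (hx0 : x ≠ 0) :
    char .V x = x⁻¹ * ((oddProd (-x) ^ 24 - oddProd x ^ 24) / 2) := by
  have hP := eulerProd_ne_zero (norm_sq_lt_one hx)
  rw [char, latticeSum, thetaInt_eq hx hx0, thetaAlt_eq hx hx0]
  simp only [shift, mul_zero, zero_sub, zpow_neg, zpow_one]
  field_simp

theorem char_S {x : ℂ} (hx : ‖x‖ < 1) (hx0 : x ≠ 0) :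
    char .S x = 2048 * x ^ 2 * evenProd x ^ 24 := by
  have hP := eulerProd_ne_zero (norm_sq_lt_one hx)
  rw [char, latticeSum, thetaHalf_eq hx hx0]
  simp only [shift, mul_one, show (3 : ℤ) - 1 = 2 by norm_num, zpow_ofNat]
  field_simp
  ring

theorem char_C_eq (x : ℂ) : char .C x = char .S x := rfl

theorem traceChar_one_zero {x : ℂ} (hx : ‖x‖ < 1) (hx0 : x ≠ 0) :
    traceChar 1 0 x = oddProd x ^ 24 / x + 24 := by
  have h1 := oddProd_neg_pow_eight hx hx0
  have h2 := oddProd_mul_oddProd_neg_mul_evenProd hx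
  simp only [traceChar, if_true, zero_ne_one, if_false]
  rw [char_C_eq, char_A hx hx0, char_S hx hx0]
  set a := oddProd (-x)
  set b := oddProd x
  set c := evenProd x
  have h3 : (b * a * c) ^ 8 = 1 := by rw [h2, one_pow]
  -- In the cube of a^8 = b^8 + 16 x c^8 the mixed terms are 48 x b^8 c^8 (b^8 + 16 x c^8) = 48 x
  -- (abc)^8 = 48 x. Half of 48 is the constant 24 of the trace functions.
  have h4 : a ^ 24 = b ^ 24 + 4096 * x ^ 3 * c ^ 24 + 48 * x := by
    have : a ^ 24 = (a ^ 8) ^ 3 := by ring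
    have h5 : b ^ 8 * (b ^ 8 + 16 * x * c ^ 8) * c ^ 8 = 1 := by rw [← h3, ← h1]; ring
    rw [this, h1]
    linear_combination 48 * x * h5
  rw [h4]
  field_simp
  ring

theorem traceChar_zero_zero {x : ℂ} (hx : ‖x‖ < 1) (hx0 : x ≠ 0) :
    traceChar 0 0 x = -24 := by
  have h1 := oddProd_neg_pow_eight hx hx0
  have h2 := oddProd_mul_oddProd_neg_mul_evenProd hx
  simp only [traceChar, zero_ne_one, if_false]
  rw [char_V hx hx0, char_S hx hx0]
  set a := oddProd (-x)
  set b := oddProd x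
  set c := evenProd x
  have h3 : (b * a * c) ^ 8 = 1 := by rw [h2, one_pow]
  have h4 : a ^ 24 = b ^ 24 + 4096 * x ^ 3 * c ^ 24 + 48 * x := by
    have : a ^ 24 = (a ^ 8) ^ 3 := by ring
    have h5 : b ^ 8 * (b ^ 8 + 16 * x * c ^ 8) * c ^ 8 = 1 := by rw [← h3, ← h1]; ring
    rw [this, h1]
    linear_combination 48 * x * h5
  rw [h4]
  field_simp
  ring

theorem traceChar_zero_one {x : ℂ} (hx : ‖x‖ < 1) (hx0 : x ≠ 0) :
    traceChar 0 1 x = 4096 * x ^ 2 * evenProd x ^ 24 + 24 := by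
  have h := traceChar_zero_zero hx hx0
  simp only [traceChar, zero_ne_one, if_false, if_true] at h ⊢
  rw [show char .V x = char .S x + 24 by linear_combination -h, char_S hx hx0]
  ring

theorem oddProd_ne_zero {x : ℂ} (hx : ‖x‖ < 1) : oddProd x ≠ 0 := fun h => by
  simpa [h] using oddProd_mul_oddProd_neg_mul_evenProd hx

theorem traceChar_one_one {x : ℂ} (hx : ‖x‖ < 1) (hx0 : x ≠ 0) :
    traceChar 1 1 x = -(oddProd (-x) ^ 24 / x) + 24 := by
  have h0 := traceChar_one_zero hx hx0
  have h1 := char_A hx hx0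
  simp only [traceChar, zero_ne_one, if_false, if_true] at h0 ⊢
  rw [show char .C x = char .A x - (oddProd x ^ 24 / x + 24) by linear_combination -h0, h1]
  field_simp
  ring

/-! ### Eta quotients -/

theorem eta_pow_eq (z : ℂ) : ModularForm.eta z ^ 24 = e z * eulerProd (e z) ^ 24 := by
  have h1 : Function.Periodic.qParam 1 z = e z := by simp [Function.Periodic.qParam, e]
  have h2 : Function.Periodic.qParam 24 z ^ 24 = e z := by
    rw [Function.Periodic.qParam, ← Complex.exp_nat_mul, e]
    congr 1
    push_cast
    ring
  simp only [ModularForm.eta, ModularForm.eta_q, h1, mul_pow, h2, eulerProd]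

theorem eta_ne_zero {z : ℂ} (hz : 0 < z.im) : ModularForm.eta z ≠ 0 :=
  ModularForm.eta_ne_zero (z := z) hz

theorem im_half_pos {τ : ℂ} (hτ : 0 < τ.im) : 0 < (τ / 2).im := by
  rw [Complex.div_ofNat_im]; linarith

theorem im_two_mul_pos {τ : ℂ} (hτ : 0 < τ.im) : 0 < (2 * τ).im := by simpa using hτ

theorem f_zero_zero {τ : ℂ} (hτ : 0 < τ.im) : f 0 0 τ = -24 := by
  rw [f_eq_traceChar 0 0 hτ, traceChar_zero_zero (norm_e_half_lt_one hτ) (e_ne_zero _)]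

theorem f_one_zero {τ : ℂ} (hτ : 0 < τ.im) :
    f 1 0 τ = ModularForm.eta (τ / 2) ^ 24 / ModularForm.eta τ ^ 24 + 24 := by
  have hx := norm_e_half_lt_one hτ
  have h0 := e_ne_zero (τ / 2)
  have h1 := oddProd_mul_eulerProd hx
  have h2 := eulerProd_ne_zero (norm_sq_lt_one hx)
  rw [f_eq_traceChar 1 0 hτ, traceChar_one_zero hx h0, eta_pow_eq, eta_pow_eq τ, ← e_half_sq τ,
    ← h1]
  field_simp

theorem f_zero_one {τ : ℂ} (hτ : 0 < τ.im) :
    f 0 1 τ = 4096 * ModularForm.eta (2 * τ) ^ 24 / ModularForm.eta τ ^ 24 + 24 := by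
  have hx := norm_e_half_lt_one hτ
  have h0 := e_ne_zero (τ / 2)
  have h1 := evenProd_mul_eulerProd hx
  have h2 := eulerProd_ne_zero (norm_sq_lt_one hx)
  have h3 : e (2 * τ) = e (τ / 2) ^ 4 := by
    rw [← e_natCast_mul]; push_cast; ring_nf
  rw [f_eq_traceChar 0 1 hτ, traceChar_zero_one hx h0, eta_pow_eq, eta_pow_eq τ, ← e_half_sq τ,
    h3, ← h1]
  field_simp

/-- The 24th power of Euler's identity. It yields the invariance of f(1,1) under inversion from the
exchange of f(1,0) and f(0,1). -/
theorem f_product {τ : ℂ} (hτ : 0 < τ.im) :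
    (f 1 0 τ - 24) * (f 0 1 τ - 24) * (f 1 1 τ - 24) = -4096 := by
  have hx := norm_e_half_lt_one hτ
  have h0 := e_ne_zero (τ / 2)
  have h2 := oddProd_mul_oddProd_neg_mul_evenProd hx
  rw [f_eq_traceChar 1 0 hτ, f_eq_traceChar 0 1 hτ, f_eq_traceChar 1 1 hτ,
    traceChar_one_zero hx h0, traceChar_one_one hx h0, traceChar_zero_one hx h0]
  set x := e (τ / 2)
  have h3 : (oddProd x * oddProd (-x) * evenProd x) ^ 24 = 1 := by rw [h2, one_pow]
  field_simp
  linear_combination -4096 * x ^ 2 * h3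

theorem im_neg_inv_pos {τ : ℂ} (hτ : 0 < τ.im) : 0 < (-1 / τ).im := by
  have h0 : τ ≠ 0 := fun h => by simp [h] at hτ
  rw [neg_div, one_div, Complex.neg_im, Complex.inv_im]
  have := Complex.normSq_pos.mpr h0
  rw [neg_div, neg_neg]
  positivity

theorem eta_neg_inv_pow {τ : ℂ} (hτ : 0 < τ.im) :
    ModularForm.eta (-1 / τ) ^ 24 = τ ^ 12 * ModularForm.eta τ ^ 24 := by
  have h0 : τ ≠ 0 := fun h => by simp [h] at hτ
  have key : ∀ z : ℍ, ModularForm.eta (-(z : ℂ)⁻¹) ^ 24 * ((z : ℂ) ^ 12)⁻¹ =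
      ModularForm.eta z ^ 24 := fun z => by
    have h1 := congrFun ModularForm.discriminant_S_invariant z
    rw [ModularForm.SL_slash_apply, UpperHalfPlane.modular_S_smul, ModularGroup.denom_S] at h1
    simpa [ModularForm.discriminant, ← inv_neg, zpow_neg] using h1
  have h2 := key ⟨τ, hτ⟩
  rw [← div_eq_mul_inv, div_eq_iff (pow_ne_zero 12 h0)] at h2
  rw [neg_div, one_div, h2, mul_comm]

theorem f_S_one_zero {τ : ℂ} (hτ : 0 < τ.im) : f 1 0 (-1 / τ) = f 0 1 τ := by
  have h0 : τ ≠ 0 := fun h => by simp [h] at hτ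
  have h1 := eta_ne_zero hτ
  rw [f_one_zero (im_neg_inv_pos hτ), f_zero_one hτ, eta_neg_inv_pow hτ,
    show -1 / τ / 2 = -1 / (2 * τ) by field_simp, eta_neg_inv_pow (im_two_mul_pos hτ)]
  field_simp
  ring

theorem f_neg_inv (x y : ZMod 2) {τ : ℂ} (hτ : 0 < τ.im) : f x y (-1 / τ) = f y x τ := by
  have h0 : τ ≠ 0 := fun h => by simp [h] at hτ
  have hS := im_neg_inv_pos hτ
  have h10 := f_S_one_zero hτ
  have h01 : f 0 1 (-1 / τ) = f 1 0 τ := by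
    rw [← f_S_one_zero hS]
    congr 1
    field_simp
  fin_cases x <;> fin_cases y
  · exact (f_zero_zero hS).trans (f_zero_zero hτ).symm
  · exact h01
  · exact h10
  · change f 1 1 (-1 / τ) = f 1 1 τ
    have h1 := f_product hτ
    have h2 := f_product hS
    rw [h10, h01, mul_comm (f 0 1 τ - 24), ← h1] at h2
    have h3 : (f 1 0 τ - 24) * (f 0 1 τ - 24) ≠ 0 := fun h => by
      rw [h, zero_mul] at h1
      norm_num at h1
    exact sub_left_injective (mul_left_cancel₀ h3 h2)

/-! ### Coefficients of the trace functions -/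

theorem dimL₀_eq_zero_of_odd {X : Sector} (hX : X ≠ .A) {k : ℤ} (hk : k % 2 = 1) :
    dimL₀ X ((k : ℚ) / 2 + 1 / 2) = 0 := by
  refine dimL₀_eq_zero_of_level_ne fun m l hm h => ?_
  rcases level_emod_two hm l with ⟨h1, -⟩ | ⟨-, h2⟩
  · exact hX h1
  · omega

theorem dimL₀_A_eq_zero_of_even {k : ℤ} (hk : k % 2 = 0) :
    dimL₀ .A ((k : ℚ) / 2 + 1 / 2) = 0 := by
  refine dimL₀_eq_zero_of_level_ne fun m l hm h => ?_
  rcases level_emod_two hm l with ⟨-, h2⟩ | ⟨h1, -⟩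
  · omega
  · exact h1 rfl

theorem dimL₀_eq_zero_of_lt {X : Sector} {k : ℤ} (hk : k < 3 * shift X - 1) :
    dimL₀ X ((k : ℚ) / 2 + 1 / 2) = 0 := by
  refine dimL₀_eq_zero_of_level_ne fun m l _ h => ?_
  have := level_ge X m l
  omega

theorem traceCoeff_eq_zero_of_lt (x y : ZMod 2) {k : ℤ} (hk : k < -1) :
    traceCoeff x y ((k : ℚ) / 2) = 0 := by
  have h : ∀ X, dimL₀ X ((k : ℚ) / 2 + 1 / 2) = 0 := fun X => by
    refine dimL₀_eq_zero_of_lt ?_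
    cases X <;> simp only [shift] <;> omega
  simp only [traceCoeff, h]
  simp

theorem traceCoeff_zero_eq_zero_of_neg (y : ZMod 2) {k : ℤ} (hk : k < 0) :
    traceCoeff 0 y ((k : ℚ) / 2) = 0 := by
  have hS : dimL₀ .S ((k : ℚ) / 2 + 1 / 2) = 0 :=
    dimL₀_eq_zero_of_lt (by simp only [shift]; omega)
  have hV : dimL₀ .V ((k : ℚ) / 2 + 1 / 2) = 0 := by
    rcases eq_or_ne k (-1) with rfl | h
    · exact dimL₀_eq_zero_of_odd (by simp) (by norm_num)
    · exact dimL₀_eq_zero_of_lt (by simp only [shift]; omega)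
  simp only [traceCoeff, hS, hV]
  simp

theorem traceCoeff_one_zero_index (y : ZMod 2) : traceCoeff 1 y 0 = 0 := by
  have hA := dimL₀_A_eq_zero_of_even (k := 0) rfl
  have hC := dimL₀_eq_zero_of_lt (X := .C) (k := 0) (by simp [shift])
  simp only [Int.cast_zero, zero_div] at hA hC
  simp [traceCoeff] at hA hC ⊢
  simp [hA, hC]

/-- By the parity of levels, the sign (-1)^k is -1 on `A` and 1 on `C`, `S`, `V`; it exchanges A - C
with -(A + C) and fixes the traces on the twisted module. -/
theorem traceCoeff_translate (x y : ZMod 2) (k : ℤ) :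
    (traceCoeff x y ((k : ℚ) / 2) : ℂ) * (-1) ^ k = traceCoeff x (y + x) ((k : ℚ) / 2) := by
  have h11 : (1 : ZMod 2) + 1 = 0 := rfl
  rcases Int.emod_two_eq_zero_or_one k with hk | hk
  · rw [(Int.even_iff.mpr hk).neg_one_zpow, mul_one]
    have hA := dimL₀_A_eq_zero_of_even hk
    rcases zmod_two_eq x with rfl | rfl <;> rcases zmod_two_eq y with rfl | rfl <;>
      simp only [add_zero, zero_add, h11, traceCoeff_one_zero, traceCoeff_one_one, hA] <;> simp
  · rw [(Int.odd_iff.mpr hk).neg_one_zpow]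
    have hV := dimL₀_eq_zero_of_odd (X := .V) (by simp) hk
    have hS := dimL₀_eq_zero_of_odd (X := .S) (by simp) hk
    have hC := dimL₀_eq_zero_of_odd (X := .C) (by simp) hk
    rcases zmod_two_eq x with rfl | rfl <;> rcases zmod_two_eq y with rfl | rfl <;>
      simp only [add_zero, zero_add, h11, traceCoeff_one_zero, traceCoeff_one_one,
        traceCoeff_zero_zero, traceCoeff_zero_one, hV, hS, hC] <;> simp

theorem f_add_one (x y : ZMod 2) {τ : ℂ} (hτ : 0 < τ.im) : f x y (τ + 1) = f x (y + x) τ := by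
  have hT : 0 < (τ + 1).im := by simpa using hτ
  refine (hasSum_f x y hT).unique ((hasSum_f x (y + x) hτ).congr_fun fun k => ?_)
  rw [← traceCoeff_translate, add_div, e_add, e_one_half, mul_zpow]
  ring

theorem dimL₀_A_zero : dimL₀ .A 0 = 1 := by
  rw [dimL₀_eq_card]
  have h0 : HasParity .A 0 := by simp [HasParity]
  rw [Nat.card_eq_one_iff_unique]
  have key : ∀ (m : {m // HasParity .A m}) (l : (Fin 12 × ℕ+) →₀ ℕ),
      weight ((cosetEquiv .A m, l) : FockLabel .A) = 0 ↔ m.1 = 0 ∧ l = 0 := by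
    intro m l
    have h1 := two_mul_weight_sub_one m l
    have h2 : weight ((cosetEquiv .A m, l) : FockLabel .A) = 0 ↔ level .A m.1 l = -1 := by
      rw [← @Int.cast_inj ℚ, ← h1]
      push_cast
      constructor <;> intro h <;> linarith
    rw [h2, level]
    simp only [shift, zero_mul, add_zero, mul_zero, zero_sub, Finsupp.sum]
    have h3 : 0 ≤ ∑ i, m.1 i ^ 2 := Finset.sum_nonneg fun i _ => sq_nonneg _
    have h4 : ∀ j ∈ l.support, 0 ≤ (l j : ℤ) * (2 * ((j.2 : ℕ) : ℤ)) := fun j _ => by positivity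
    have h5 := Finset.sum_nonneg h4
    constructor
    · intro h
      constructor
      · ext i
        have h6 : ∑ i, m.1 i ^ 2 = 0 := by linarith
        rw [Finset.sum_eq_zero_iff_of_nonneg fun i _ => sq_nonneg _] at h6
        simpa using h6 i (Finset.mem_univ i)
      · have h6 : ∑ j ∈ l.support, (l j : ℤ) * (2 * ((j.2 : ℕ) : ℤ)) = 0 := by linarith
        rw [Finset.sum_eq_zero_iff_of_nonneg h4] at h6
        ext j
        by_contra hj
        have := h6 j (by simpa using hj)
        simp at this
        exact hj this
    · rintro ⟨h, rfl⟩
      simp [h]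
  refine ⟨⟨fun ⟨⟨v, l⟩, hs⟩ ⟨⟨v', l'⟩, hs'⟩ => ?_⟩,
    ⟨⟨(cosetEquiv .A ⟨0, h0⟩, 0), (key _ _).mpr ⟨rfl, rfl⟩⟩⟩⟩
  obtain ⟨m, rfl⟩ := (cosetEquiv .A).surjective v
  obtain ⟨m', rfl⟩ := (cosetEquiv .A).surjective v'
  obtain ⟨h1, h2⟩ := (key _ _).mp hs
  obtain ⟨h3, h4⟩ := (key _ _).mp hs'
  have h5 : m = m' := Subtype.ext (h1.trans h3.symm)
  subst h5 h2 h4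
  rfl

theorem traceCoeff_one_zero_neg_half : traceCoeff 1 0 (-1 / 2) = 1 := by
  have hC := dimL₀_eq_zero_of_lt (X := .C) (k := -1) (by simp [shift])
  have hA := dimL₀_A_zero
  rw [traceCoeff_one_zero]
  norm_num at hC ⊢
  simp [hA, hC]

/-- Uniqueness of the coefficients of a convergent power series. -/
theorem coeff_eq_zero_of_hasSum_zero {c : ℕ → ℂ}
    (h : ∀ x : ℂ, x ≠ 0 → ‖x‖ < 1 → HasSum (fun k => c k * x ^ k) 0) (k : ℕ) : c k = 0 := by
  let p := FormalMultilinearSeries.ofScalars ℂ c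
  let g : ℂ → ℂ := fun x => ∑' k, c k * x ^ k
  have h1 : HasFPowerSeriesAt g p 0 := by
    rw [hasFPowerSeriesAt_iff]
    filter_upwards [Metric.ball_mem_nhds (0 : ℂ) one_pos] with z hz
    rw [zero_add]
    have hs : Summable fun k => c k * z ^ k := by
      rcases eq_or_ne z 0 with rfl | hz0
      · refine summable_of_ne_finset_zero (s := {0}) fun b hb => ?_
        simp at hb
        simp [hb]
      · exact (h z hz0 (by simpa using hz)).summable
    refine hs.hasSum.congr_fun fun k => ?_
    simp [p, FormalMultilinearSeries.coeff_ofScalars, mul_comm]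
  have h2 : g =ᶠ[𝓝[≠] 0] fun _ => 0 := by
    filter_upwards [self_mem_nhdsWithin, mem_nhdsWithin_of_mem_nhds
      (Metric.ball_mem_nhds (0 : ℂ) one_pos)] with z hz hz1
    exact (h z hz (by simpa using hz1)).tsum_eq
  -- The sums are prescribed only for x ≠ 0, where the character formulas apply; continuity of the
  -- power series supplies the point 0.
  have h3 : g =ᶠ[𝓝 0] fun _ => 0 :=
    (ContinuousAt.eventuallyEq_nhds_iff_eventuallyEq_nhdsNE h1.continuousAt
      continuousAt_const).mp h2
  have h4 := (h1.congr h3).eq_zero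
  have h5 : p.coeff k = 0 := by rw [h4]; rfl
  simpa [p, FormalMultilinearSeries.coeff_ofScalars] using h5

theorem hasSum_nat_of_int {c : ℤ → ℂ} {a : ℂ} (h : HasSum c a) (hc : ∀ k < 0, c k = 0) :
    HasSum (fun k : ℕ => c k) a := by
  refine (Function.Injective.hasSum_iff Nat.cast_injective fun k hk => ?_).mpr h
  refine hc k ?_
  by_contra hk0
  exact hk ⟨k.toNat, by simp; omega⟩

theorem traceCoeff_zero_zero_eq (k : ℕ) :
    traceCoeff 0 0 ((k : ℚ) / 2) = if k = 0 then -24 else 0 := by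
  have h := coeff_eq_zero_of_hasSum_zero
    (c := fun k => (traceCoeff 0 0 ((k : ℚ) / 2) : ℂ) - if k = 0 then -24 else 0)
    (fun x hx0 hx => by
      have h1 := hasSum_nat_of_int (hasSum_traceChar 0 0 hx hx0) fun k hk => by
        rw [traceCoeff_zero_eq_zero_of_neg 0 hk, Int.cast_zero, zero_mul]
      rw [traceChar_zero_zero hx hx0] at h1
      have h2 := h1.sub (hasSum_ite_eq (0 : ℕ) (-24 : ℂ))
      rw [sub_self] at h2
      refine h2.congr_fun fun k => ?_
      rcases eq_or_ne k 0 with rfl | hk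
      · simp
      · simp [hk]) k
  have h1 := sub_eq_zero.mp h
  split_ifs at h1 ⊢ <;> exact_mod_cast h1

theorem dimL₀_V_half : dimL₀ .V (1 / 2) = 24 := by
  have h := traceCoeff_zero_zero_eq 0
  have hS := dimL₀_eq_zero_of_lt (X := .S) (k := 0) (by simp [shift])
  rw [traceCoeff_zero_zero] at h
  norm_num at h hS ⊢
  omega

/-- Bose–Fermi cancellation: f(0,0) is constant, so its coefficients vanish away from n = 0. -/
theorem dimL₀_S_eq_V {n : ℤ} (hn : n ≠ 0) : dimL₀ .S ((n : ℚ) + 1 / 2) = dimL₀ .V (n + 1 / 2) := by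
  rcases lt_or_gt_of_ne hn with h | h
  · have h1 : ∀ X, dimL₀ X (((2 * n : ℤ) : ℚ) / 2 + 1 / 2) = 0 := fun X =>
      dimL₀_eq_zero_of_lt (by cases X <;> simp only [shift] <;> omega)
    have h2 : ((2 * n : ℤ) : ℚ) / 2 = n := by push_cast; ring
    simp only [h2] at h1
    rw [h1, h1]
  · obtain ⟨k, rfl⟩ := Int.eq_ofNat_of_zero_le h.le
    have h1 := traceCoeff_zero_zero_eq (2 * k)
    rw [if_neg (by omega), traceCoeff_zero_zero] at h1
    have h2 : ((2 * k : ℕ) : ℚ) / 2 = k := by push_cast; ring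
    rw [h2] at h1
    push_cast
    omega

/-! ### Holomorphy -/

theorem differentiableAt_eta {z : ℂ} (hz : 0 < z.im) : DifferentiableAt ℂ ModularForm.eta z :=
  ModularForm.differentiableAt_eta_of_mem_upperHalfPlaneSet hz

theorem eventually_im_pos {τ : ℂ} (hτ : 0 < τ.im) : ∀ᶠ z in 𝓝 τ, 0 < z.im :=
  (isOpen_lt continuous_const Complex.continuous_im).mem_nhds hτ

theorem differentiableAt_f_one_zero {τ : ℂ} (hτ : 0 < τ.im) : DifferentiableAt ℂ (f 1 0) τ := by
  have h1 : (fun z => ModularForm.eta (z / 2) ^ 24 / ModularForm.eta z ^ 24 + 24) =ᶠ[𝓝 τ] f 1 0 :=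
    (eventually_im_pos hτ).mono fun z hz => (f_one_zero hz).symm
  refine DifferentiableAt.congr_of_eventuallyEq ?_ h1.symm
  have h2 : DifferentiableAt ℂ (fun z => ModularForm.eta (z / 2)) τ :=
    (differentiableAt_eta (im_half_pos hτ)).comp τ
      (f := fun z => z / 2) (differentiableAt_id.div_const 2)
  exact ((h2.pow 24).div ((differentiableAt_eta hτ).pow 24)
    (pow_ne_zero _ (eta_ne_zero hτ))).add_const _

theorem differentiableAt_f (x y : ZMod 2) {τ : ℂ} (hτ : 0 < τ.im) :
    DifferentiableAt ℂ (f x y) τ := by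
  have h0 : τ ≠ 0 := fun h => by simp [h] at hτ
  fin_cases x <;> fin_cases y
  · exact (differentiableAt_const (-24 : ℂ)).congr_of_eventuallyEq
      ((eventually_im_pos hτ).mono fun z hz => f_zero_zero hz)
  · refine DifferentiableAt.congr_of_eventuallyEq (f := fun z => f 1 0 (-1 / z)) ?_
      ((eventually_im_pos hτ).mono fun z hz => (f_neg_inv 1 0 hz).symm)
    exact (differentiableAt_f_one_zero (im_neg_inv_pos hτ)).comp τ
      ((differentiableAt_const _).div differentiableAt_id h0)
  · exact differentiableAt_f_one_zero hτ
  · refine DifferentiableAt.congr_of_eventuallyEq (f := fun z => f 1 0 (z + 1)) ?_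
      ((eventually_im_pos hτ).mono fun z hz => by
        have := f_add_one 1 0 hz
        rw [zero_add] at this
        exact this.symm)
    exact (differentiableAt_f_one_zero (by simpa using hτ)).comp τ
      (differentiableAt_id.add_const _)


/-! ### Equivariance of the Hecke operators -/

open scoped MatrixGroups

open ModularGroup (S T)

/-- The value at `(x, y; τ)` of the translate of `g` by an integral matrix. -/
def matrixTranslate {N : ℕ} (g : ZMod N → ZMod N → ℂ → ℂ) (A : Matrix (Fin 2) (Fin 2) ℤ)
    (x y : ZMod N) (τ : ℂ) : ℂ :=
  g ((A 1 1 : ℤ) * x - (A 1 0 : ℤ) * y) ((A 0 0 : ℤ) * y - (A 0 1 : ℤ) * x)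
    (((A 0 0 : ℤ) * τ + (A 0 1 : ℤ)) / ((A 1 0 : ℤ) * τ + (A 1 1 : ℤ)))

/-- Equivariance of `g` under the generators of the modular group. -/
structure IsEquivariant {N : ℕ} (g : ZMod N → ZMod N → ℂ → ℂ) : Prop where
  translate : ∀ x y {τ : ℂ}, 0 < τ.im → g x y (τ + 1) = g x (y + x) τ
  invert : ∀ x y {τ : ℂ}, 0 < τ.im → g x y (-1 / τ) = g y (-x) τ

theorem isEquivariant_f : IsEquivariant f where
  translate x y _ hτ := f_add_one x y hτ
  invert x y _ hτ := by rw [f_neg_inv x y hτ, ZModModule.neg_eq_self]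

theorem moebius_im_pos {A : Matrix (Fin 2) (Fin 2) ℤ} (hA : 0 < A.det) {τ : ℂ} (hτ : 0 < τ.im) :
    ((A 1 0 : ℤ) * τ + (A 1 1 : ℤ) : ℂ) ≠ 0 ∧
      0 < (((A 0 0 : ℤ) * τ + (A 0 1 : ℤ)) / ((A 1 0 : ℤ) * τ + (A 1 1 : ℤ)) : ℂ).im := by
  rw [Matrix.det_fin_two] at hA
  have h0 : ((A 1 0 : ℤ) * τ + (A 1 1 : ℤ) : ℂ) ≠ 0 := by
    intro h
    have h1 := congrArg Complex.im h
    have h2 := congrArg Complex.re h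
    simp only [Complex.add_im, Complex.add_re, Complex.mul_im, Complex.mul_re, Complex.intCast_im,
      Complex.intCast_re, zero_mul, add_zero, sub_zero, Complex.zero_im, Complex.zero_re,
      mul_eq_zero, hτ.ne', or_false] at h1 h2
    rw [h1, zero_mul, zero_add] at h2
    have h3 : A 1 0 = 0 := by exact_mod_cast h1
    have h4 : A 1 1 = 0 := by exact_mod_cast h2
    simp [h3, h4] at hA
  refine ⟨h0, ?_⟩
  have h1 := Complex.normSq_pos.mpr h0
  rw [Complex.div_im]
  simp only [Complex.add_im, Complex.add_re, Complex.mul_im, Complex.mul_re, Complex.intCast_im,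
    Complex.intCast_re, zero_mul, add_zero, sub_zero]
  rw [← sub_div]
  refine div_pos ?_ h1
  have h2 : (0 : ℝ) < A 0 0 * A 1 1 - A 0 1 * A 1 0 := by exact_mod_cast hA
  nlinarith [mul_pos h2 hτ]

section

variable {N : ℕ} {g : ZMod N → ZMod N → ℂ → ℂ} {m : ℤ}

theorem IsEquivariant.matrixTranslate_T_smul (hg : IsEquivariant g) (hm : 0 < m)
    (A : FixedDetMatrix (Fin 2) ℤ m) (x y : ZMod N) {τ : ℂ} (hτ : 0 < τ.im) :
    matrixTranslate g (T • A).1 x y τ = matrixTranslate g A.1 x y τ := by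
  obtain ⟨h0, h1⟩ := moebius_im_pos (A := A.1) (by rw [A.2]; exact hm) hτ
  have e : (T • A).1 = !![A.1 0 0 + A.1 1 0, A.1 0 1 + A.1 1 1; A.1 1 0, A.1 1 1] := by
    rw [FixedDetMatrices.smul_coe]
    ext i j
    fin_cases i <;> fin_cases j <;> simp [T, Matrix.mul_apply, Fin.sum_univ_two]
  rw [matrixTranslate, matrixTranslate, e]
  simp only [Matrix.of_apply, Matrix.cons_val', Matrix.cons_val_zero, Matrix.cons_val_one,
    Matrix.cons_val_fin_one]
  have h2 := hg.translate ((A.1 1 1 : ℤ) * x - (A.1 1 0 : ℤ) * y)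
    (((A.1 0 0 + A.1 1 0 : ℤ) : ZMod N) * y - ((A.1 0 1 + A.1 1 1 : ℤ) : ZMod N) * x) h1
  convert h2 using 2
  · rw [div_add_one h0]
    push_cast
    ring
  · push_cast
    ring

theorem IsEquivariant.matrixTranslate_S_smul (hg : IsEquivariant g) (hm : 0 < m)
    (A : FixedDetMatrix (Fin 2) ℤ m) (x y : ZMod N) {τ : ℂ} (hτ : 0 < τ.im) :
    matrixTranslate g (S • A).1 x y τ = matrixTranslate g A.1 x y τ := by
  obtain ⟨h0, h1⟩ := moebius_im_pos (A := A.1) (by rw [A.2]; exact hm) hτ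
  have e : (S • A).1 = !![-A.1 1 0, -A.1 1 1; A.1 0 0, A.1 0 1] := by
    rw [FixedDetMatrices.smul_coe]
    ext i j
    fin_cases i <;> fin_cases j <;> simp [S, Matrix.mul_apply, Fin.sum_univ_two]
  rw [matrixTranslate, matrixTranslate, e]
  simp only [Matrix.of_apply, Matrix.cons_val', Matrix.cons_val_zero, Matrix.cons_val_one,
    Matrix.cons_val_fin_one]
  have h2 := hg.invert (((A.1 0 1 : ℤ) : ZMod N) * x - ((A.1 0 0 : ℤ) : ZMod N) * y)
    (((-A.1 1 0 : ℤ) : ZMod N) * y - ((-A.1 1 1 : ℤ) : ZMod N) * x) h1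
  convert h2 using 2
  · have h3 : ((A.1 0 0 : ℤ) * τ + (A.1 0 1 : ℤ) : ℂ) ≠ 0 := fun h => by simp [h] at h1
    field_simp
    push_cast
    ring
  · push_cast
    ring
  · ring

/-- Invariance under the generators S and T suffices. The translates thus depend only on the left
orbit of the matrix. -/
theorem IsEquivariant.matrixTranslate_smul (hg : IsEquivariant g) (hm : 0 < m) (γ : SL(2, ℤ))
    (A : FixedDetMatrix (Fin 2) ℤ m) (x y : ZMod N) {τ : ℂ} (hτ : 0 < τ.im) :
    matrixTranslate g (γ • A).1 x y τ = matrixTranslate g A.1 x y τ := by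
  have hγ : γ ∈ Subgroup.closure {S, T} := by
    rw [SpecialLinearGroup.SL2Z_generators]; trivial
  induction hγ using Subgroup.closure_induction generalizing A with
  | mem γ h =>
    rcases h with rfl | rfl
    · exact hg.matrixTranslate_S_smul hm A x y hτ
    · exact hg.matrixTranslate_T_smul hm A x y hτ
  | one => rw [one_smul]
  | mul γ δ _ _ h1 h2 => rw [mul_smul, h1, h2]
  | inv γ _ h => rw [← h (γ⁻¹ • A), smul_inv_smul]

/-- Multiplication from the right on matrices of fixed determinant. -/
def mulRightEquiv (m : ℤ) (γ : SL(2, ℤ)) :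
    FixedDetMatrix (Fin 2) ℤ m ≃ FixedDetMatrix (Fin 2) ℤ m where
  toFun A := ⟨A.1 * γ.1, by rw [Matrix.det_mul, γ.2, mul_one, A.2]⟩
  invFun A := ⟨A.1 * (γ⁻¹).1, by rw [Matrix.det_mul, (γ⁻¹).2, mul_one, A.2]⟩
  left_inv A := by
    apply FixedDetMatrices.ext'
    change A.1 * γ.1 * (γ⁻¹).1 = A.1
    rw [mul_assoc, ← Matrix.SpecialLinearGroup.coe_mul, mul_inv_cancel,
      Matrix.SpecialLinearGroup.coe_one, mul_one]
  right_inv A := by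
    apply FixedDetMatrices.ext'
    change A.1 * (γ⁻¹).1 * γ.1 = A.1
    rw [mul_assoc, ← Matrix.SpecialLinearGroup.coe_mul, inv_mul_cancel,
      Matrix.SpecialLinearGroup.coe_one, mul_one]

theorem mulRightEquiv_val (γ : SL(2, ℤ)) (A : FixedDetMatrix (Fin 2) ℤ m) :
    (mulRightEquiv m γ A).1 = A.1 * γ.1 := rfl

theorem mulRightEquiv_smul (γ δ : SL(2, ℤ)) (A : FixedDetMatrix (Fin 2) ℤ m) :
    mulRightEquiv m γ (δ • A) = δ • mulRightEquiv m γ A := by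
  apply FixedDetMatrices.ext'
  simp only [mulRightEquiv_val, FixedDetMatrices.smul_coe, mul_assoc]

/-- Left orbits of the modular group on matrices of fixed determinant. -/
abbrev LeftOrbits (m : ℤ) := MulAction.orbitRel.Quotient SL(2, ℤ) (FixedDetMatrix (Fin 2) ℤ m)

/-- The permutation of the left orbits given by multiplication from the right. -/
def orbitPerm (m : ℤ) (γ : SL(2, ℤ)) : LeftOrbits m ≃ LeftOrbits m :=
  Quotient.congr (mulRightEquiv m γ) fun A B => by
    change A ∈ MulAction.orbit _ B ↔ mulRightEquiv m γ A ∈ MulAction.orbit _ (mulRightEquiv m γ B)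
    refine exists_congr fun δ => ?_
    change δ • B = A ↔ δ • mulRightEquiv m γ B = mulRightEquiv m γ A
    rw [← mulRightEquiv_smul, (mulRightEquiv m γ).apply_eq_iff_eq]

end

/-! ### Upper triangular representatives of the left orbits -/

/-- The index set of the sum that defines a Hecke operator. -/
def heckeIndex (m : ℕ) : Finset (Σ _ : ℕ × ℕ, ℕ) :=
  m.divisorsAntidiagonal.sigma fun ad => Finset.range ad.2

theorem mem_heckeIndex {m : ℕ} {i : Σ _ : ℕ × ℕ, ℕ} :
    i ∈ heckeIndex m ↔ (i.1.1 * i.1.2 = m ∧ m ≠ 0) ∧ i.2 < i.1.2 := by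
  simp [heckeIndex, Nat.mem_divisorsAntidiagonal]

/-- The upper triangular representative of a left orbit. -/
def heckeRep (m : ℕ) (i : heckeIndex m) : FixedDetMatrix (Fin 2) ℤ (m : ℤ) :=
  ⟨!![(i.1.1.1 : ℤ), (i.1.2 : ℤ); 0, (i.1.1.2 : ℤ)], by
    rw [Matrix.det_fin_two_of, mul_zero, sub_zero]
    exact_mod_cast (mem_heckeIndex.mp i.2).1.1⟩

theorem heckeRep_injective_orbit {m : ℕ} {i j : heckeIndex m} {γ : SL(2, ℤ)}
    (h : γ • heckeRep m i = heckeRep m j) : i = j := by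
  obtain ⟨⟨⟨a, d⟩, b⟩, hi⟩ := i
  obtain ⟨⟨⟨a', d'⟩, b'⟩, hj⟩ := j
  obtain ⟨⟨had, hm⟩, hb⟩ := mem_heckeIndex.mp hi
  obtain ⟨⟨had', -⟩, hb'⟩ := mem_heckeIndex.mp hj
  simp only at had hb had' hb'
  have ha : 0 < a := Nat.pos_of_ne_zero fun h => hm (by rw [← had, h, zero_mul])
  have ha' : 0 < a' := Nat.pos_of_ne_zero fun h => hm (by rw [← had', h, zero_mul])
  have hd : 0 < d := by omega
  have hdet := γ.2
  rw [Matrix.det_fin_two] at hdet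
  have h1 := congrArg Subtype.val h
  rw [FixedDetMatrices.smul_coe] at h1
  have h00 := congrFun (congrFun h1 0) 0
  have h01 := congrFun (congrFun h1 0) 1
  have h10 := congrFun (congrFun h1 1) 0
  have h11 := congrFun (congrFun h1 1) 1
  simp only [heckeRep, Matrix.mul_apply, Fin.sum_univ_two, Matrix.of_apply, Matrix.cons_val',
    Matrix.cons_val_zero, Matrix.cons_val_one, Matrix.cons_val_fin_one, mul_zero, add_zero]
    at h00 h01 h10 h11
  have hc : γ.1 1 0 = 0 := by
    rcases mul_eq_zero.mp h10 with h | h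
    · exact h
    · omega
  rw [hc, mul_zero, sub_zero] at hdet
  rw [hc, zero_mul, zero_add] at h11
  have hp : γ.1 0 0 = 1 := by
    rcases Int.eq_one_or_neg_one_of_mul_eq_one hdet with h | h
    · exact h
    · rw [h] at h00; omega
  have hs : γ.1 1 1 = 1 := by rwa [hp, one_mul] at hdet
  rw [hp, one_mul] at h00 h01
  rw [hs, one_mul] at h11
  -- Both b and b' lie in [0, d) and differ by a multiple of d.
  have hn : γ.1 0 1 = 0 := by
    by_contra hne
    rcases lt_or_gt_of_ne hne with h | h <;> nlinarith
  rw [hn, zero_mul, add_zero] at h01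
  have e1 : a = a' := by omega
  have e2 : b = b' := by omega
  have e3 : d = d' := by omega
  subst e1 e2 e3
  rfl

/-- Hermite normal form: reduction by S and T ends at a matrix with lower left entry 0 and 0 ≤ b <
d. -/
theorem exists_smul_heckeRep {m : ℕ} (hm : m ≠ 0) (A : FixedDetMatrix (Fin 2) ℤ (m : ℤ)) :
    ∃ (γ : SL(2, ℤ)) (i : heckeIndex m), A = γ • heckeRep m i := by
  have hm' : (m : ℤ) ≠ 0 := by exact_mod_cast hm
  induction A using FixedDetMatrices.induction_on hm' with
  | h0 A h10 h00 h01 h11 =>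
    have hdet := A.2
    rw [Matrix.det_fin_two, h10, mul_zero, sub_zero] at hdet
    have hd : 0 < A.1 1 1 := by
      by_contra hd
      have : A.1 0 0 * A.1 1 1 ≤ 0 := mul_nonpos_of_nonneg_of_nonpos h00.le (not_lt.mp hd)
      omega
    rw [abs_of_nonneg h01, abs_of_pos hd] at h11
    obtain ⟨a, ha⟩ := Int.eq_ofNat_of_zero_le h00.le
    obtain ⟨b, hb⟩ := Int.eq_ofNat_of_zero_le h01
    obtain ⟨d, hd'⟩ := Int.eq_ofNat_of_zero_le hd.le
    rw [ha, hd'] at hdet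
    have hi : (⟨(a, d), b⟩ : Σ _ : ℕ × ℕ, ℕ) ∈ heckeIndex m := by
      rw [mem_heckeIndex]
      refine ⟨⟨by exact_mod_cast hdet, hm⟩, ?_⟩
      change b < d
      omega
    refine ⟨1, ⟨_, hi⟩, ?_⟩
    rw [one_smul]
    apply FixedDetMatrices.ext
    intro i j
    fin_cases i <;> fin_cases j <;> simp [heckeRep, ha, hb, hd', h10]
  | hS B h =>
    obtain ⟨γ, i, rfl⟩ := h
    exact ⟨S * γ, i, by rw [mul_smul]⟩
  | hT B h =>
    obtain ⟨γ, i, rfl⟩ := h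
    exact ⟨T * γ, i, by rw [mul_smul]⟩

/-- The index set of a Hecke operator parametrizes the left orbits. -/
def heckeOrbitEquiv {m : ℕ} (hm : m ≠ 0) : heckeIndex m ≃ LeftOrbits (m : ℤ) :=
  Equiv.ofBijective (fun i => Quotient.mk _ (heckeRep m i)) ⟨fun i j h => by
    obtain ⟨γ, hγ⟩ := Quotient.exact h
    exact (heckeRep_injective_orbit hγ).symm, fun q => by
    obtain ⟨A, rfl⟩ := Quotient.exists_rep q
    obtain ⟨γ, i, rfl⟩ := exists_smul_heckeRep hm A
    refine ⟨i, Quotient.sound ⟨γ⁻¹, ?_⟩⟩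
    exact inv_smul_smul γ _⟩

/-- The sum that defines a Hecke operator, without the factor `1 / m`. -/
def heckeSum {N : ℕ} (m : ℕ) (g : ZMod N → ZMod N → ℂ → ℂ) (x y : ZMod N) (τ : ℂ) : ℂ :=
  ∑ ad ∈ m.divisorsAntidiagonal, ∑ b ∈ Finset.range ad.2,
    g ((ad.2 : ZMod N) * x) ((ad.1 : ZMod N) * y - (b : ZMod N) * x)
      (((ad.1 : ℂ) * τ + (b : ℂ)) / (ad.2 : ℂ))

theorem hecke_eq {N : ℕ} (m : ℕ) (g : ZMod N → ZMod N → ℂ → ℂ) (x y : ZMod N) (τ : ℂ) :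
    hecke m g x y τ = 1 / (m : ℂ) * heckeSum m g x y τ := rfl

section

variable {N : ℕ} {g : ZMod N → ZMod N → ℂ → ℂ} {m : ℕ}

theorem heckeSum_eq_sum_heckeRep (m : ℕ) (g : ZMod N → ZMod N → ℂ → ℂ) (x y : ZMod N) (τ : ℂ) :
    heckeSum m g x y τ = ∑ i : heckeIndex m, matrixTranslate g (heckeRep m i).1 x y τ := by
  rw [heckeSum, Finset.sum_sigma', ← Finset.sum_coe_sort]
  refine Finset.sum_congr rfl fun i _ => ?_
  simp [matrixTranslate, heckeRep]

/-- Right multiplication commutes with the left action, so it permutes the left orbits and only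
reindexes the Hecke sum. The hypothesis `h` says that the change of arguments is right
multiplication by γ. -/
theorem IsEquivariant.heckeSum_of_mulRight (hg : IsEquivariant g) (γ : SL(2, ℤ))
    {x y x' y' : ZMod N} {τ τ' : ℂ} (hτ : 0 < τ.im) (h : ∀ A : FixedDetMatrix (Fin 2) ℤ (m : ℤ),
      matrixTranslate g A.1 x' y' τ' = matrixTranslate g (mulRightEquiv m γ A).1 x y τ) :
    heckeSum m g x' y' τ' = heckeSum m g x y τ := by
  rcases eq_or_ne m 0 with rfl | hm
  · simp [heckeSum]
  have hm' : (0 : ℤ) < m := by exact_mod_cast Nat.pos_of_ne_zero hm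
  let Φ : LeftOrbits (m : ℤ) → ℂ := Quotient.lift (fun A => matrixTranslate g A.1 x y τ) (by
    rintro A B ⟨δ, rfl⟩
    exact hg.matrixTranslate_smul hm' δ B x y hτ)
  let E := heckeOrbitEquiv hm
  rw [heckeSum_eq_sum_heckeRep, heckeSum_eq_sum_heckeRep]
  simp only [h]
  have h1 : ∀ i, matrixTranslate g (mulRightEquiv m γ (heckeRep m i)).1 x y τ =
      Φ (E (((E.trans (orbitPerm m γ)).trans E.symm) i)) := fun i => by
    rw [Equiv.trans_apply, Equiv.apply_symm_apply]
    rfl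
  simp only [h1]
  exact Equiv.sum_comp ((E.trans (orbitPerm m γ)).trans E.symm) fun i => Φ (E i)

theorem IsEquivariant.heckeSum (hg : IsEquivariant g) (m : ℕ) :
    IsEquivariant (heckeSum m g) where
  translate x y τ hτ := by
    refine hg.heckeSum_of_mulRight T hτ fun A => ?_
    have e : (mulRightEquiv m T A).1 =
        !![A.1 0 0, A.1 0 0 + A.1 0 1; A.1 1 0, A.1 1 0 + A.1 1 1] := by
      rw [mulRightEquiv_val]
      ext i j
      fin_cases i <;> fin_cases j <;>
        simp [T, Matrix.mul_apply, Fin.sum_univ_two]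
    rw [matrixTranslate, matrixTranslate, e]
    simp only [Matrix.of_apply, Matrix.cons_val', Matrix.cons_val_zero, Matrix.cons_val_one,
      Matrix.cons_val_fin_one]
    push_cast
    congr 1
    · ring
    · ring
    · ring
  invert x y τ hτ := by
    refine hg.heckeSum_of_mulRight S hτ fun A => ?_
    have e : (mulRightEquiv m S A).1 = !![A.1 0 1, -A.1 0 0; A.1 1 1, -A.1 1 0] := by
      rw [mulRightEquiv_val]
      ext i j
      fin_cases i <;> fin_cases j <;>
        simp [S, Matrix.mul_apply, Fin.sum_univ_two]
    have h0 : τ ≠ 0 := fun h => by simp [h] at hτ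
    rw [matrixTranslate, matrixTranslate, e]
    simp only [Matrix.of_apply, Matrix.cons_val', Matrix.cons_val_zero, Matrix.cons_val_one,
      Matrix.cons_val_fin_one]
    push_cast
    congr 1
    · ring
    · ring
    · rw [← mul_div_mul_right _ _ h0]
      congr 1
      · field_simp
        ring
      · field_simp
        ring

end


/-! ### Exponentials of power series -/

theorem coeff_pow_eq_zero_of_lt {L : PowerSeries ℂ} (hL : PowerSeries.constantCoeff L = 0)
    {k n : ℕ} (h : k < n) : PowerSeries.coeff k (L ^ n) = 0 :=
  PowerSeries.X_pow_dvd_iff.mp (pow_dvd_pow_of_dvd (PowerSeries.X_dvd_iff.mpr hL) n) k h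

/-- Cauchy products are submultiplicative for the sum of ‖coefficient · p^k‖; the norm bound
dominates the double series of the exponential. -/
theorem hasSum_coeff_pow {L : PowerSeries ℂ} {p : ℂ}
    (hs : Summable fun k => ‖PowerSeries.coeff k L * p ^ k‖) (n : ℕ) :
    (Summable fun k => ‖PowerSeries.coeff k (L ^ n) * p ^ k‖) ∧
      ∑' k, ‖PowerSeries.coeff k (L ^ n) * p ^ k‖ ≤ (∑' k, ‖PowerSeries.coeff k L * p ^ k‖) ^ n ∧
      ∑' k, PowerSeries.coeff k (L ^ n) * p ^ k = (∑' k, PowerSeries.coeff k L * p ^ k) ^ n := by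
  induction n with
  | zero =>
    have h : ∀ k, PowerSeries.coeff k (L ^ 0) * p ^ k = if k = 0 then 1 else 0 := fun k => by
      rw [pow_zero, PowerSeries.coeff_one]
      rcases eq_or_ne k 0 with rfl | hk
      · simp
      · simp [hk]
    simp only [h]
    have h1 : ∀ k : ℕ, ‖(if k = 0 then 1 else 0 : ℂ)‖ = if k = 0 then 1 else 0 := fun k => by
      split_ifs <;> simp
    simp only [h1, tsum_ite_eq, pow_zero, le_refl, and_true]
    exact (hasSum_ite_eq 0 (1 : ℝ)).summable
  | succ n ih =>
    obtain ⟨h1, h2, h3⟩ := ih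
    have h : ∀ k, PowerSeries.coeff k (L ^ (n + 1)) * p ^ k =
        ∑ kl ∈ Finset.HasAntidiagonal.antidiagonal k,
          (PowerSeries.coeff kl.1 (L ^ n) * p ^ kl.1) * (PowerSeries.coeff kl.2 L * p ^ kl.2) := by
      intro k
      rw [pow_succ, PowerSeries.coeff_mul, Finset.sum_mul]
      refine Finset.sum_congr rfl fun kl hkl => ?_
      rw [← Finset.HasAntidiagonal.mem_antidiagonal.mp hkl]
      ring
    simp only [h]
    have h4 := summable_norm_sum_mul_antidiagonal_of_summable_norm h1 hs
    refine ⟨h4, ?_, ?_⟩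
    · rw [pow_succ]
      refine le_trans ?_ (mul_le_mul_of_nonneg_right h2 (tsum_nonneg fun _ => norm_nonneg _))
      have h1' : Summable fun k => ‖‖PowerSeries.coeff k (L ^ n) * p ^ k‖‖ := by simpa using h1
      have hs' : Summable fun k => ‖‖PowerSeries.coeff k L * p ^ k‖‖ := by simpa using hs
      rw [tsum_mul_tsum_eq_tsum_sum_antidiagonal_of_summable_norm h1' hs']
      refine h4.tsum_le_tsum (fun k => ?_)
        (summable_norm_sum_mul_antidiagonal_of_summable_norm h1' hs').of_norm
      refine (norm_sum_le _ _).trans (Finset.sum_le_sum fun kl _ => ?_)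
      rw [norm_mul]
    · rw [pow_succ, ← h3, tsum_mul_tsum_eq_tsum_sum_antidiagonal_of_summable_norm h1 hs]

theorem hasSum_coeff_exp_subst {L : PowerSeries ℂ} (hL : PowerSeries.constantCoeff L = 0) (k : ℕ) :
    HasSum (fun n : ℕ => ((n.factorial : ℂ)⁻¹) * PowerSeries.coeff k (L ^ n))
      (PowerSeries.coeff k ((PowerSeries.exp ℂ).subst L)) := by
  have hsupp : ∀ n ∉ Finset.range (k + 1),
      ((n.factorial : ℂ)⁻¹) * PowerSeries.coeff k (L ^ n) = 0 := fun n hn => by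
    rw [coeff_pow_eq_zero_of_lt hL (by simpa using hn), mul_zero]
  have h1 := hasSum_sum_of_ne_finset_zero (L := .unconditional ℕ) hsupp
  convert h1 using 1
  rw [PowerSeries.coeff_subst' (PowerSeries.HasSubst.of_constantCoeff_zero' hL)]
  rw [finsum_eq_sum_of_support_subset (s := Finset.range (k + 1))]
  · refine Finset.sum_congr rfl fun n _ => ?_
    simp [PowerSeries.coeff_exp]
  · intro n hn
    by_contra hn'
    refine hn ?_
    simp only [coeff_pow_eq_zero_of_lt hL (show k < n by simpa using hn'), smul_zero]

/-- The double series of the exponential of a power series. -/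
def expTerm (L : PowerSeries ℂ) (p : ℂ) (q : ℕ × ℕ) : ℂ :=
  ((q.1.factorial : ℂ)⁻¹) * (PowerSeries.coeff q.2 (L ^ q.1) * p ^ q.2)

theorem summable_expTerm {L : PowerSeries ℂ} {p : ℂ}
    (hs : Summable fun k => ‖PowerSeries.coeff k L * p ^ k‖) : Summable (expTerm L p) := by
  have h : ∀ q, ‖expTerm L p q‖ =
      (q.1.factorial : ℝ)⁻¹ * ‖PowerSeries.coeff q.2 (L ^ q.1) * p ^ q.2‖ := fun q => by
    rw [expTerm, norm_mul, norm_inv, Complex.norm_natCast]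
  refine Summable.of_norm ((summable_prod_of_nonneg fun _ => norm_nonneg _).mpr ⟨fun n => ?_, ?_⟩)
  · simp only [h]
    exact (hasSum_coeff_pow hs n).1.mul_left _
  · refine Summable.of_nonneg_of_le (fun n => tsum_nonneg fun _ => norm_nonneg _) (fun n => ?_)
      (Real.summable_pow_div_factorial (∑' k, ‖PowerSeries.coeff k L * p ^ k‖))
    simp only [h]
    rw [tsum_mul_left, div_eq_inv_mul]
    exact mul_le_mul_of_nonneg_left (hasSum_coeff_pow hs n).2.1 (by positivity)

theorem hasSum_exp_div_factorial (z : ℂ) :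
    HasSum (fun n : ℕ => z ^ n / (n.factorial : ℂ)) (Complex.exp z) := by
  have h := NormedSpace.expSeries_div_hasSum_exp (𝔸 := ℂ) z
  rwa [← Complex.exp_eq_exp_ℂ] at h

theorem hasSum_column_of_row {F : ℕ × ℕ → ℂ} (hF : Summable F) {r c : ℕ → ℂ} {R : ℂ}
    (hrow : ∀ n, HasSum (fun k => F (n, k)) (r n)) (hcol : ∀ k, HasSum (fun n => F (n, k)) (c k))
    (hr : HasSum r R) : HasSum c R := by
  have h1 := hF.hasSum.prod_fiberwise hrow
  have h3 : HasSum (fun q : ℕ × ℕ => F (q.2, q.1)) (∑' q, F q) :=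
    (Equiv.prodComm ℕ ℕ).hasSum_iff.mpr hF.hasSum
  rw [← h1.unique hr]
  exact h3.prod_fiberwise hcol

theorem hasSum_expTerm_row {L : PowerSeries ℂ} {p : ℂ}
    (hs : Summable fun k => ‖PowerSeries.coeff k L * p ^ k‖) (n : ℕ) :
    HasSum (fun k => expTerm L p (n, k))
      ((∑' k, PowerSeries.coeff k L * p ^ k) ^ n / (n.factorial : ℂ)) := by
  have h := hasSum_coeff_pow hs n
  have h1 := h.1.of_norm.hasSum
  rw [h.2.2] at h1
  rw [div_eq_inv_mul]
  exact h1.mul_left ((n.factorial : ℂ)⁻¹)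

theorem hasSum_expTerm_column {L : PowerSeries ℂ} (hL : PowerSeries.constantCoeff L = 0) (p : ℂ)
    (k : ℕ) : HasSum (fun n => expTerm L p (n, k))
      (PowerSeries.coeff k ((PowerSeries.exp ℂ).subst L) * p ^ k) := by
  have h : (fun n => expTerm L p (n, k)) =
      fun n => ((n.factorial : ℂ)⁻¹ * PowerSeries.coeff k (L ^ n)) * p ^ k :=
    funext fun n => (mul_assoc _ _ _).symm
  rw [h]
  exact (hasSum_coeff_exp_subst hL k).mul_right (p ^ k)

/-- Evaluation at p commutes with the formal exponential: the double series is summed by rows on one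
side and by columns on the other. -/
theorem hasSum_exp_subst {L : PowerSeries ℂ} (hL : PowerSeries.constantCoeff L = 0) {p : ℂ}
    (hs : Summable fun k => ‖PowerSeries.coeff k L * p ^ k‖) :
    HasSum (fun k => PowerSeries.coeff k ((PowerSeries.exp ℂ).subst L) * p ^ k)
      (Complex.exp (∑' k, PowerSeries.coeff k L * p ^ k)) :=
  hasSum_column_of_row (summable_expTerm hs) (hasSum_expTerm_row hs) (hasSum_expTerm_column hL p)
    (hasSum_exp_div_factorial _)

/-- The equation φ' = φ D determines the coefficient k + 1 from those of index at most k. -/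
theorem eq_of_derivative_eq_mul {φ ψ D : PowerSeries ℂ}
    (h0 : PowerSeries.constantCoeff φ = PowerSeries.constantCoeff ψ)
    (hφ : PowerSeries.derivative ℂ φ = φ * D) (hψ : PowerSeries.derivative ℂ ψ = ψ * D) :
    φ = ψ := by
  ext k
  induction k using Nat.strong_induction_on with
  | _ k ih =>
    rcases k with _ | k
    · simpa using h0
    · have h1 := PowerSeries.coeff_derivative φ k
      have h2 := PowerSeries.coeff_derivative ψ k
      have hk : (k : ℂ) + 1 ≠ 0 := by exact_mod_cast Nat.succ_ne_zero k
      refine mul_right_cancel₀ hk ?_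
      rw [← h1, ← h2, hφ, hψ, PowerSeries.coeff_mul, PowerSeries.coeff_mul]
      refine Finset.sum_congr rfl fun kl hkl => ?_
      rw [ih kl.1 (by have := Finset.HasAntidiagonal.mem_antidiagonal.mp hkl; omega)]

theorem constantCoeff_exp_subst {L : PowerSeries ℂ} (hL : PowerSeries.constantCoeff L = 0) :
    PowerSeries.constantCoeff ((PowerSeries.exp ℂ).subst L) = 1 := by
  have h := hasSum_exp_subst hL (p := 0) (by
    refine summable_of_ne_finset_zero (s := {0}) fun b hb => ?_
    simp at hb
    simp [hb])
  have h1 : ∀ L : PowerSeries ℂ, HasSum (fun k => PowerSeries.coeff k L * 0 ^ k)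
      (PowerSeries.constantCoeff L) := fun L => by
    refine (hasSum_ite_eq 0 (PowerSeries.constantCoeff L)).congr_fun fun k => ?_
    rcases eq_or_ne k 0 with rfl | hk
    · simp
    · simp [hk]
  rw [(h1 L).tsum_eq, hL, Complex.exp_zero] at h
  exact (h1 _).unique h

theorem derivative_exp_subst {L : PowerSeries ℂ} (hL : PowerSeries.constantCoeff L = 0) :
    PowerSeries.derivative ℂ ((PowerSeries.exp ℂ).subst L) =
      (PowerSeries.exp ℂ).subst L * PowerSeries.derivative ℂ L := by
  rw [PowerSeries.derivative_subst (PowerSeries.HasSubst.of_constantCoeff_zero' hL),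
    PowerSeries.derivative_exp]

/-! ### Modular functions of level one that vanish at infinity -/

/-- P is a modular form of weight 0 and level one, hence constant, and the constant is its limit at
i∞. Invariance under all of SL(2, ℤ) reduces boundedness at every cusp to boundedness at i∞. -/
theorem eq_zero_of_level_one {P : ℂ → ℂ} (hd : ∀ τ : ℂ, 0 < τ.im → DifferentiableAt ℂ P τ)
    (hT : ∀ τ : ℂ, 0 < τ.im → P (τ + 1) = P τ) (hS : ∀ τ : ℂ, 0 < τ.im → P (-1 / τ) = P τ)
    (h0 : Tendsto P (comap Complex.im atTop) (𝓝 0)) {τ : ℂ} (hτ : 0 < τ.im) : P τ = 0 := by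
  let F : ℍ → ℂ := fun z => P z
  have hFT : SlashAction.map (0 : ℤ) ModularGroup.T F = F := by
    ext z
    rw [ModularForm.SL_slash_apply, UpperHalfPlane.modular_T_smul]
    simp only [neg_zero, zpow_zero, mul_one, F]
    rw [← hT z z.2, UpperHalfPlane.coe_vadd]
    congr 1
    push_cast
    ring
  have hFS : SlashAction.map (0 : ℤ) ModularGroup.S F = F := by
    ext z
    rw [ModularForm.SL_slash_apply, UpperHalfPlane.modular_S_smul]
    simp only [neg_zero, zpow_zero, mul_one, F]
    rw [← hS z z.2]
    congr 1
    rw [neg_div, one_div, ← inv_neg]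
  have hinv := SlashInvariantForm.slash_action_generators_SL2Z hFS hFT
  have hF0 : Tendsto F UpperHalfPlane.atImInfty (𝓝 0) := by
    refine h0.comp (tendsto_comap_iff.mpr ?_)
    exact tendsto_comap
  have hb : UpperHalfPlane.IsBoundedAtImInfty F := by
    rw [UpperHalfPlane.isBoundedAtImInfty_iff]
    have h1 := hF0.eventually (Metric.ball_mem_nhds 0 one_pos)
    rw [UpperHalfPlane.atImInfty, eventually_comap] at h1
    obtain ⟨A, hA⟩ := eventually_atTop.mp h1
    refine ⟨1, A, fun z hz => ?_⟩
    have := hA z.im hz z rfl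
    rw [dist_zero_right] at this
    exact this.le
  let M : ModularForm (Matrix.SpecialLinearGroup.mapGL (n := Fin 2) (R := ℤ) ℝ).range 0 :=
    { toFun := F
      slash_action_eq' := fun A hA => by
        obtain ⟨A, rfl⟩ := hA
        exact hinv A
      holo' := by
        rw [UpperHalfPlane.mdifferentiable_iff]
        refine DifferentiableOn.congr (f := P) (fun z hz => (hd z hz).differentiableWithinAt)
          fun z hz => ?_
        simp [F, UpperHalfPlane.ofComplex_apply_of_im_pos hz]
      bdd_at_cusps' := fun hc => by
        rw [Subgroup.IsArithmetic.isCusp_iff_isCusp_SL2Z] at hc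
        rw [OnePoint.isBoundedAt_iff_forall_SL2Z hc]
        intro γ _
        rw [hinv]
        exact hb }
  obtain ⟨c, hc⟩ := ModularFormClass.levelOne_weight_zero_const M
  have hc' : ∀ z, F z = c := fun z => congrFun hc z
  have h1 : c = 0 := by
    refine tendsto_nhds_unique (f := F) (l := UpperHalfPlane.atImInfty) ?_ hF0
    exact tendsto_const_nhds.congr fun z => (hc' z).symm
  exact (hc' ⟨τ, hτ⟩).trans h1


/-! ### Exponentials of Lambert-type series -/

theorem hasSum_divisorsAntidiagonal {E : Type*} [AddCommMonoid E] [TopologicalSpace E]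
    [ContinuousAdd E] [RegularSpace E] {F : ℕ × ℕ → E} {a : E}
    (h : HasSum (fun q : ℕ+ × ℕ+ => F (q.1, q.2)) a) :
    HasSum (fun m : ℕ => ∑ ad ∈ m.divisorsAntidiagonal, F ad) a := by
  have h1 := (sigmaAntidiagonalEquivProd.hasSum_iff.mpr h).sigma fun n => hasSum_fintype _
  refine (PNat.coe_injective.hasSum_iff fun m hm => ?_).mp (h1.congr_fun fun n => ?_)
  · rcases Nat.eq_zero_or_pos m with rfl | hm0
    · simp
    · exact (hm ⟨⟨m, hm0⟩, rfl⟩).elim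
  · rw [Function.comp_apply, ← Finset.sum_coe_sort]
    rfl

theorem hasSum_exp_subst_of_divisors {L : PowerSeries ℂ} {w : ℕ × ℕ → ℂ} {p a : ℂ}
    (hL : ∀ m, PowerSeries.coeff m L = ∑ ad ∈ m.divisorsAntidiagonal, w ad)
    (hw : HasSum (fun q : ℕ+ × ℕ+ => w (q.1, q.2) * p ^ ((q.1 : ℕ) * q.2)) a) :
    HasSum (fun k => PowerSeries.coeff k ((PowerSeries.exp ℂ).subst L) * p ^ k)
      (Complex.exp a) := by
  have hp : ∀ m, PowerSeries.coeff m L * p ^ m =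
      ∑ ad ∈ m.divisorsAntidiagonal, w ad * p ^ (ad.1 * ad.2) := fun m => by
    rw [hL, Finset.sum_mul]
    exact Finset.sum_congr rfl fun ad had => by rw [(Nat.mem_divisorsAntidiagonal.mp had).1]
  have h1 := hasSum_divisorsAntidiagonal (F := fun ad => w ad * p ^ (ad.1 * ad.2)) hw
  have h2 := hasSum_divisorsAntidiagonal (F := fun ad => ‖w ad * p ^ (ad.1 * ad.2)‖)
    hw.summable.norm.hasSum
  have hs : Summable fun m => ‖PowerSeries.coeff m L * p ^ m‖ :=
    Summable.of_nonneg_of_le (fun _ => norm_nonneg _)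
      (fun m => by rw [hp]; exact norm_sum_le _ _) h2.summable
  simp only [← hp] at h1
  rw [← h1.tsum_eq]
  refine hasSum_exp_subst ?_ hs
  rw [← PowerSeries.coeff_zero_eq_constantCoeff_apply, hL]
  simp

theorem summable_norm_pow_mul {p : ℂ} (hp : ‖p‖ < 1) :
    Summable fun q : ℕ+ × ℕ+ => ‖p‖ ^ ((q.1 : ℕ) * q.2) := by
  have h := summable_prod_mul_pow (𝕜 := ℝ) 0 (r := ‖p‖) (by simpa using hp)
  simpa using h

theorem norm_pow_lt_one {p : ℂ} (hp : ‖p‖ < 1) (d : ℕ+) : ‖p ^ (d : ℕ)‖ < 1 := by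
  rw [norm_pow]; exact pow_lt_one₀ (norm_nonneg _) hp d.ne_zero

/-- Double series whose rows are sums over the first index. -/
theorem hasSum_pnat_prod {p : ℂ} (hp : ‖p‖ < 1) {w : ℕ → ℂ} {C : ℝ} (hw : ∀ a, ‖w a‖ ≤ C)
    {r : ℂ → ℂ} (hr : ∀ z : ℂ, ‖z‖ < 1 → HasSum (fun a : ℕ+ => w a * z ^ (a : ℕ)) (r z)) :
    ∃ a, HasSum (fun q : ℕ+ × ℕ+ => w q.1 * p ^ ((q.1 : ℕ) * q.2)) a ∧
      HasSum (fun d : ℕ+ => r (p ^ (d : ℕ))) a := by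
  have hs : Summable fun q : ℕ+ × ℕ+ => w q.1 * p ^ ((q.1 : ℕ) * q.2) := by
    refine Summable.of_norm_bounded ((summable_norm_pow_mul hp).mul_left C) fun q => ?_
    rw [norm_mul, norm_pow]
    exact mul_le_mul_of_nonneg_right (hw _) (by positivity)
  refine ⟨_, hs.hasSum, ?_⟩
  have h := (Equiv.prodComm ℕ+ ℕ+).hasSum_iff.mpr hs.hasSum
  refine h.prod_fiberwise fun d => (hr _ (norm_pow_lt_one hp d)).congr_fun fun a => ?_
  simp only [Function.comp_apply, Equiv.prodComm_apply, Prod.swap_prod_mk]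
  rw [← pow_mul, mul_comm (a : ℕ)]

theorem hasSum_pnat_log {z : ℂ} (hz : ‖z‖ < 1) :
    HasSum (fun a : ℕ+ => (1 / (a : ℕ) : ℂ) * z ^ (a : ℕ)) (-Complex.log (1 - z)) := by
  refine (PNat.coe_injective.hasSum_iff (f := fun a : ℕ => (1 / (a : ℂ)) * z ^ a)
    fun m hm => ?_).mpr ((Complex.hasSum_taylorSeries_neg_log hz).congr_fun fun a => by ring)
  rcases Nat.eq_zero_or_pos m with rfl | hm0
  · simp
  · exact (hm ⟨⟨m, hm0⟩, rfl⟩).elim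

theorem hasSum_pnat_log_neg {z : ℂ} (hz : ‖z‖ < 1) :
    HasSum (fun a : ℕ+ => ((-1) ^ (a : ℕ) / (a : ℕ) : ℂ) * z ^ (a : ℕ)) (-Complex.log (1 + z)) := by
  have h := hasSum_pnat_log (z := -z) (by simpa using hz)
  rw [sub_neg_eq_add] at h
  refine h.congr_fun fun a => ?_
  rw [neg_pow z]
  ring

theorem hasProd_pnat_iff {F : ℕ → ℂ} {a : ℂ} :
    HasProd (fun d : ℕ+ => F d) a ↔ HasProd (fun n : ℕ => F (n + 1)) a := by
  rw [← Equiv.pnatEquivNat.symm.hasProd_iff]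
  rfl

theorem hasProd_one_add_pow {p : ℂ} (hp : ‖p‖ < 1) :
    HasProd (fun n : ℕ => 1 + p ^ (n + 1)) (oddProd p)⁻¹ := by
  have hp2 := norm_sq_lt_one hp
  have h := (hasProd_eulerProd hp2).mul ((hasProd_eulerProd hp).inv₀ (eulerProd_ne_zero hp))
  have h1 : eulerProd (p ^ 2) * (eulerProd p)⁻¹ = (oddProd p)⁻¹ := by
    rw [← oddProd_mul_eulerProd hp, mul_inv, mul_left_comm, mul_inv_cancel₀ (eulerProd_ne_zero hp2),
      mul_one]
  rw [h1] at h
  have h2 : ∀ n : ℕ, 1 + p ^ (n + 1) = (1 - (p ^ 2) ^ (n + 1)) * (1 - p ^ (n + 1))⁻¹ := fun n => by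
    rw [← div_eq_mul_inv, eq_div_iff (one_sub_pow_succ_ne_zero hp n)]
    ring
  simpa only [h2] using h

/-- By Euler, ∏(1 + p^d)^(-24) = `oddProd p ^ 24`; expanding -24 ∑ log(1 + p^d) and collecting
p^(ad) gives the divisor sums. -/
theorem hasSum_exp_oddProd {L : PowerSeries ℂ}
    (hL : ∀ m, PowerSeries.coeff m L =
      ∑ ad ∈ m.divisorsAntidiagonal, 24 * ((-1) ^ ad.1 / (ad.1 : ℂ)))
    {p : ℂ} (hp : ‖p‖ < 1) :
    HasSum (fun k => PowerSeries.coeff k ((PowerSeries.exp ℂ).subst L) * p ^ k)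
      (oddProd p ^ 24) := by
  obtain ⟨a, h1, h2⟩ := hasSum_pnat_prod hp (w := fun a => 24 * ((-1) ^ a / (a : ℂ))) (C := 24)
    (fun a => by
      rw [norm_mul, norm_div, norm_pow, norm_neg, norm_one, one_pow, Complex.norm_natCast]
      rcases Nat.eq_zero_or_pos a with rfl | ha
      · simp
      · have : (1 : ℝ) / a ≤ 1 := by
          rw [div_le_one (by positivity)]; exact_mod_cast ha
        simpa using this)
    (r := fun z => 24 * -Complex.log (1 + z))
    (fun z hz => ((hasSum_pnat_log_neg hz).mul_left 24).congr_fun fun a => by ring)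
  have h3 := hasSum_exp_subst_of_divisors hL h1
  have h4 := h2.cexp
  have h5 : HasProd (fun d : ℕ+ => (1 + p ^ (d : ℕ))⁻¹ ^ 24) (oddProd p ^ 24) := by
    rw [hasProd_pnat_iff (F := fun d => (1 + p ^ d)⁻¹ ^ 24)]
    have h := (hasProd_one_add_pow hp).inv₀ (inv_ne_zero (oddProd_ne_zero hp))
    rw [inv_inv] at h
    exact h.pow 24
  have h6 : Complex.exp a = oddProd p ^ 24 := by
    refine h4.unique (h5.congr_fun fun d => ?_)
    have hz := norm_pow_lt_one hp d
    have h0 : 1 + p ^ (d : ℕ) ≠ 0 := fun h => by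
      rw [← neg_eq_iff_add_eq_zero] at h
      simp [← h] at hz
    rw [Function.comp_apply, show (24 : ℂ) * -Complex.log (1 + p ^ (d : ℕ)) =
      (24 : ℕ) * -Complex.log (1 + p ^ (d : ℕ)) by norm_num, Complex.exp_nat_mul,
      Complex.exp_neg, Complex.exp_log h0]
  rwa [h6] at h3

/-- The coefficients of `p f(1, 0; 2σ)`. -/
def hauptCoeff (k : ℕ) : ℂ := (traceCoeff 1 0 (((k - 1 : ℤ) : ℚ) / 2) : ℂ)

theorem hauptCoeff_zero : hauptCoeff 0 = 1 := by
  rw [hauptCoeff, Nat.cast_zero, zero_sub, Int.cast_neg, Int.cast_one,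
    traceCoeff_one_zero_neg_half, Int.cast_one]

theorem hasSum_shift (x y : ZMod 2) {t : ℂ} (ht : ‖t‖ < 1) (ht0 : t ≠ 0) :
    HasSum (fun k : ℕ => (traceCoeff x y (((k - 1 : ℤ) : ℚ) / 2) : ℂ) * t ^ k)
      (t * traceChar x y t) := by
  have h1 := (Equiv.subRight (1 : ℤ)).hasSum_iff.mpr (hasSum_traceChar x y ht ht0)
  have h2 := hasSum_nat_of_int (h1.mul_left t) fun k hk => by
    rw [Function.comp_apply, Equiv.subRight_apply, traceCoeff_eq_zero_of_lt x y (by omega)]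
    simp
  refine h2.congr_fun fun k => ?_
  rw [Function.comp_apply, Equiv.subRight_apply, zpow_sub_one₀ ht0, zpow_natCast]
  field_simp

theorem hasSum_hauptCoeff {t : ℂ} (ht : ‖t‖ < 1) (ht0 : t ≠ 0) :
    HasSum (fun k : ℕ => hauptCoeff k * t ^ k) (oddProd t ^ 24 + 24 * t) := by
  have h := hasSum_shift 1 0 ht ht0
  rw [traceChar_one_zero ht ht0, mul_add, mul_div_cancel₀ _ ht0, mul_comm t] at h
  exact h

/-- The power series `p f(1, 0; 2σ)`. -/
def hauptSeries : PowerSeries ℂ := PowerSeries.mk hauptCoeff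

/-- The power series `∑ s_m p ^ m` with `s_m = ∑_{ad = m} (-1) ^ a 24 d`. -/
def altDivisorSeries : PowerSeries ℂ :=
  PowerSeries.mk fun m => ∑ ad ∈ m.divisorsAntidiagonal, 24 * (-1) ^ ad.1 * (ad.2 : ℂ)

/-- The logarithmic derivative of the product for p f(1,0;2σ) - 24p. It is the limit, as τ tends to
i∞, of the differential equation to be proved for (x,y) = (0,1). -/
theorem X_mul_derivative_hauptSeries :
    PowerSeries.X * PowerSeries.derivative ℂ (hauptSeries - 24 * PowerSeries.X) =
      altDivisorSeries * (hauptSeries - 24 * PowerSeries.X) := by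
  let L : PowerSeries ℂ := PowerSeries.mk fun m =>
    ∑ ad ∈ m.divisorsAntidiagonal, 24 * ((-1) ^ ad.1 / (ad.1 : ℂ))
  have hL : PowerSeries.constantCoeff L = 0 := by
    rw [← PowerSeries.coeff_zero_eq_constantCoeff_apply]
    simp [L]
  have h1 : hauptSeries - 24 * PowerSeries.X = (PowerSeries.exp ℂ).subst L := by
    ext k
    have h := coeff_eq_zero_of_hasSum_zero (c := fun k =>
      PowerSeries.coeff k (hauptSeries - 24 * PowerSeries.X) -
        PowerSeries.coeff k ((PowerSeries.exp ℂ).subst L)) (fun x hx0 hx => ?_) k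
    · exact sub_eq_zero.mp h
    have hX : HasSum (fun k : ℕ => PowerSeries.coeff k (24 * PowerSeries.X : PowerSeries ℂ) * x ^ k)
        (24 * x) := by
      convert hasSum_single (f := fun k : ℕ =>
        PowerSeries.coeff k (24 * PowerSeries.X : PowerSeries ℂ) * x ^ k) 1 (fun k hk => ?_) using 1
      · rw [← map_ofNat (PowerSeries.C (R := ℂ)), PowerSeries.coeff_C_mul]
        simp
      · rw [← map_ofNat (PowerSeries.C (R := ℂ)), PowerSeries.coeff_C_mul, PowerSeries.coeff_X,
          if_neg hk]
        simp
    have h2 := ((hasSum_hauptCoeff hx hx0).sub hX).sub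
      (hasSum_exp_oddProd (L := L) (fun m => by simp [L]) hx)
    rw [add_sub_cancel_right, sub_self] at h2
    refine h2.congr_fun fun k => ?_
    rw [map_sub, hauptSeries, PowerSeries.coeff_mk]
    ring
  have h2 : altDivisorSeries = PowerSeries.X * PowerSeries.derivative ℂ L := by
    ext m
    rcases m with _ | m
    · simp [altDivisorSeries]
    · rw [PowerSeries.coeff_succ_X_mul, PowerSeries.coeff_derivative, altDivisorSeries,
        PowerSeries.coeff_mk, PowerSeries.coeff_mk, Finset.sum_mul]
      refine Finset.sum_congr rfl fun ad had => ?_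
      have h3 := (Nat.mem_divisorsAntidiagonal.mp had).1
      have h4 : (ad.1 : ℂ) ≠ 0 := fun h => by
        have : ad.1 = 0 := by exact_mod_cast h
        rw [this, zero_mul] at h3
        omega
      have h5 : (m : ℂ) + 1 = ad.1 * ad.2 := by exact_mod_cast h3.symm
      rw [h5]
      field_simp
  rw [h1, derivative_exp_subst hL, h2]
  ring


/-! ### Behaviour at the cusp -/

/-- The filter of neighbourhoods of `i∞` in the complex plane. -/
abbrev atImTop : Filter ℂ := comap Complex.im atTop

theorem eventually_le_im (A : ℝ) : ∀ᶠ τ in atImTop, A ≤ τ.im :=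
  tendsto_comap.eventually (eventually_ge_atTop A)

theorem norm_e_half (τ : ℂ) : ‖e (τ / 2)‖ = Real.exp (-2 * Real.pi * τ.im / 2) := by
  rw [norm_e, Complex.div_ofNat_im]
  congr 1
  ring

theorem tendsto_norm_e_half : Tendsto (fun τ => ‖e (τ / 2)‖) atImTop (𝓝 0) := by
  simp only [norm_e_half]
  refine Real.tendsto_exp_atBot.comp ?_
  have h : Tendsto Complex.im atImTop atTop := tendsto_comap
  refine (h.const_mul_atTop_of_neg (r := -Real.pi) (by linarith [Real.pi_pos])).congr fun τ => ?_
  ring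

theorem f_sub_sum_le (x y : ZMod 2) (n : ℕ) : ∃ C, ∀ τ : ℂ, 1 ≤ τ.im →
    ‖e (τ / 2) * f x y τ - ∑ k ∈ Finset.range n,
      (traceCoeff x y (((k - 1 : ℤ) : ℚ) / 2) : ℂ) * e (τ / 2) ^ k‖ ≤ C * ‖e (τ / 2)‖ ^ n := by
  set c : ℕ → ℂ := fun k => (traceCoeff x y (((k - 1 : ℤ) : ℚ) / 2) : ℂ)
  have hs : ∀ τ : ℂ, 0 < τ.im → HasSum (fun k => c k * e (τ / 2) ^ k) (e (τ / 2) * f x y τ) :=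
    fun τ hτ => by
      rw [f_eq_traceChar x y hτ]
      exact hasSum_shift x y (norm_e_half_lt_one hτ) (e_ne_zero _)
  -- For Im τ ≥ 1 one has |e(τ/2)| ≤ r, so the convergent series at τ = i bounds all tails
  -- uniformly.
  set r := ‖e (Complex.I / 2)‖ with hr
  have hr0 : 0 < r := norm_pos_iff.mpr (e_ne_zero _)
  have h1 : Summable fun k => ‖c (k + n)‖ * r ^ k := by
    have h := ((summable_nat_add_iff n).mpr
      (hs Complex.I (by simp)).summable.norm).mul_right ((r ^ n)⁻¹)
    refine h.congr fun k => ?_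
    rw [norm_mul, norm_pow, ← hr, pow_add]
    field_simp
  refine ⟨∑' k, ‖c (k + n)‖ * r ^ k, fun τ hτ => ?_⟩
  have hle : ‖e (τ / 2)‖ ≤ r := by
    rw [hr, norm_e_half, norm_e_half, Real.exp_le_exp, Complex.I_im]
    nlinarith [Real.pi_pos]
  have h2 := (hasSum_nat_add_iff' n).mpr (hs τ (by linarith))
  refine h2.norm_le_of_bounded (h1.hasSum.mul_right _) fun k => ?_
  rw [norm_mul, norm_pow, pow_add, ← mul_assoc]
  gcongr

/-- The sign `(-1) ^ y`. -/
def sgn (y : ZMod 2) : ℂ := if y = 0 then 1 else -1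

theorem sgn_natCast (b : ℕ) : sgn (b : ZMod 2) = (-1) ^ b := by
  rw [sgn]
  rcases Nat.even_or_odd b with h | h
  · rw [if_pos ((ZMod.natCast_eq_zero_iff_even).mpr h), h.neg_one_pow]
  · rw [if_neg (fun h0 => Nat.not_even_iff_odd.mpr h (ZMod.natCast_eq_zero_iff_even.mp h0)),
      h.neg_one_pow]

/-- The terms of `f` that do not vanish at `i∞`. -/
def principalPart (x y : ZMod 2) (τ : ℂ) : ℂ :=
  if x = 1 then sgn y * e (-τ / 2) else -24 * sgn y

theorem traceCoeff_neg_half (x y : ZMod 2) :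
    (traceCoeff x y (-1 / 2) : ℂ) = if x = 1 then sgn y else 0 := by
  rcases zmod_two_eq x with rfl | rfl
  · have h := traceCoeff_zero_eq_zero_of_neg y (k := -1) (by norm_num)
    rw [Int.cast_neg, Int.cast_one] at h
    rw [h]
    simp
  · rw [if_pos rfl, sgn]
    rcases zmod_two_eq y with rfl | rfl
    · rw [traceCoeff_one_zero_neg_half, if_pos rfl, Int.cast_one]
    · have h := traceCoeff_translate 1 0 (-1)
      rw [Int.cast_neg, Int.cast_one, traceCoeff_one_zero_neg_half, zero_add] at h
      rw [← h]
      simp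

theorem traceCoeff_index_zero (x y : ZMod 2) :
    (traceCoeff x y 0 : ℂ) = if x = 1 then 0 else -24 * sgn y := by
  rcases zmod_two_eq x with rfl | rfl
  · rw [if_neg (by decide), sgn]
    rcases zmod_two_eq y with rfl | rfl
    · have h := traceCoeff_zero_zero_eq 0
      rw [Nat.cast_zero, zero_div] at h
      rw [h]
      simp
    · have hS := dimL₀_eq_zero_of_lt (X := .S) (k := 0) (by simp [shift])
      rw [Int.cast_zero, zero_div, zero_add] at hS
      rw [traceCoeff_zero_one, zero_add, hS, dimL₀_V_half]
      simp
  · rw [traceCoeff_one_zero_index]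
    simp

theorem tendsto_f_sub_principalPart (x y : ZMod 2) :
    Tendsto (fun τ => f x y τ - principalPart x y τ) atImTop (𝓝 0) := by
  obtain ⟨C, hC⟩ := f_sub_sum_le x y 2
  refine squeeze_zero_norm' ?_ (by simpa using tendsto_norm_e_half.const_mul C)
  filter_upwards [eventually_le_im 1] with τ hτ
  have h := hC τ hτ
  have h0 := e_ne_zero (τ / 2)
  have hn := norm_pos_iff.mpr h0
  refine le_of_mul_le_mul_left ?_ hn
  rw [← norm_mul]
  refine le_of_eq_of_le ?_ (h.trans_eq (by ring))
  congr 1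
  have hinv : e (-τ / 2) * e (τ / 2) = 1 := by
    rw [← e_add, show -τ / 2 + τ / 2 = ((0 : ℤ) : ℂ) by push_cast; ring, e_intCast]
  rw [Finset.sum_range_succ, Finset.sum_range_one, Nat.cast_zero, Nat.cast_one, zero_sub, sub_self,
    Int.cast_neg, Int.cast_one, Int.cast_zero, zero_div, traceCoeff_neg_half, traceCoeff_index_zero,
    principalPart]
  split_ifs
  · linear_combination -sgn y * hinv
  · ring

theorem tendsto_affine {a d : ℕ} (ha : 0 < a) (hd : 0 < d) (b : ℕ) :
    Tendsto (fun τ : ℂ => ((a : ℂ) * τ + b) / d) atImTop atImTop := by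
  rw [tendsto_comap_iff]
  have h : Tendsto Complex.im atImTop atTop := tendsto_comap
  refine (h.const_mul_atTop (r := (a : ℝ) / d) (by positivity)).congr fun τ => ?_
  rw [Function.comp_apply, Complex.div_natCast_im]
  simp
  ring

theorem pos_of_mem_divisorsAntidiagonal {m : ℕ} {ad : ℕ × ℕ} (h : ad ∈ m.divisorsAntidiagonal) :
    0 < ad.1 ∧ 0 < ad.2 := by
  obtain ⟨h1, h2⟩ := Nat.mem_divisorsAntidiagonal.mp h
  rw [← h1] at h2
  exact ⟨Nat.pos_of_ne_zero (left_ne_zero_of_mul h2), Nat.pos_of_ne_zero (right_ne_zero_of_mul h2)⟩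

theorem tendsto_heckeSum_sub (m : ℕ) (x y : ZMod 2) :
    Tendsto (fun τ => heckeSum m f x y τ - heckeSum m principalPart x y τ) atImTop (𝓝 0) := by
  have h : Tendsto (fun τ => ∑ ad ∈ m.divisorsAntidiagonal, ∑ b ∈ Finset.range ad.2,
      (f (ad.2 * x) (ad.1 * y - b * x) ((ad.1 * τ + b) / ad.2) -
        principalPart (ad.2 * x) (ad.1 * y - b * x) ((ad.1 * τ + b) / ad.2))) atImTop
      (𝓝 (∑ ad ∈ m.divisorsAntidiagonal, ∑ b ∈ Finset.range ad.2, 0)) := by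
    refine tendsto_finsetSum _ fun ad had => tendsto_finsetSum _ fun b _ => ?_
    obtain ⟨h1, h2⟩ := pos_of_mem_divisorsAntidiagonal had
    exact (tendsto_f_sub_principalPart _ _).comp (tendsto_affine h1 h2 b)
  simp only [Finset.sum_const_zero, Finset.sum_sub_distrib] at h
  exact h

theorem heckeSum_principalPart_zero_one (m : ℕ) (τ : ℂ) :
    heckeSum m principalPart 0 1 τ = -PowerSeries.coeff m altDivisorSeries := by
  rw [heckeSum, altDivisorSeries, PowerSeries.coeff_mk, ← Finset.sum_neg_distrib]
  refine Finset.sum_congr rfl fun ad _ => ?_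
  simp only [mul_zero, sub_zero, mul_one, principalPart, zero_ne_one, if_false, sgn_natCast,
    Finset.sum_const, Finset.card_range, nsmul_eq_mul]
  ring

theorem sum_pow_eq_zero {z : ℂ} {d : ℕ} (h : z ^ d = 1) (hz : z ≠ 1) :
    ∑ b ∈ Finset.range d, z ^ b = 0 := by
  have h1 := geom_sum_mul z d
  rw [h, sub_self] at h1
  exact (mul_eq_zero.mp h1).resolve_right (sub_ne_zero.mpr hz)

/-- The sum over b is geometric with ratio a d-th root of unity: -1 for even d, and e(1/2 - 1/(2d))
for odd d, which equals 1 only if d = 1. All polar terms except that of d = 1 cancel. -/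
theorem sum_principalPart {a d : ℕ} (hd : 0 < d) (τ : ℂ) :
    ∑ b ∈ Finset.range d, principalPart (d * 1) (a * 0 - b * 1) ((a * τ + b) / d) =
      if d = 1 then e (-(a : ℂ) * τ / 2) else 0 := by
  simp only [mul_one, mul_zero, zero_sub, ZModModule.neg_eq_self]
  rcases Nat.even_or_odd d with h | h
  · have h0 : (d : ZMod 2) = 0 := ZMod.natCast_eq_zero_iff_even.mpr h
    simp only [h0, principalPart, zero_ne_one, if_false, sgn_natCast]
    rw [← Finset.mul_sum, sum_pow_eq_zero h.neg_one_pow (by norm_num), if_neg, mul_zero]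
    rintro rfl
    exact absurd h (by decide)
  · have h0 : (d : ZMod 2) = 1 := ZMod.natCast_eq_one_iff_odd.mpr h
    have hd0 : (d : ℂ) ≠ 0 := by exact_mod_cast hd.ne'
    simp only [h0, principalPart, if_true, sgn_natCast]
    have h1 : ∀ b : ℕ, (-1) ^ b * e (-((a * τ + b) / d) / 2) =
        e (-(a * τ / d) / 2) * (e (1 / 2 - 1 / (2 * d))) ^ b := fun b => by
      rw [← e_one_half, ← e_natCast_mul, ← e_natCast_mul, ← e_add, ← e_add]
      congr 1
      field_simp
      ring
    simp only [h1]
    rw [← Finset.mul_sum]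
    split_ifs with hd1
    · subst hd1
      simp
    · rw [sum_pow_eq_zero, mul_zero]
      · obtain ⟨j, rfl⟩ := h
        have hj : e (j : ℂ) = 1 := by exact_mod_cast e_intCast j
        rw [← e_natCast_mul]
        refine (congrArg e ?_).trans hj
        field_simp
        push_cast
        ring
      · intro h2
        rw [e, Complex.exp_eq_one_iff] at h2
        obtain ⟨n, hn⟩ := h2
        have hpi := Complex.two_pi_I_ne_zero
        have h3 : (1 / 2 - 1 / (2 * d) : ℂ) = n := by
          refine mul_left_cancel₀ hpi ?_
          rw [hn, mul_comm]
        field_simp at h3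
        have h4 : (d : ℤ) - 1 = 2 * d * n := by exact_mod_cast h3
        have h5 : (d : ℤ) ∣ 1 := ⟨1 - 2 * n, by linear_combination -h4⟩
        exact hd1 (by exact_mod_cast Int.eq_one_of_dvd_one (by positivity) h5)

theorem heckeSum_principalPart_one_zero {m : ℕ} (hm : m ≠ 0) (τ : ℂ) :
    heckeSum m principalPart 1 0 τ = e (-(m : ℂ) * τ / 2) := by
  rw [heckeSum, Finset.sum_congr rfl fun ad had =>
    sum_principalPart (a := ad.1) (pos_of_mem_divisorsAntidiagonal had).2 τ]
  rw [Finset.sum_eq_single (m, 1)]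
  · simp
  · rintro ⟨a, d⟩ had hne
    rw [if_neg]
    rintro rfl
    have := (Nat.mem_divisorsAntidiagonal.mp had).1
    simp at this
    exact hne (by rw [this])
  · intro h
    simp [hm] at h


/-! ### The lift is the difference of two Hauptmoduln -/

/-- The power series `∑ H_m(x, y; τ) p ^ m` of the sums in the Hecke operators. -/
def heckeSumSeries (x y : ZMod 2) (τ : ℂ) : PowerSeries ℂ :=
  PowerSeries.mk fun m => heckeSum m f x y τ

/-- The power series `p (f(1, 0; 2σ) - f(x, y; τ))`. -/
def diffSeries (x y : ZMod 2) (τ : ℂ) : PowerSeries ℂ :=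
  hauptSeries - PowerSeries.C (f x y τ) * PowerSeries.X

/-- The defect in the differential equation that characterizes the lift. -/
def defectSeries (x y : ZMod 2) (τ : ℂ) : PowerSeries ℂ :=
  PowerSeries.X * PowerSeries.derivative ℂ (diffSeries x y τ) +
    heckeSumSeries x y τ * diffSeries x y τ

theorem coeff_X_mul_derivative (φ : PowerSeries ℂ) (n : ℕ) :
    PowerSeries.coeff n (PowerSeries.X * PowerSeries.derivative ℂ φ) =
      n * PowerSeries.coeff n φ := by
  rcases n with _ | n
  · simp
  · rw [PowerSeries.coeff_succ_X_mul, PowerSeries.coeff_derivative]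
    push_cast
    ring

theorem coeff_diffSeries (x y : ZMod 2) (τ : ℂ) (n : ℕ) :
    PowerSeries.coeff n (diffSeries x y τ) = hauptCoeff n - f x y τ * if n = 1 then 1 else 0 := by
  rw [diffSeries, map_sub, PowerSeries.coeff_C_mul, PowerSeries.coeff_X, hauptSeries,
    PowerSeries.coeff_mk]

theorem coeff_defectSeries (x y : ZMod 2) (τ : ℂ) (n : ℕ) :
    PowerSeries.coeff n (defectSeries x y τ) =
      n * (hauptCoeff n - f x y τ * if n = 1 then 1 else 0) +
        ∑ ij ∈ Finset.HasAntidiagonal.antidiagonal n, heckeSum ij.1 f x y τ *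
          (hauptCoeff ij.2 - f x y τ * if ij.2 = 1 then 1 else 0) := by
  rw [defectSeries, map_add, coeff_X_mul_derivative, PowerSeries.coeff_mul]
  simp only [coeff_diffSeries, heckeSumSeries, PowerSeries.coeff_mk]

theorem isEquivariant_coeff_defectSeries (n : ℕ) :
    IsEquivariant fun x y τ => PowerSeries.coeff n (defectSeries x y τ) where
  translate x y τ hτ := by
    simp only [coeff_defectSeries, isEquivariant_f.translate x y hτ,
      (isEquivariant_f.heckeSum _).translate x y hτ]
  invert x y τ hτ := by
    simp only [coeff_defectSeries, isEquivariant_f.invert x y hτ,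
      (isEquivariant_f.heckeSum _).invert x y hτ]

theorem affine_im_pos {a d : ℕ} (ha : 0 < a) (hd : 0 < d) (b : ℕ) {τ : ℂ} (hτ : 0 < τ.im) :
    0 < (((a : ℂ) * τ + b) / d).im := by
  rw [Complex.div_natCast_im]
  simp only [Complex.add_im, Complex.mul_im, Complex.natCast_re, Complex.natCast_im, zero_mul,
    add_zero]
  positivity

theorem differentiableAt_heckeSum (m : ℕ) (x y : ZMod 2) {τ : ℂ} (hτ : 0 < τ.im) :
    DifferentiableAt ℂ (heckeSum m f x y) τ := by
  unfold heckeSum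
  refine DifferentiableAt.fun_sum fun ad had => DifferentiableAt.fun_sum fun b _ => ?_
  obtain ⟨h1, h2⟩ := pos_of_mem_divisorsAntidiagonal had
  refine DifferentiableAt.comp τ (g := f _ _) (f := fun z : ℂ => ((ad.1 : ℂ) * z + b) / ad.2)
    (differentiableAt_f _ _ (affine_im_pos h1 h2 b hτ)) ?_
  fun_prop

theorem differentiableAt_coeff_defectSeries (n : ℕ) (x y : ZMod 2) {τ : ℂ} (hτ : 0 < τ.im) :
    DifferentiableAt ℂ (fun τ => PowerSeries.coeff n (defectSeries x y τ)) τ := by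
  simp only [coeff_defectSeries]
  have h1 := differentiableAt_f x y hτ
  have h2 := fun m => differentiableAt_heckeSum m x y hτ
  refine DifferentiableAt.add ?_ (DifferentiableAt.fun_sum fun ij _ => ?_)
  · exact ((differentiableAt_const _).sub (h1.mul_const _)).const_mul _
  · exact (h2 _).mul ((differentiableAt_const _).sub (h1.mul_const _))

/-- Here f(0,1) tends to 24 and the Hecke sums to minus the coefficients of `altDivisorSeries`, so
the limit of the defect vanishes by `X_mul_derivative_hauptSeries`. -/
theorem tendsto_coeff_defectSeries_zero_one (n : ℕ) :
    Tendsto (fun τ => PowerSeries.coeff n (defectSeries 0 1 τ)) atImTop (𝓝 0) := by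
  have hf : Tendsto (f 0 1) atImTop (𝓝 24) := by
    have h := (tendsto_f_sub_principalPart 0 1).add_const 24
    rw [zero_add] at h
    refine h.congr fun τ => ?_
    rw [principalPart, if_neg (by decide), sgn, if_neg (by decide)]
    ring
  have hH : ∀ m, Tendsto (heckeSum m f 0 1) atImTop (𝓝 (-PowerSeries.coeff m altDivisorSeries)) :=
    fun m => by
      have h := (tendsto_heckeSum_sub m 0 1).add_const (-PowerSeries.coeff m altDivisorSeries)
      rw [zero_add] at h
      refine h.congr fun τ => ?_
      rw [heckeSum_principalPart_zero_one]
      ring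
  have hE : ∀ j : ℕ, Tendsto (fun τ => hauptCoeff j - f 0 1 τ * if j = 1 then 1 else 0) atImTop
      (𝓝 (PowerSeries.coeff j (hauptSeries - 24 * PowerSeries.X))) := fun j => by
    rw [map_sub, ← map_ofNat (PowerSeries.C (R := ℂ)), PowerSeries.coeff_C_mul, PowerSeries.coeff_X,
      hauptSeries, PowerSeries.coeff_mk]
    exact (hf.mul_const _).const_sub _
  have h0 := congrArg (PowerSeries.coeff n) X_mul_derivative_hauptSeries
  rw [coeff_X_mul_derivative, PowerSeries.coeff_mul] at h0
  have h := ((hE n).const_mul (n : ℂ)).add (tendsto_finsetSum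
    (Finset.HasAntidiagonal.antidiagonal n) fun ij _ => (hH ij.1).mul (hE ij.2))
  rw [h0] at h
  simp only [neg_mul, Finset.sum_neg_distrib, add_neg_cancel] at h
  exact h.congr fun τ => (coeff_defectSeries 0 1 τ n).symm

/-- The regular part of the Hecke sums of `f(1, 0)`. -/
def heckeRest (m : ℕ) (τ : ℂ) : ℂ :=
  -- The Hecke sum of index 0 is empty; the correction lets the polar parts form the full geometric
  -- series over m ≥ 0.
  heckeSum m f 1 0 τ + (if m = 0 then 1 else 0) - (e (τ / 2))⁻¹ ^ m

theorem inv_e (z : ℂ) : (e z)⁻¹ = e (-z) := by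
  refine inv_eq_of_mul_eq_one_right ?_
  rw [← e_add, show z + -z = ((0 : ℤ) : ℂ) by push_cast; ring, e_intCast]

theorem tendsto_heckeRest (m : ℕ) : Tendsto (heckeRest m) atImTop (𝓝 0) := by
  rcases eq_or_ne m 0 with rfl | hm
  · refine tendsto_const_nhds.congr fun τ => ?_
    simp [heckeRest, heckeSum]
  · refine (tendsto_heckeSum_sub m 1 0).congr fun τ => ?_
    rw [heckeRest, if_neg hm, heckeSum_principalPart_one_zero hm, add_zero, inv_e, ← e_natCast_mul]
    congr 2
    ring

theorem heckeRest_add_two (m : ℕ) {τ : ℂ} (hτ : 0 < τ.im) :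
    heckeRest m (τ + 2) = heckeRest m τ := by
  have h := isEquivariant_f.heckeSum m
  have hτ1 : 0 < (τ + 1).im := by simpa using hτ
  have h1 : heckeSum m f 1 0 (τ + 2) = heckeSum m f 1 0 τ := by
    rw [show τ + 2 = τ + 1 + 1 by ring, h.translate 1 0 hτ1, h.translate _ _ hτ]
    rfl
  rw [heckeRest, heckeRest, h1, add_div, div_self two_ne_zero, e_add, e_one, mul_one]

/-- A holomorphic function of period 2 that tends to 0 at i∞ is a multiple of e(τ/2) up to a bounded
factor. This decay compensates the simple pole, in e(τ/2), of f(1,0). -/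
theorem isBigO_heckeRest (m : ℕ) :
    heckeRest m =O[atImTop] fun τ => ‖e (τ / 2)‖ := by
  -- The decay criterion requires periodicity on all of ℂ, hence the extension by zero below the
  -- real axis.
  have heq : (fun τ : ℂ => if 0 < τ.im then heckeRest m τ else 0) =ᶠ[atImTop] heckeRest m := by
    filter_upwards [eventually_le_im 1] with τ hτ
    rw [if_pos (by linarith)]
  have h := Function.Periodic.exp_decay_of_zero_at_inf (h := 2)
    (f := fun τ : ℂ => if 0 < τ.im then heckeRest m τ else 0) two_pos (fun τ => ?_) ?_ ?_
  · refine (h.congr' heq ?_)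
    exact Eventually.of_forall fun τ => (norm_e_half τ).symm
  · have him : (τ + ((2 : ℝ) : ℂ)).im = τ.im := by simp
    simp only [him]
    split_ifs with hτ
    · rw [← heckeRest_add_two m hτ]
      norm_num
    · rfl
  · filter_upwards [eventually_le_im 1] with τ hτ
    have hτ0 : 0 < τ.im := by linarith
    refine DifferentiableAt.congr_of_eventuallyEq (f := heckeRest m) ?_
      ((eventually_im_pos hτ0).mono fun z hz => if_pos hz)
    have he : DifferentiableAt ℂ (fun z => e (z / 2)) τ := by
      unfold e
      fun_prop
    exact ((differentiableAt_heckeSum m 1 0 hτ0).add_const _).sub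
      ((he.fun_inv (e_ne_zero _)).fun_pow m)
  · exact (tendsto_heckeRest m).congr' heq.symm

/-- With x = e(τ/2), the product of the geometric series ∑ x^(-m) p^m with `hauptSeries` produces
partial sums of the expansion of x f(1,0). They combine with f(1,0) into x^(-n-1) times a Taylor
remainder, where the poles cancel. -/
theorem coeff_succ_defectSeries_one_zero (n : ℕ) (τ : ℂ) :
    PowerSeries.coeff (n + 1) (defectSeries 1 0 τ) = n * hauptCoeff (n + 1) +
      ∑ ij ∈ Finset.HasAntidiagonal.antidiagonal (n + 1), heckeRest ij.1 τ * hauptCoeff ij.2 -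
      f 1 0 τ * heckeRest n τ - (e (τ / 2))⁻¹ ^ (n + 1) * (e (τ / 2) * f 1 0 τ -
        ∑ k ∈ Finset.range (n + 2), hauptCoeff k * e (τ / 2) ^ k) := by
  have hx := e_ne_zero (τ / 2)
  set x := e (τ / 2)
  let R : PowerSeries ℂ := PowerSeries.mk fun m => heckeRest m τ
  let P : PowerSeries ℂ := PowerSeries.mk fun m => x⁻¹ ^ m
  have hH : heckeSumSeries 1 0 τ = P + R - 1 := by
    ext m
    simp only [heckeSumSeries, P, R, map_sub, map_add, PowerSeries.coeff_mk, PowerSeries.coeff_one,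
      heckeRest]
    ring
  have hP : PowerSeries.coeff (n + 1) (P * hauptSeries) =
      x⁻¹ ^ (n + 1) * ∑ k ∈ Finset.range (n + 2), hauptCoeff k * x ^ k := by
    rw [mul_comm, PowerSeries.coeff_mul, Finset.Nat.sum_antidiagonal_eq_sum_range_succ_mk,
      Finset.mul_sum]
    refine Finset.sum_congr rfl fun k hk => ?_
    simp only [hauptSeries, P, PowerSeries.coeff_mk]
    have hk' : n + 1 = (n + 1 - k) + k := by have := Finset.mem_range.mp hk; omega
    have hxk : x⁻¹ ^ k * x ^ k = 1 := by rw [← mul_pow, inv_mul_cancel₀ hx, one_pow]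
    rw [hk', pow_add, Nat.add_sub_cancel]
    linear_combination -(hauptCoeff k * x⁻¹ ^ (n + 1 - k)) * hxk
  have hR : PowerSeries.coeff (n + 1) (R * hauptSeries) =
      ∑ ij ∈ Finset.HasAntidiagonal.antidiagonal (n + 1), heckeRest ij.1 τ * hauptCoeff ij.2 := by
    simp only [PowerSeries.coeff_mul, R, hauptSeries, PowerSeries.coeff_mk]
  have h1 : defectSeries 1 0 τ = PowerSeries.X * PowerSeries.derivative ℂ (diffSeries 1 0 τ) +
      (P * hauptSeries + R * hauptSeries - hauptSeries -
        PowerSeries.C (f 1 0 τ) * ((P + R - 1) * PowerSeries.X)) := by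
    rw [defectSeries, hH, diffSeries]
    ring
  rw [h1, map_add, coeff_X_mul_derivative, coeff_diffSeries, map_sub, map_sub, map_add, hP, hR,
    PowerSeries.coeff_C_mul, PowerSeries.coeff_succ_mul_X]
  simp only [map_sub, map_add, P, R, PowerSeries.coeff_mk, PowerSeries.coeff_one, hauptSeries]
  rcases Nat.eq_zero_or_pos n with rfl | hn
  · simp
    field_simp
    ring
  · rw [if_neg (by omega), if_neg (by omega)]
    push_cast
    linear_combination f 1 0 τ * x⁻¹ ^ n * mul_inv_cancel₀ hx

theorem isBigO_one_of_le {u : ℂ → ℂ} (h : ∃ C, ∀ τ : ℂ, 1 ≤ τ.im → ‖u τ‖ ≤ C) :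
    u =O[atImTop] fun _ => (1 : ℝ) := by
  obtain ⟨C, hC⟩ := h
  refine Asymptotics.IsBigO.of_bound C ?_
  filter_upwards [eventually_le_im 1] with τ hτ
  simpa using hC τ hτ

theorem isBigO_coeff_defectSeries_one_zero (n : ℕ) :
    (fun τ => PowerSeries.coeff n (defectSeries 1 0 τ)) =O[atImTop] fun _ => (1 : ℝ) := by
  rcases n with _ | n
  · have h0 : ∀ τ, PowerSeries.coeff 0 (defectSeries 1 0 τ) = 0 := fun τ => by
      simp [coeff_defectSeries, heckeSum]
    simp only [h0]
    exact Asymptotics.isBigO_zero _ _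
  have hone : (fun τ => ‖e (τ / 2)‖) =O[atImTop] fun _ => (1 : ℝ) :=
    tendsto_norm_e_half.isBigO_one ℝ
  have hconst : ∀ c : ℂ, (fun _ : ℂ => c) =O[atImTop] fun _ => (1 : ℝ) := fun c =>
    Asymptotics.isBigO_const_const c one_ne_zero _
  have hR : ∀ m, heckeRest m =O[atImTop] fun _ => (1 : ℝ) := fun m =>
    (isBigO_heckeRest m).trans hone
  simp only [coeff_succ_defectSeries_one_zero]
  refine (((hconst _).add (Asymptotics.IsBigO.fun_sum fun ij _ => ?_)).sub ?_).sub ?_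
  · simpa using (hR ij.1).mul (hconst (hauptCoeff ij.2))
  · obtain ⟨C, hC⟩ := f_sub_sum_le 1 0 0
    simp only [Finset.range_zero, Finset.sum_empty, sub_zero, pow_zero, mul_one] at hC
    have h1 := (isBigO_one_of_le ⟨C, hC⟩).mul (isBigO_heckeRest n)
    have h2 : (fun τ => ‖e (τ / 2)‖⁻¹) =O[atImTop] fun τ => ‖e (τ / 2)‖⁻¹ :=
      Asymptotics.isBigO_refl _ _
    have h3 : (fun τ => (e (τ / 2))⁻¹) =O[atImTop] fun τ => ‖e (τ / 2)‖⁻¹ :=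
      Asymptotics.IsBigO.of_norm_left (by simpa using h2)
    refine (h3.mul h1).congr (fun τ => ?_) fun τ => ?_
    · have := e_ne_zero (τ / 2)
      field_simp
    · have := norm_ne_zero_iff.mpr (e_ne_zero (τ / 2))
      field_simp
  -- The remainder has order n + 2 in e(τ/2), one more than the negative power in front of it.
  · obtain ⟨C, hC⟩ := f_sub_sum_le 1 0 (n + 1 + 1)
    refine isBigO_one_of_le ⟨C, fun τ hτ => ?_⟩
    have h := hC τ hτ
    have h0 := norm_pos_iff.mpr (e_ne_zero (τ / 2))
    have h1 : ‖e (τ / 2)‖ < 1 := norm_e_half_lt_one (by linarith)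
    have hC0 : 0 ≤ C := nonneg_of_mul_nonneg_left ((norm_nonneg _).trans h) (by positivity)
    rw [norm_mul, norm_pow, norm_inv]
    refine (mul_le_mul_of_nonneg_left h (by positivity)).trans ?_
    rw [pow_succ ‖e (τ / 2)‖ (n + 1)]
    calc ‖e (τ / 2)‖⁻¹ ^ (n + 1) * (C * (‖e (τ / 2)‖ ^ (n + 1) * ‖e (τ / 2)‖))
        = C * ‖e (τ / 2)‖ := by
          rw [inv_pow]
          field_simp
      _ ≤ C := mul_le_of_le_one_right hC0 h1.le

theorem tendsto_add_one_atImTop : Tendsto (fun τ : ℂ => τ + 1) atImTop atImTop := by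
  have h := tendsto_affine one_pos one_pos 1
  simpa using h

theorem isBigO_coeff_defectSeries_one_one (n : ℕ) :
    (fun τ => PowerSeries.coeff n (defectSeries 1 1 τ)) =O[atImTop] fun _ => (1 : ℝ) := by
  refine ((isBigO_coeff_defectSeries_one_zero n).comp_tendsto tendsto_add_one_atImTop).congr' ?_
    EventuallyEq.rfl
  filter_upwards [eventually_le_im 1] with τ hτ
  have h := (isEquivariant_coeff_defectSeries n).translate 1 0 (τ := τ) (by linarith)
  rw [zero_add] at h
  exact h

/-- The three nonzero pairs (x,y) form one orbit of the modular group; multiplying over the orbit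
reduces the claim to level one. -/
theorem coeff_defectSeries_eq_zero (n : ℕ) {x y : ZMod 2} (hxy : ¬(x = 0 ∧ y = 0)) {τ : ℂ}
    (hτ : 0 < τ.im) : PowerSeries.coeff n (defectSeries x y τ) = 0 := by
  set D : ZMod 2 → ZMod 2 → ℂ → ℂ := fun x y τ => PowerSeries.coeff n (defectSeries x y τ) with hD
  have hE : IsEquivariant D := isEquivariant_coeff_defectSeries n
  have hd : ∀ x y, ∀ τ : ℂ, 0 < τ.im → DifferentiableAt ℂ (D x y) τ := fun x y τ hτ =>
    differentiableAt_coeff_defectSeries n x y hτ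
  have h11 : (1 : ZMod 2) + 1 = 0 := rfl
  have hT : ∀ τ : ℂ, 0 < τ.im → D 1 0 (τ + 1) = D 1 1 τ ∧ D 1 1 (τ + 1) = D 1 0 τ ∧
      D 0 1 (τ + 1) = D 0 1 τ := fun τ hτ => by
    rw [hE.translate _ _ hτ, hE.translate _ _ hτ, hE.translate _ _ hτ, zero_add, h11, add_zero]
    exact ⟨rfl, rfl, rfl⟩
  have hS : ∀ τ : ℂ, 0 < τ.im → D 1 0 (-1 / τ) = D 0 1 τ ∧ D 1 1 (-1 / τ) = D 1 1 τ ∧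
      D 0 1 (-1 / τ) = D 1 0 τ := fun τ hτ => by
    rw [hE.invert _ _ hτ, hE.invert _ _ hτ, hE.invert _ _ hτ, ZModModule.neg_eq_self,
      ZModModule.neg_eq_self]
    exact ⟨rfl, rfl, rfl⟩
  -- Translation exchanges D(1,0) with D(1,1) and inversion exchanges D(1,0) with D(0,1). At i∞ the
  -- product is bounded times bounded times o(1).
  have hprod : ∀ τ : ℂ, 0 < τ.im → D 1 0 τ * D 1 1 τ * D 0 1 τ = 0 := fun τ hτ => by
    refine eq_zero_of_level_one (P := fun τ => D 1 0 τ * D 1 1 τ * D 0 1 τ)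
      (fun τ hτ => ((hd _ _ τ hτ).mul (hd _ _ τ hτ)).mul (hd _ _ τ hτ)) (fun τ hτ => ?_)
      (fun τ hτ => ?_) ?_ hτ
    · obtain ⟨h1, h2, h3⟩ := hT τ hτ
      simp only [h1, h2, h3]
      ring
    · obtain ⟨h1, h2, h3⟩ := hS τ hτ
      simp only [h1, h2, h3]
      ring
    · have h1 := (isBigO_coeff_defectSeries_one_zero n).mul (isBigO_coeff_defectSeries_one_one n)
      have h2 := h1.mul_isLittleO ((Asymptotics.isLittleO_one_iff ℝ).mpr
        (tendsto_coeff_defectSeries_zero_one n))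
      simp only [mul_one] at h2
      exact (Asymptotics.isLittleO_one_iff ℝ).mp h2
  have hopen : IsOpen {z : ℂ | 0 < z.im} := isOpen_lt continuous_const Complex.continuous_im
  have hconn : IsPreconnected {z : ℂ | 0 < z.im} := (convex_halfSpace_im_gt 0).isPreconnected
  have han : ∀ x y, AnalyticOnNhd ℂ (D x y) {z : ℂ | 0 < z.im} := fun x y =>
    DifferentiableOn.analyticOnNhd (fun z hz => (hd x y z hz).differentiableWithinAt) hopen
  have hone : ∀ τ : ℂ, 0 < τ.im → (τ + 1).im > 0 := fun τ hτ => by simpa using hτ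
  have h01 : ∀ τ : ℂ, 0 < τ.im → D 0 1 τ = 0 := by
    -- Analytic functions on the connected half-plane have no zero divisors, so one factor is
    -- identically zero; equivariance transports this to D(0,1).
    rcases ((han 1 0).mul (han 1 1)).eq_zero_or_eq_zero_of_mul_eq_zero (han 0 1) hprod hconn
      with h | h
    · have h10 : ∀ τ : ℂ, 0 < τ.im → D 1 0 τ = 0 := by
        rcases (han 1 0).eq_zero_or_eq_zero_of_mul_eq_zero (han 1 1) h hconn with h | h
        · exact h
        · intro τ hτ
          rw [← (hT τ hτ).2.1]
          exact h _ (hone τ hτ)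
      intro τ hτ
      rw [← (hS τ hτ).1]
      exact h10 _ (im_neg_inv_pos hτ)
    · exact h
  have h10 : ∀ τ : ℂ, 0 < τ.im → D 1 0 τ = 0 := fun τ hτ => by
    rw [← (hS τ hτ).2.2]
    exact h01 _ (im_neg_inv_pos hτ)
  rcases zmod_two_eq x with rfl | rfl <;> rcases zmod_two_eq y with rfl | rfl
  · exact (hxy ⟨rfl, rfl⟩).elim
  · exact h01 τ hτ
  · exact h10 τ hτ
  · exact (hT τ hτ).1.symm.trans (h10 _ (hone τ hτ))

theorem liftSeries_eq_diffSeries {x y : ZMod 2} (hxy : ¬(x = 0 ∧ y = 0)) {τ : ℂ} (hτ : 0 < τ.im) :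
    liftSeries f x y τ = diffSeries x y τ := by
  have hL : PowerSeries.constantCoeff (-heckeSeries f x y τ) = 0 := by
    rw [← PowerSeries.coeff_zero_eq_constantCoeff_apply]
    simp [heckeSeries]
  have hH : heckeSumSeries x y τ =
      PowerSeries.X * PowerSeries.derivative ℂ (heckeSeries f x y τ) := by
    ext m
    rw [coeff_X_mul_derivative, heckeSumSeries, heckeSeries, PowerSeries.coeff_mk,
      PowerSeries.coeff_mk]
    rcases eq_or_ne m 0 with rfl | hm
    · simp [heckeSum]
    · have : (m : ℂ) ≠ 0 := by exact_mod_cast hm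
      rw [if_neg hm, hecke_eq]
      field_simp
  have hD : defectSeries x y τ = 0 := PowerSeries.ext fun n => by
    rw [coeff_defectSeries_eq_zero n hxy hτ, map_zero]
  -- Both series have constant term 1 and logarithmic derivative D; for `diffSeries` this is the
  -- vanishing of the defect, divided by p.
  refine eq_of_derivative_eq_mul (D := PowerSeries.derivative ℂ (-heckeSeries f x y τ)) ?_
    (derivative_exp_subst hL) ?_
  · rw [liftSeries, constantCoeff_exp_subst hL, ← PowerSeries.coeff_zero_eq_constantCoeff_apply,
      coeff_diffSeries, hauptCoeff_zero]
    simp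
  · rw [defectSeries, hH, mul_assoc, ← mul_add] at hD
    have h := (mul_eq_zero.mp hD).resolve_left PowerSeries.X_ne_zero
    rw [map_neg]
    linear_combination h


/-! ### The values of the lifts -/

theorem hasSum_diffSeries (x y : ZMod 2) (τ : ℂ) {p : ℂ} (hp : ‖p‖ < 1) (hp0 : p ≠ 0) :
    HasSum (fun k => PowerSeries.coeff k (diffSeries x y τ) * p ^ k)
      (oddProd p ^ 24 + 24 * p - f x y τ * p) := by
  have h1 := hasSum_single (f := fun k : ℕ => (f x y τ * if k = 1 then 1 else 0) * p ^ k) 1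
    fun k hk => by rw [if_neg hk, mul_zero, zero_mul]
  rw [if_pos rfl, mul_one, pow_one] at h1
  refine ((hasSum_hauptCoeff hp hp0).sub h1).congr_fun fun k => ?_
  rw [coeff_diffSeries]
  ring

theorem hasSum_liftSeries {x y : ZMod 2} (hxy : ¬(x = 0 ∧ y = 0)) {σ τ : ℂ} (hσ : 0 < σ.im)
    (hτ : 0 < τ.im) :
    HasSum (fun k => PowerSeries.coeff k (liftSeries f x y τ) * e σ ^ k)
      (e σ * (f 1 0 (2 * σ) - f x y τ)) := by
  have h := hasSum_diffSeries x y τ (norm_e_lt_one hσ) (e_ne_zero σ)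
  rw [liftSeries_eq_diffSeries hxy hτ]
  convert h using 1
  have h1 := e_ne_zero σ
  rw [f_eq_traceChar 1 0 (im_two_mul_pos hσ), mul_div_cancel_left₀ σ two_ne_zero,
    traceChar_one_zero (norm_e_lt_one hσ) h1]
  field_simp

theorem coeff_neg_heckeSeries (x y : ZMod 2) (τ : ℂ) (m : ℕ) :
    PowerSeries.coeff m (-heckeSeries f x y τ) = -(1 / (m : ℂ) * heckeSum m f x y τ) := by
  rw [map_neg, heckeSeries, PowerSeries.coeff_mk]
  split_ifs with hm
  · simp [hm]
  · rw [hecke_eq]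

theorem coeff_neg_heckeSeries_zero (y : ZMod 2) (τ : ℂ) (m : ℕ) :
    PowerSeries.coeff m (-heckeSeries f 0 y τ) = ∑ ad ∈ m.divisorsAntidiagonal,
      -(1 / (ad.1 : ℂ) * (1 / (ad.2 : ℂ) * ∑ b ∈ Finset.range ad.2,
        f 0 (ad.1 * y) ((ad.1 * τ + b) / ad.2))) := by
  rw [coeff_neg_heckeSeries, heckeSum, Finset.mul_sum, ← Finset.sum_neg_distrib]
  refine Finset.sum_congr rfl fun ad had => ?_
  rw [← (Nat.mem_divisorsAntidiagonal.mp had).1]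
  simp only [mul_zero, sub_zero, Nat.cast_mul]
  ring

theorem norm_one_div_natCast_le (a : ℕ) : ‖(1 / (a : ℂ))‖ ≤ 1 := by
  rw [norm_div, norm_one, Complex.norm_natCast]
  rcases Nat.eq_zero_or_pos a with rfl | ha
  · simp
  · rw [div_le_one (by positivity)]
    exact_mod_cast ha

/-- Since f(0,0) = -24, the d summands over b cancel the factor 1/d, and the exponent is 24 ∑
p^(ad)/a = -24 ∑ log(1 - p^d). -/
theorem hasSum_liftSeries_zero_zero {σ τ : ℂ} (hσ : 0 < σ.im) (hτ : 0 < τ.im) :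
    HasSum (fun k => PowerSeries.coeff k (liftSeries f 0 0 τ) * e σ ^ k)
      ((eulerProd (e σ))⁻¹ ^ 24) := by
  have hp := norm_e_lt_one hσ
  have hL : ∀ m, PowerSeries.coeff m (-heckeSeries f 0 0 τ) =
      ∑ ad ∈ m.divisorsAntidiagonal, 24 * (1 / (ad.1 : ℂ)) := fun m => by
    rw [coeff_neg_heckeSeries_zero]
    refine Finset.sum_congr rfl fun ad had => ?_
    obtain ⟨h1, h2⟩ := pos_of_mem_divisorsAntidiagonal had
    have h3 : (ad.2 : ℂ) ≠ 0 := by exact_mod_cast h2.ne'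
    rw [Finset.sum_congr rfl fun b _ => by
      rw [mul_zero, f_zero_zero (affine_im_pos h1 h2 b hτ)]]
    rw [Finset.sum_const, Finset.card_range, nsmul_eq_mul]
    field_simp
  obtain ⟨a, h1, h2⟩ := hasSum_pnat_prod hp (w := fun a => 24 * (1 / (a : ℂ))) (C := 24)
    (fun a => by
      have := norm_one_div_natCast_le a
      rw [norm_mul]
      norm_num at this ⊢
      linarith)
    (r := fun z => 24 * -Complex.log (1 - z))
    (fun z hz => ((hasSum_pnat_log hz).mul_left 24).congr_fun fun a => by ring)
  have h3 := hasSum_exp_subst_of_divisors hL h1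
  have h5 : HasProd (fun d : ℕ+ => (1 - e σ ^ (d : ℕ))⁻¹ ^ 24) ((eulerProd (e σ))⁻¹ ^ 24) := by
    rw [hasProd_pnat_iff (F := fun d => (1 - e σ ^ d)⁻¹ ^ 24)]
    exact ((hasProd_eulerProd hp).inv₀ (eulerProd_ne_zero hp)).pow 24
  have h6 : Complex.exp a = (eulerProd (e σ))⁻¹ ^ 24 := by
    refine h2.cexp.unique (h5.congr_fun fun d => ?_)
    have h0 : 1 - e σ ^ (d : ℕ) ≠ 0 := fun h => by
      have := norm_pow_lt_one hp d
      rw [← sub_eq_zero.mp h, norm_one] at this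
      exact lt_irrefl _ this
    rw [Function.comp_apply, show (24 : ℂ) * -Complex.log (1 - e σ ^ (d : ℕ)) =
      (24 : ℕ) * -Complex.log (1 - e σ ^ (d : ℕ)) by norm_num, Complex.exp_nat_mul,
      Complex.exp_neg, Complex.exp_log h0]
  rwa [h6] at h3

/-! ### The superdenominator -/

theorem dimL₀_eq_zero_of_neg {X : Sector} {n : ℤ} (hn : n < 0) : dimL₀ X (n + 1 / 2) = 0 := by
  have h := dimL₀_eq_zero_of_lt (X := X) (k := 2 * n) (by cases X <;> simp only [shift] <;> omega)
  rwa [show ((2 * n : ℤ) : ℚ) / 2 = n by push_cast; ring] at h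

theorem evenMult_eq (m : ℕ+) (n : ℤ) :
    evenMult m n = dimL₀ .S ((((m : ℕ) : ℤ) * n : ℤ) + 1 / 2) := by
  rw [evenMult]
  push_cast
  rfl

theorem oddMult_eq (m : ℕ+) (n : ℤ) :
    oddMult m n = dimL₀ .V ((((m : ℕ) : ℤ) * n : ℤ) + 1 / 2) := by
  rw [oddMult]
  push_cast
  rfl

theorem mult_eq_zero_of_neg (m : ℕ+) {n : ℤ} (hn : n < 0) : evenMult m n = 0 ∧ oddMult m n = 0 := by
  have h : ((m : ℕ) : ℤ) * n < 0 := mul_neg_of_pos_of_neg (by exact_mod_cast m.pos) hn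
  rw [evenMult_eq, oddMult_eq]
  exact ⟨dimL₀_eq_zero_of_neg h, dimL₀_eq_zero_of_neg h⟩

theorem norm_e_root_le {σ τ : ℂ} (hτ : 0 < τ.im) (m : ℕ+) {n : ℤ} (hn : 0 ≤ n) :
    ‖e (((m : ℕ) : ℂ) * σ + (n : ℂ) * τ)‖ ≤ ‖e σ‖ ^ (m : ℕ) := by
  have hq := norm_e_lt_one hτ
  lift n to ℕ using hn
  rw [e_add, e_natCast_mul, e_intCast_mul, norm_mul, norm_pow, zpow_natCast, norm_pow]
  exact mul_le_of_le_one_right (by positivity) (pow_le_one₀ (norm_nonneg _) hq.le)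

theorem norm_e_root_lt_one {σ τ : ℂ} (hσ : 0 < σ.im) (hτ : 0 < τ.im) (m : ℕ+) {n : ℤ} (hn : 0 ≤ n) :
    ‖e (((m : ℕ) : ℂ) * σ + (n : ℂ) * τ)‖ < 1 :=
  (norm_e_root_le hτ m hn).trans_lt (pow_lt_one₀ (norm_nonneg _) (norm_e_lt_one hσ) m.ne_zero)

/-- By `dimL₀_S_eq_V` every factor with n ≠ 0 equals 1; the roots (m, 0) have multiplicity 0 in `S`
and 24 in `V`. -/
theorem hasProd_superdenominatorFactor {σ τ : ℂ} (hσ : 0 < σ.im) (hτ : 0 < τ.im) :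
    HasProd (superdenominatorFactor σ τ) ((eulerProd (e σ))⁻¹ ^ 24) := by
  have hp := norm_e_lt_one hσ
  have hinj : Function.Injective fun m : ℕ+ => (m, (0 : ℤ)) := fun a b h => congrArg Prod.fst h
  refine (hinj.hasProd_iff fun α hα => ?_).mp ?_
  · obtain ⟨m, n⟩ := α
    have hn : n ≠ 0 := by
      rintro rfl
      exact hα ⟨m, rfl⟩
    rw [superdenominatorFactor]
    rcases lt_or_gt_of_ne hn with h | h
    · obtain ⟨h1, h2⟩ := mult_eq_zero_of_neg m h
      simp only [h1, h2, pow_zero, div_one]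
    · have h1 : evenMult m n = oddMult m n := by
        rw [evenMult_eq, oddMult_eq]
        exact dimL₀_S_eq_V (mul_ne_zero (by exact_mod_cast m.ne_zero) hn)
      simp only [h1]
      refine div_self (pow_ne_zero _ fun h2 => ?_)
      have h3 := norm_e_root_lt_one hσ hτ m h.le
      rw [← sub_eq_zero.mp h2, norm_one] at h3
      exact lt_irrefl _ h3
  · have h5 : HasProd (fun d : ℕ+ => (1 - e σ ^ (d : ℕ))⁻¹ ^ 24) ((eulerProd (e σ))⁻¹ ^ 24) := by
      rw [hasProd_pnat_iff (F := fun d => (1 - e σ ^ d)⁻¹ ^ 24)]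
      exact ((hasProd_eulerProd hp).inv₀ (eulerProd_ne_zero hp)).pow 24
    refine h5.congr_fun fun m => ?_
    have hS := dimL₀_eq_zero_of_lt (X := .S) (k := 0) (by simp [shift])
    rw [Int.cast_zero, zero_div, zero_add] at hS
    have h1 : evenMult m 0 = 0 := by
      rw [evenMult, Int.cast_zero, mul_zero, zero_add, hS]
    have h2 : oddMult m 0 = 24 := by
      rw [oddMult, Int.cast_zero, mul_zero, zero_add, dimL₀_V_half]
    rw [Function.comp_apply, superdenominatorFactor]
    simp only [h1, h2, Int.cast_zero, zero_mul, add_zero, pow_zero, e_natCast_mul]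
    rw [inv_pow, one_div]

/-! ### The denominator -/

theorem hasSum_f_zero (y : ZMod 2) {τ : ℂ} (hτ : 0 < τ.im) :
    HasSum (fun j : ℕ => (traceCoeff 0 y j : ℂ) * e τ ^ j) (f 0 y τ) := by
  have hinj : Function.Injective fun j : ℕ => (2 * j : ℤ) := fun a b h => by
    simpa using h
  refine ((hinj.hasSum_iff fun k hk => ?_).mpr (hasSum_f 0 y hτ)).congr_fun fun j => ?_
  · rcases lt_or_ge k 0 with h | h
    · rw [traceCoeff_zero_eq_zero_of_neg y h, Int.cast_zero, zero_mul]
    · have hodd : k % 2 = 1 := by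
        by_contra h1
        exact hk ⟨(k / 2).toNat, by simp only; omega⟩
      have hS := dimL₀_eq_zero_of_odd (X := .S) (by simp) hodd
      have hV := dimL₀_eq_zero_of_odd (X := .V) (by simp) hodd
      rcases zmod_two_eq y with rfl | rfl
      · rw [traceCoeff_zero_zero, hS, hV]; simp
      · rw [traceCoeff_zero_one, hS, hV]; simp
  · rw [Function.comp_apply, ← e_half_sq, ← pow_mul,
      show (((2 * j : ℤ) : ℚ) / 2) = j by push_cast; ring]
    norm_cast

theorem sum_e_div (d : ℕ) (hd : 0 < d) (j : ℕ) :
    ∑ b ∈ Finset.range d, e (j * b / d) = if d ∣ j then (d : ℂ) else 0 := by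
  have hd0 : (d : ℂ) ≠ 0 := by exact_mod_cast hd.ne'
  have h1 : ∀ b : ℕ, e (j * b / d) = e (j / d) ^ b := fun b => by
    rw [← e_natCast_mul]
    congr 1
    ring
  simp only [h1]
  split_ifs with h
  · obtain ⟨n, rfl⟩ := h
    have hn : e (n : ℂ) = 1 := by exact_mod_cast e_intCast n
    rw [Nat.cast_mul, mul_div_cancel_left₀ _ hd0, hn]
    simp
  · refine sum_pow_eq_zero ?_ fun h2 => h ?_
    · have hj : e (j : ℂ) = 1 := by exact_mod_cast e_intCast j
      rw [← e_natCast_mul, mul_div_cancel₀ _ hd0, hj]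
    · rw [e, Complex.exp_eq_one_iff] at h2
      obtain ⟨n, hn⟩ := h2
      have h3 : (j / d : ℂ) = n := by
        refine mul_left_cancel₀ Complex.two_pi_I_ne_zero ?_
        rw [hn, mul_comm]
      rw [div_eq_iff hd0] at h3
      have h4 : (j : ℤ) = n * d := by exact_mod_cast h3
      exact Int.natCast_dvd_natCast.mp ⟨n, by rw [h4, mul_comm]⟩

/-- Orthogonality of the d-th roots of unity keeps only the exponents j = dn, and q^(aj/d) = q^(an).
-/
theorem hasSum_average (y : ZMod 2) {a d : ℕ} (ha : 0 < a) (hd : 0 < d) {τ : ℂ} (hτ : 0 < τ.im) :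
    HasSum (fun n : ℕ => (traceCoeff 0 y ((d : ℚ) * n) : ℂ) * e τ ^ (a * n))
      (1 / (d : ℂ) * ∑ b ∈ Finset.range d, f 0 y ((a * τ + b) / d)) := by
  have hd0 : (d : ℂ) ≠ 0 := by exact_mod_cast hd.ne'
  have h1 := (hasSum_sum (s := Finset.range d) fun b _ =>
    hasSum_f_zero y (affine_im_pos ha hd b hτ)).mul_left (1 / (d : ℂ))
  have h2 : ∀ j : ℕ, 1 / (d : ℂ) * ∑ b ∈ Finset.range d,
      (traceCoeff 0 y j : ℂ) * e ((a * τ + b) / d) ^ j =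
        if d ∣ j then (traceCoeff 0 y j : ℂ) * e (j * (a * τ) / d) else 0 := fun j => by
    have h3 : ∀ b : ℕ, (traceCoeff 0 y j : ℂ) * e ((a * τ + b) / d) ^ j =
        (traceCoeff 0 y j : ℂ) * e (j * (a * τ) / d) * e (j * b / d) := fun b => by
      rw [← e_natCast_mul, mul_assoc, ← e_add]
      congr 2
      ring
    simp only [h3]
    rw [← Finset.mul_sum, sum_e_div d hd]
    split_ifs
    · field_simp
    · simp
  simp only [h2] at h1
  have hinj : Function.Injective fun n : ℕ => d * n := fun x y h => Nat.eq_of_mul_eq_mul_left hd h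
  refine ((hinj.hasSum_iff fun j hj => if_neg fun ⟨n, hn⟩ => hj ⟨n, hn.symm⟩).mpr h1).congr_fun
    fun n => ?_
  rw [Function.comp_apply, if_pos (dvd_mul_right d n), ← e_natCast_mul]
  push_cast
  congr 2
  field_simp

theorem traceCoeff_zero_eq_mult (d : ℕ+) (n : ℤ) (a : ℕ) :
    (traceCoeff 0 (a : ZMod 2) (((d : ℕ) : ℚ) * n) : ℂ) =
      evenMult d n - (-1) ^ a * oddMult d n := by
  rw [← sgn_natCast, sgn, evenMult, oddMult]
  rcases zmod_two_eq (a : ZMod 2) with h | h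
  · rw [h, traceCoeff_zero_zero]
    simp
  · rw [h, traceCoeff_zero_one]
    simp

/-! ### Growth of the multiplicities -/

theorem norm_oddProd_le_one {r : ℝ} (hr0 : 0 < r) (hr : r < 1) : ‖oddProd r‖ ≤ 1 := by
  have hr' : ‖(r : ℂ)‖ < 1 := by rwa [Complex.norm_real, Real.norm_of_nonneg hr0.le]
  refine le_of_tendsto (tendsto_prod_range (hasProd_oddProd hr')).norm
    (Eventually.of_forall fun N => ?_)
  rw [norm_prod]
  refine Finset.prod_le_one (fun _ _ => norm_nonneg _) fun j _ => ?_
  have h1 : r ^ (2 * j + 1) ≤ 1 := pow_le_one₀ hr0.le hr.le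
  have h2 : 0 < r ^ (2 * j + 1) := by positivity
  rw [show (1 + (r : ℂ) ^ (2 * j + 1) * (-1)) = ((1 - r ^ (2 * j + 1) : ℝ) : ℂ) by push_cast; ring,
    Complex.norm_real, Real.norm_of_nonneg (by linarith)]
  linarith

theorem e_ofReal_mul_I (t : ℝ) : e (t * Complex.I) = (Real.exp (-(2 * Real.pi * t)) : ℝ) := by
  rw [e, Complex.ofReal_exp]
  congr 1
  push_cast
  linear_combination 2 * (Real.pi : ℂ) * t * Complex.I_mul_I

theorem traceCoeff_zero_one_nonneg (n : ℚ) : 0 ≤ traceCoeff 0 1 n := by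
  rw [traceCoeff_zero_one]; positivity

/-- The coefficients are nonnegative, so a single term is at most the whole sum f(0,1;iy) =
f(1,0;i/y). The latter is bounded by its pole e^(π/y) plus 24, because ∏(1 - r^(2j+1)) ≤ 1. -/
theorem traceCoeff_zero_one_le {y : ℝ} (hy : 0 < y) (N : ℕ) :
    (traceCoeff 0 1 N : ℝ) ≤
      (Real.exp (Real.pi / y) + 24) * Real.exp (2 * Real.pi * y * N) := by
  have hpi := Real.pi_pos
  have him : 0 < ((y : ℂ) * Complex.I).im := by simpa using hy
  have him' : 0 < (((1 / y : ℝ) : ℂ) * Complex.I).im := by simpa using hy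
  set r : ℝ := Real.exp (-(Real.pi / y)) with hr
  have hr0 : 0 < r := Real.exp_pos _
  have hr1 : r < 1 := Real.exp_lt_one_iff.mpr (by rw [neg_lt_zero]; positivity)
  have hval : ‖f 0 1 (y * Complex.I)‖ ≤ Real.exp (Real.pi / y) + 24 := by
    have h1 : f 0 1 (y * Complex.I) = f 1 0 (((1 / y : ℝ) : ℂ) * Complex.I) := by
      rw [← f_neg_inv 0 1 him']
      congr 1
      have : (y : ℂ) ≠ 0 := by exact_mod_cast hy.ne'
      push_cast
      field_simp
      exact Complex.I_sq
    have h2 : e (((1 / y : ℝ) : ℂ) * Complex.I / 2) = (r : ℂ) := by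
      rw [show ((1 / y : ℝ) : ℂ) * Complex.I / 2 = ((1 / (2 * y) : ℝ) : ℂ) * Complex.I by
        push_cast; ring, e_ofReal_mul_I, hr]
      congr 3
      field_simp
    have h3 := norm_e_half_lt_one him'
    rw [h1, f_eq_traceChar 1 0 him', traceChar_one_zero h3 (e_ne_zero _), h2]
    refine (norm_add_le _ _).trans ?_
    have h4 := norm_oddProd_le_one hr0 hr1
    rw [norm_div, norm_pow, Complex.norm_real, Real.norm_of_nonneg hr0.le]
    refine add_le_add ?_ (by norm_num)
    have h5 : Real.exp (Real.pi / y) = 1 / r := by rw [hr, Real.exp_neg, one_div, inv_inv]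
    rw [h5]
    exact div_le_div_of_nonneg_right (pow_le_one₀ (norm_nonneg _) h4) hr0.le
  have hs := hasSum_f_zero 1 him
  have hterm : ∀ j : ℕ, (traceCoeff 0 1 j : ℂ) * e (y * Complex.I) ^ j =
      ((traceCoeff 0 1 j * Real.exp (-(2 * Real.pi * y)) ^ j : ℝ) : ℂ) := fun j => by
    rw [e_ofReal_mul_I]
    push_cast
    rfl
  simp only [hterm] at hs
  have hs' := Complex.hasSum_re hs
  simp only [Complex.ofReal_re] at hs'
  have hle := le_hasSum hs' N fun j _ =>
    mul_nonneg (by exact_mod_cast traceCoeff_zero_one_nonneg j) (by positivity)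
  have hle' := hle.trans ((Complex.re_le_norm _).trans hval)
  rw [← Real.exp_nat_mul] at hle'
  have h6 := mul_le_mul_of_nonneg_right hle' (Real.exp_pos (2 * Real.pi * y * N)).le
  rwa [mul_assoc, ← Real.exp_add, show N * -(2 * Real.pi * y) + 2 * Real.pi * y * N = 0 by ring,
    Real.exp_zero, mul_one] at h6

theorem summable_roots {σ τ : ℂ} (hσ : 0 < σ.im) (hτ : 0 < τ.im) (h : 1 / 2 < σ.im * τ.im) :
    Summable fun α : ℕ+ × ℕ => (traceCoeff 0 1 (((α.1 : ℕ) : ℚ) * α.2) : ℝ) *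
      (‖e σ‖ ^ (α.1 : ℕ) * ‖e τ‖ ^ α.2) := by
  have hpi := Real.pi_pos
  -- Im σ is split into θ Im σ, spent on the growth of the coefficients, and (1 - θ) Im σ, left for
  -- decay in d. The lower bound on θ gives B < 1 and the upper bound gives A < 1.
  obtain ⟨θ, hθ1, hθ2⟩ := exists_between (show 1 / (2 * (σ.im * τ.im)) < 1 by
    rw [div_lt_one (by positivity)]; linarith)
  have hθ0 : 0 < θ := lt_trans (by positivity) hθ1
  have hθ : 1 / (θ * σ.im) < 2 * τ.im := by
    rw [div_lt_iff₀ (by positivity)] at hθ1 ⊢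
    linarith
  set A := Real.exp (-(2 * Real.pi * ((1 - θ) * σ.im))) with hA
  set B := Real.exp (Real.pi * (1 / (θ * σ.im) - 2 * τ.im)) with hB
  have hA1 : A < 1 := Real.exp_lt_one_iff.mpr (by
    have : 0 < (1 - θ) * σ.im := mul_pos (by linarith) hσ
    rw [neg_lt_zero]; positivity)
  have hB1 : B < 1 := Real.exp_lt_one_iff.mpr (mul_neg_of_pos_of_neg hpi (by linarith))
  have hq1 := norm_e_lt_one hτ
  have hsA : Summable fun d : ℕ+ => A ^ (d : ℕ) :=
    (summable_geometric_of_lt_one (Real.exp_pos _).le hA1).comp_injective PNat.coe_injective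
  have hsB : Summable fun n : ℕ => B ^ n + 24 * ‖e τ‖ ^ n :=
    (summable_geometric_of_lt_one (Real.exp_pos _).le hB1).add
      ((summable_geometric_of_lt_one (norm_nonneg _) hq1).mul_left 24)
  have hA0 : 0 < A := Real.exp_pos _
  have hB0 : 0 < B := Real.exp_pos _
  refine Summable.of_nonneg_of_le (fun α => mul_nonneg
    (by exact_mod_cast traceCoeff_zero_one_nonneg _) (by positivity)) (fun α => ?_)
    (hsA.mul_of_nonneg hsB (fun d => by positivity) (fun n => by positivity))
  obtain ⟨d, n⟩ := α
  simp only
  have hbound : (traceCoeff 0 1 (((d : ℕ) : ℚ) * n) : ℝ) ≤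
      (Real.exp (Real.pi * (1 / (θ * σ.im)) * n) + 24) *
        Real.exp (2 * Real.pi * (θ * σ.im) * (d : ℕ)) := by
    rcases Nat.eq_zero_or_pos n with rfl | hn
    · have h0 := traceCoeff_index_zero 0 1
      rw [if_neg (by decide), sgn, if_neg (by decide)] at h0
      have h1 : traceCoeff 0 1 0 = 24 := by
        have : (traceCoeff 0 1 0 : ℂ) = (24 : ℤ) := by rw [h0]; norm_num
        exact_mod_cast this
      rw [Nat.cast_zero, mul_zero, h1, Nat.cast_zero, mul_zero, Real.exp_zero]
      have h2 : 1 ≤ Real.exp (2 * Real.pi * (θ * σ.im) * (d : ℕ)) := Real.one_le_exp (by positivity)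
      push_cast
      linarith
    · have hn0 : (0 : ℝ) < n := by exact_mod_cast hn
      -- This y makes one exponent linear in n and the other linear in d, so the estimate factors.
      -- For n = 0 it is undefined, and the coefficient 24 was treated directly.
      have h1 := traceCoeff_zero_one_le (y := θ * σ.im / n) (by positivity) (d * n)
      push_cast at h1
      rw [show Real.pi / (θ * σ.im / n) = Real.pi * (1 / (θ * σ.im)) * n by field_simp,
        show 2 * Real.pi * (θ * σ.im / n) * ((d : ℕ) * n) = 2 * Real.pi * (θ * σ.im) * (d : ℕ) by
          field_simp] at h1
      exact h1
  refine (mul_le_mul_of_nonneg_right hbound (by positivity)).trans_eq ?_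
  rw [norm_e σ, norm_e τ, hA, hB, ← Real.exp_nat_mul, ← Real.exp_nat_mul, ← Real.exp_nat_mul,
    ← Real.exp_nat_mul]
  have h1 : Real.exp (2 * Real.pi * (θ * σ.im) * (d : ℕ)) *
      Real.exp ((d : ℕ) * -(2 * Real.pi * σ.im)) =
        Real.exp ((d : ℕ) * -(2 * Real.pi * ((1 - θ) * σ.im))) := by
    rw [← Real.exp_add]; congr 1; ring
  have h2 : Real.exp (Real.pi * (1 / (θ * σ.im)) * n) * Real.exp (n * -(2 * Real.pi * τ.im)) =
      Real.exp (n * (Real.pi * (1 / (θ * σ.im) - 2 * τ.im))) := by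
    rw [← Real.exp_add]; congr 1; ring
  rw [← h1, ← h2]
  ring


/-! ### The logarithm of the denominator as a triple series -/

/-- The terms of the logarithm of the denominator: the contribution of the multiple `a (m, n)` of
the root `(m, n)`. -/
def logTerm (σ τ : ℂ) (q : (ℕ+ × ℤ) × ℕ+) : ℂ :=
  -(1 / ((q.2 : ℕ) : ℂ) * (traceCoeff 0 ((q.2 : ℕ) : ZMod 2) (((q.1.1 : ℕ) : ℚ) * q.1.2) : ℂ) *
    e (((q.1.1 : ℕ) : ℂ) * σ + (q.1.2 : ℂ) * τ) ^ (q.2 : ℕ))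

theorem traceCoeff_root_eq_zero_of_neg (y : ZMod 2) (m : ℕ+) {n : ℤ} (hn : n < 0) :
    traceCoeff 0 y (((m : ℕ) : ℚ) * n) = 0 := by
  have h := traceCoeff_zero_eq_zero_of_neg y (k := 2 * (((m : ℕ) : ℤ) * n)) (by
    have : ((m : ℕ) : ℤ) * n < 0 := mul_neg_of_pos_of_neg (by exact_mod_cast m.pos) hn
    omega)
  rwa [show ((2 * (((m : ℕ) : ℤ) * n) : ℤ) : ℚ) / 2 = ((m : ℕ) : ℚ) * n by push_cast; ring] at h

theorem norm_traceCoeff_zero_le (y : ZMod 2) (n : ℚ) :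
    ‖(traceCoeff 0 y n : ℂ)‖ ≤ (traceCoeff 0 1 n : ℝ) := by
  rw [Complex.norm_intCast]
  rcases zmod_two_eq y with rfl | rfl
  · rw [traceCoeff_zero_zero, traceCoeff_zero_one]
    push_cast
    exact (abs_sub _ _).trans_eq (by simp)
  · rw [abs_of_nonneg (by exact_mod_cast traceCoeff_zero_one_nonneg n)]

theorem summable_int_roots {σ τ : ℂ} (hσ : 0 < σ.im) (hτ : 0 < τ.im) (h : 1 / 2 < σ.im * τ.im) :
    Summable fun α : ℕ+ × ℤ => (traceCoeff 0 1 (((α.1 : ℕ) : ℚ) * α.2) : ℝ) *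
      ‖e (((α.1 : ℕ) : ℂ) * σ + (α.2 : ℂ) * τ)‖ := by
  have hinj : Function.Injective fun α : ℕ+ × ℕ => (α.1, (α.2 : ℤ)) := fun a b hab => by
    simpa [Prod.ext_iff] using hab
  refine (hinj.summable_iff fun α hα => ?_).mp ((summable_roots hσ hτ h).congr fun α => ?_)
  · rw [traceCoeff_root_eq_zero_of_neg 1 α.1, Int.cast_zero, zero_mul]
    by_contra hn
    exact hα ⟨(α.1, α.2.toNat), Prod.ext rfl (show ((α.2.toNat : ℕ) : ℤ) = α.2 by omega)⟩
  · simp only [Function.comp_apply, Int.cast_natCast]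
    rw [e_add, e_natCast_mul, e_natCast_mul, norm_mul, norm_pow, norm_pow]

/-- For n ≥ 0 one has |z| ≤ |p|, hence |z|^a ≤ |z| |p|^(a-1); this separates the sum over a as a
geometric series. -/
theorem summable_logTerm {σ τ : ℂ} (hσ : 0 < σ.im) (hτ : 0 < τ.im) (h : 1 / 2 < σ.im * τ.im) :
    Summable (logTerm σ τ) := by
  have hp := norm_e_lt_one hσ
  have hgeo : Summable fun a : ℕ+ => ‖e σ‖ ^ ((a : ℕ) - 1) := by
    rw [← Equiv.pnatEquivNat.symm.summable_iff]
    exact (summable_geometric_of_lt_one (norm_nonneg _) hp).congr fun n => by simp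
  refine Summable.of_norm_bounded ((summable_int_roots hσ hτ h).mul_of_nonneg hgeo
    (fun α => mul_nonneg (Int.cast_nonneg (traceCoeff_zero_one_nonneg _)) (norm_nonneg _))
    fun a => by positivity) fun q => ?_
  obtain ⟨⟨m, n⟩, a⟩ := q
  rcases lt_or_ge n 0 with hn | hn
  · simp only [logTerm, traceCoeff_root_eq_zero_of_neg _ m hn]
    simp
  · simp only [logTerm, norm_neg]
    rw [norm_mul, norm_mul, norm_pow]
    have h1 := norm_one_div_natCast_le (a : ℕ)
    have h2 := norm_traceCoeff_zero_le ((a : ℕ) : ZMod 2) (((m : ℕ) : ℚ) * n)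
    have h3 : ‖e (((m : ℕ) : ℂ) * σ + (n : ℂ) * τ)‖ ≤ ‖e σ‖ :=
      (norm_e_root_le hτ m hn).trans (pow_le_of_le_one (norm_nonneg _) hp.le m.ne_zero)
    set z := e (((m : ℕ) : ℂ) * σ + (n : ℂ) * τ)
    have h4 : ‖z‖ ^ (a : ℕ) ≤ ‖z‖ * ‖e σ‖ ^ ((a : ℕ) - 1) := by
      obtain ⟨b, hb⟩ : ∃ b, (a : ℕ) = b + 1 := ⟨(a : ℕ) - 1, by have := a.pos; omega⟩
      rw [hb, Nat.add_sub_cancel, pow_succ']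
      gcongr
    rw [mul_assoc ((traceCoeff 0 1 (((m : ℕ) : ℚ) * n) : ℤ) : ℝ)]
    refine mul_le_mul ((mul_le_of_le_one_left (norm_nonneg _) h1).trans h2) h4 (by positivity) ?_
    exact_mod_cast traceCoeff_zero_one_nonneg _

/-- The coefficient at a is the even multiplicity minus (-1)^a times the odd one. The row therefore
sums to `evenMult` · log(1 - z) - `oddMult` · log(1 + z), and the sign (-1)^a is what produces 1 +
z. -/
theorem exists_hasSum_logTerm_row {σ τ : ℂ} (hσ : 0 < σ.im) (hτ : 0 < τ.im) (α : ℕ+ × ℤ) :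
    ∃ r, HasSum (fun a => logTerm σ τ (α, a)) r ∧ Complex.exp r = denominatorFactor σ τ α := by
  obtain ⟨m, n⟩ := α
  rcases lt_or_ge n 0 with hn | hn
  · refine ⟨0, ?_, ?_⟩
    · refine hasSum_zero.congr_fun fun a => ?_
      simp only [logTerm, traceCoeff_root_eq_zero_of_neg _ m hn]
      simp
    · obtain ⟨h1, h2⟩ := mult_eq_zero_of_neg m hn
      simp only [denominatorFactor, h1, h2, pow_zero, div_one, Complex.exp_zero]
  · have hz := norm_e_root_lt_one hσ hτ m hn
    simp only [denominatorFactor, logTerm, traceCoeff_zero_eq_mult]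
    set z := e (((m : ℕ) : ℂ) * σ + (n : ℂ) * τ)
    refine ⟨_, (((hasSum_pnat_log hz).mul_left (-(evenMult m n : ℂ))).add
      ((hasSum_pnat_log_neg hz).mul_left (oddMult m n : ℂ))).congr_fun fun a => by ring, ?_⟩
    have h1 : 1 - z ≠ 0 := fun h => by
      rw [← sub_eq_zero.mp h, norm_one] at hz
      exact lt_irrefl _ hz
    have h2 : 1 + z ≠ 0 := fun h => by
      rw [← neg_eq_iff_add_eq_zero] at h
      rw [← h, norm_neg, norm_one] at hz
      exact lt_irrefl _ hz
    rw [neg_mul_neg, Complex.exp_add, Complex.exp_nat_mul, Complex.exp_nat_mul, Complex.exp_neg,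
      Complex.exp_log h1, Complex.exp_log h2, inv_pow, div_eq_mul_inv]

theorem hasProd_denominatorFactor {σ τ : ℂ} (hσ : 0 < σ.im) (hτ : 0 < τ.im)
    (h : 1 / 2 < σ.im * τ.im) : HasProd (denominatorFactor σ τ) (Ψ f 0 1 σ τ) := by
  have hs := summable_logTerm hσ hτ h
  choose r hr hexp using exists_hasSum_logTerm_row (σ := σ) (τ := τ) hσ hτ
  have h1 := (hs.hasSum.prod_fiberwise hr).cexp
  have h2 : Complex.exp ∘ r = denominatorFactor σ τ := funext hexp
  rw [h2] at h1
  -- The same series is now grouped by (a, d), where d is the first entry of the root; the inner sum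
  -- over n is the average over b in the Hecke operator.
  let E : (ℕ+ × ℕ+) × ℤ ≃ (ℕ+ × ℤ) × ℕ+ :=
    { toFun := fun q => ((q.1.2, q.2), q.1.1)
      invFun := fun q => ((q.2, q.1.1), q.1.2)
      left_inv := fun _ => rfl
      right_inv := fun _ => rfl }
  have hL := coeff_neg_heckeSeries_zero 1 τ
  have h3 : HasSum (fun q : ℕ+ × ℕ+ => -(1 / ((q.1 : ℕ) : ℂ) * (1 / ((q.2 : ℕ) : ℂ) *
      ∑ b ∈ Finset.range (q.2 : ℕ), f 0 (((q.1 : ℕ) : ZMod 2) * 1)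
        ((((q.1 : ℕ) : ℂ) * τ + b) / ((q.2 : ℕ) : ℂ)))) * e σ ^ ((q.1 : ℕ) * q.2))
      (∑' q, logTerm σ τ q) := by
    refine (E.hasSum_iff.mpr hs.hasSum).prod_fiberwise fun q => ?_
    obtain ⟨a, d⟩ := q
    have h4 := (hasSum_average (((a : ℕ) : ZMod 2) * 1) a.pos d.pos hτ).mul_left
      (-(1 / ((a : ℕ) : ℂ)) * e σ ^ ((a : ℕ) * d))
    refine (Function.Injective.hasSum_iff Nat.cast_injective (f := fun n : ℤ =>
      logTerm σ τ ((d, n), a)) fun n hn => ?_).mp ?_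
    · have hn0 : n < 0 := by
        by_contra hn0
        exact hn ⟨n.toNat, by omega⟩
      simp only [logTerm, traceCoeff_root_eq_zero_of_neg _ d hn0]
      simp
    · have h6 : ∀ s t : ℂ, -(1 / ((a : ℕ) : ℂ) * s) * t = -(1 / ((a : ℕ) : ℂ)) * t * s :=
        fun s t => by ring
      dsimp only
      rw [h6]
      refine h4.congr_fun fun n => ?_
      simp only [Function.comp_apply, logTerm, Int.cast_natCast, mul_one]
      rw [e_add, e_natCast_mul, e_natCast_mul, mul_pow, ← pow_mul, ← pow_mul, mul_comm (a : ℕ) n,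
        mul_comm (a : ℕ) d]
      ring
  have h5 := hasSum_exp_subst_of_divisors hL h3
  rw [Ψ, liftSeries, h5.tsum_eq]
  exact h1

end ConwayDenominator

end

/-! ### Assembly of the theorem -/

open ConwayDenominator in
theorem mainTheorem2 (σ τ : ℍ) :
    -- the power series in `p` converge
    (∀ x y : ZMod 2,
      Summable (fun k : ℕ => PowerSeries.coeff k (liftSeries f x y (τ : ℂ)) * e (σ : ℂ) ^ k)) ∧
    -- the four identities
    (e σ)⁻¹ * Ψ f 0 0 σ τ = 1 / ModularForm.eta σ ^ 24 - 24 - f 0 0 τ ∧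
    (e σ)⁻¹ * Ψ f 0 1 σ τ =
      ModularForm.eta σ ^ 24 / ModularForm.eta (2 * (σ : ℂ)) ^ 24 + 24 - f 0 1 τ ∧
    (e σ)⁻¹ * Ψ f 1 0 σ τ = f 1 0 (2 * (σ : ℂ)) - f 1 0 τ ∧
    (e σ)⁻¹ * Ψ f 1 1 σ τ = f 1 0 (2 * (σ : ℂ)) - f 1 1 τ ∧
    -- the first two lifts are the superdenominator and the denominator
    HasProd (superdenominatorFactor σ τ) (Ψ f 0 0 σ τ) ∧
    (1 / 2 < σ.im * τ.im → HasProd (denominatorFactor σ τ) (Ψ f 0 1 σ τ)) := by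
  have hσ : 0 < (σ : ℂ).im := σ.2
  have hτ : 0 < (τ : ℂ).im := τ.2
  have h00 := hasSum_liftSeries_zero_zero hσ hτ
  have hΨ00 : Ψ f 0 0 σ τ = (eulerProd (e σ))⁻¹ ^ 24 := h00.tsum_eq
  have hΨ : ∀ x y : ZMod 2, ¬(x = 0 ∧ y = 0) →
      (e σ)⁻¹ * Ψ f x y σ τ = f 1 0 (2 * (σ : ℂ)) - f x y τ := fun x y hxy => by
    rw [Ψ, (hasSum_liftSeries hxy hσ hτ).tsum_eq, inv_mul_cancel_left₀ (e_ne_zero _)]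
  refine ⟨fun x y => ?_, ?_, ?_, hΨ 1 0 (by decide), hΨ 1 1 (by decide), ?_, fun h => ?_⟩
  · by_cases hxy : x = 0 ∧ y = 0
    · obtain ⟨rfl, rfl⟩ := hxy
      exact h00.summable
    · exact (hasSum_liftSeries hxy hσ hτ).summable
  · rw [hΨ00, f_zero_zero hτ, eta_pow_eq, inv_pow, one_div, mul_inv]
    ring
  · rw [hΨ 0 1 (by decide), f_one_zero (im_two_mul_pos hσ),
      mul_div_cancel_left₀ (σ : ℂ) two_ne_zero]
  · rw [hΨ00]
    exact hasProd_superdenominatorFactor hσ hτ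
  · exact hasProd_denominatorFactor hσ hτ h
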